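/- Let $\mathrm{Sp}_2(\mathbb{R})=\{M\in\mathbb{R}^{4\times4}:\ M'JM=J\}$ with $J=\begin{pmatrix}0&-E\\E&0\end{pmatrix}$ ($E$ the $2\times2$ identity matrix, $'$ the transpose). Let $N\ge 1$ be a squarefree integer and let $\Sigma_N$ be the paramodular group of level $N$, i.e. the group of all $M\in\mathrm{Sp}_2(\mathbb{R})$ of the form $$(\ast)\qquad \begin{pmatrix} a_1&a_2N&b_1&b_2\\ a_3&a_4&b_3&b_4/N\\ c_1&c_2N&d_1&d_2\\ c_3N&c_4N&d_3N&d_4\end{pmatrix},\qquad a_i,b_i,c_i,d_i\in\mathbb{Z}.$$ Let $\mathbb{G}$ be the group of all matrices $\frac{1}{\sqrt m}K\in\mathrm{Sp}_2(\mathbb{R})$ with $m\ge1$ an integer and $K$ an integral matrix. For $M\in\mathbb{G}$ let $\nu(M)$ be the least positive integer $m$ such that $\sqrt m\,M$ has the form $(\ast)$, and for a prime $p$ let $\mathbb{G}_p$ be the subgroup of all $M\in\mathbb{G}$ for which $\nu(M)=p^r$ with some $r\ge0$. For a Hecke pair $(U,G)$ let $\mathcal{H}(U,G)$ denote its Hecke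 algebra over $\mathbb{Z}$: the free $\mathbb{Z}$-module on the double cosets $UgU$, $g\in G$, where the coefficient of $UxU$ in the product of $UgU=\bigsqcup_i Ug_i$ and $UhU=\bigsqcup_j Uh_j$ is the number of pairs $(i,j)$ with $Ug_ih_j=Ux$. For a prime $p$ put $$\mathcal{T}_{N,1}(p)=\Sigma_N\tfrac{1}{\sqrt p}\operatorname{diag}(1,1,p,p)\Sigma_N,\qquad \mathcal{T}_{N,2}(p)=\Sigma_N\tfrac1p\operatorname{diag}(1,p,p^2,p)\Sigma_N,$$ and for $p\mid N$ let $W_p=\begin{pmatrix}V_p&0\\0&V_p'^{-1}\end{pmatrix}$ with any $V_p=\frac{1}{\sqrt p}\begin{pmatrix}\alpha p&\beta N\\ \gamma&\delta p\end{pmatrix}$, $\alpha,\beta,\gamma,\delta\in\mathbb{Z}$, $\det V_p=1$ (such $V_p$ exist, and $W_p\in\mathbb{G}_p$). Theorem 5. The Hecke algebra $\mathcal{H}(\Sigma_N,\mathbb{G})$ is the tensor product over $\mathbb{Z}$ of its primary components $\mathcal{H}(\Sigma_N,\mathbb{G}_p)$, $p$ prime; that is, there is a ring isomorphism from $\bigotimes_p\mathcal{H}(\Sigma_N,\mathbb{G}_p)$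 (the direct limit of the tensor products over finite sets of primes) onto $\mathcal{H}(\Sigma_N,\mathbb{G})$ which on each factor is the natural inclusion $\Sigma_NM\Sigma_N\mapsto\Sigma_NM\Sigma_N$. For every prime $p$: (i) if $p\nmid N$, then $\mathcal{H}(\Sigma_N,\mathbb{G}_p)=\mathbb{Z}[\mathcal{T}_{N,1}(p),\mathcal{T}_{N,2}(p)]$ is the polynomial ring over $\mathbb{Z}$ in the algebraically independent elements $\mathcal{T}_{N,1}(p)$, $\mathcal{T}_{N,2}(p)$; (ii) if $p\mid N$, then $\mathcal{H}(\Sigma_N,\mathbb{G}_p)=\mathbb{Z}[\Sigma_NW_p\Sigma_N,\mathcal{T}_{N,1}(p),\mathcal{T}_{N,2}(p)]$, i.e. the (non-commutative) ring $\mathcal{H}(\Sigma_N,\mathbb{G}_p)$ is generated by these three double cosets; (iii) $\mathcal{H}(\Sigma_N,\mathbb{G}_p)$ is commutative if and only if $p\nmid N$. -/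

import Mathlib

open scoped Pointwise TensorProduct

namespace HeckeAlgebra

variable {G : Type*} [Group G] {Δ : Submonoid G} {U : Subgroup G}

/-- The double coset `U g U` as a set. -/
def carrier (D : HeckeCoset Δ U U) : Set G :=
  Quotient.lift (fun g : Δ => DoubleCoset.doubleCoset (g : G) U U) (fun _ _ h => h) D

/-- The set `U \ G` of right cosets `U g`. -/
abbrev RightCosets (U : Subgroup G) := Quotient (QuotientGroup.rightRel U)

/-- The right coset `U g`. -/
def rc (U : Subgroup G) (g : G) : RightCosets U := Quotient.mk _ g

/-- The coefficient at `U x U` of the product of double cosets `D₁ · D₂`: if `D₁`, `D₂` are the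
disjoint unions of the right cosets `U gᵢ`, `U hⱼ`, this is the number of pairs `(i, j)` with
`U gᵢ hⱼ = U x`, i.e. the number of cosets `U hⱼ ⊆ D₂` with `x hⱼ⁻¹ ∈ D₁`. -/
noncomputable def mulCoeff (D₁ D₂ : HeckeCoset Δ U U) (x : G) : ℕ :=
  {c : RightCosets U | ∃ h ∈ carrier D₂, c = rc U h ∧ x * h⁻¹ ∈ carrier D₁}.ncard

theorem rc_eq {g h : G} : rc U g = rc U h ↔ h * g⁻¹ ∈ U := by
  unfold rc
  rw [Quotient.eq, QuotientGroup.rightRel_apply]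

theorem rc_mul_left {u : G} (hu : u ∈ U) (g : G) : rc U (u * g) = rc U g := by
  rw [rc_eq]; simpa using hu

theorem rc_out (c : RightCosets U) : rc U c.out = c := Quotient.out_eq c

theorem carrier_mk (g : Δ) :
    carrier (HeckeCoset.mk U U g) = DoubleCoset.doubleCoset (g : G) U U := rfl

theorem mem_carrier_self (g : Δ) : (g : G) ∈ carrier (HeckeCoset.mk U U g) :=
  DoubleCoset.mem_doubleCoset_self U U _

theorem mem_carrier_iff {D : HeckeCoset Δ U U} (x : Δ) :
    (x : G) ∈ carrier D ↔ HeckeCoset.mk U U x = D := by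
  induction D using Quotient.inductionOn with
  | h g =>
    constructor
    · intro h
      exact Quotient.sound (DoubleCoset.doubleCoset_eq_of_mem h)
    · rintro h
      change _ ∈ carrier (HeckeCoset.mk U U g)
      rw [HeckeCoset.mk, ← h]
      exact mem_carrier_self x

theorem mul_mem_carrier {D : HeckeCoset Δ U U} {x u v : G} (hu : u ∈ U) (hv : v ∈ U)
    (hx : x ∈ carrier D) : u * x * v ∈ carrier D := by
  induction D using Quotient.inductionOn with
  | h g =>
    obtain ⟨a, ha, b, hb, rfl⟩ := DoubleCoset.mem_doubleCoset.1 hx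
    exact DoubleCoset.mem_doubleCoset.2
      ⟨u * a, mul_mem hu ha, b * v, mul_mem hb hv, by simp only [mul_assoc]⟩

theorem mem_carrier_left {D : HeckeCoset Δ U U} {x u : G} (hu : u ∈ U) :
    u * x ∈ carrier D ↔ x ∈ carrier D := by
  refine ⟨fun h => ?_, fun h => ?_⟩
  · simpa using mul_mem_carrier (inv_mem hu) (one_mem U) h
  · simpa using mul_mem_carrier hu (one_mem U) h

theorem mem_carrier_right {D : HeckeCoset Δ U U} {x u : G} (hu : u ∈ U) :
    x * u ∈ carrier D ↔ x ∈ carrier D := by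
  refine ⟨fun h => ?_, fun h => ?_⟩
  · simpa using mul_mem_carrier (one_mem U) (inv_mem hu) h
  · simpa using mul_mem_carrier (one_mem U) hu h

theorem carrier_nonempty (D : HeckeCoset Δ U U) : (carrier D).Nonempty := by
  induction D using Quotient.inductionOn with
  | h g => exact ⟨g, mem_carrier_self g⟩

theorem mulCoeff_mul_left (D₁ D₂ : HeckeCoset Δ U U) (x : G) {u : G} (hu : u ∈ U) :
    mulCoeff D₁ D₂ (u * x) = mulCoeff D₁ D₂ x := by
  simp only [mulCoeff, mul_assoc, mem_carrier_left hu]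

/-- The basis element of the Hecke algebra given by a double coset. -/
noncomputable def basis (D : HeckeCoset Δ U U) : HeckeRing Δ U ℤ :=
  HeckeCosetModule.of (Finsupp.single D 1)

theorem eq_sum_basis (f : HeckeRing Δ U ℤ) :
    f = Finsupp.sum (HeckeCosetModule.of.symm f) fun D a => a • basis D := by
  change (HeckeCosetModule.of.symm f : HeckeCoset Δ U U →₀ ℤ) = _
  conv_lhs => rw [← Finsupp.sum_single (HeckeCosetModule.of.symm f)]
  change (Finsupp.sum _ _ : HeckeCoset Δ U U →₀ ℤ) = (Finsupp.sum _ _ : HeckeCoset Δ U U →₀ ℤ)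
  refine Finsupp.sum_congr fun D _ => ?_
  change _ = (_ : ℤ) • (Finsupp.single D (1 : ℤ))
  rw [Finsupp.smul_single, smul_eq_mul, mul_one]

section Hecke

variable [IsHeckeTriple Δ U U]

theorem carrier_subset (D : HeckeCoset Δ U U) : carrier D ⊆ Δ := by
  induction D using Quotient.inductionOn with
  | h g =>
    intro x hx
    obtain ⟨a, ha, b, hb, rfl⟩ := DoubleCoset.mem_doubleCoset.1 hx
    exact mul_mem (mul_mem (IsHeckeTriple.mem_of_mem_left (H₁ := U) U ha) g.2)
      (IsHeckeTriple.mem_of_mem_left (H₁ := U) U hb)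

/-- A double coset is a finite union of right cosets. -/
theorem finite_rightCosets (D : HeckeCoset Δ U U) : (rc U '' carrier D).Finite := by
  induction D using Quotient.inductionOn with
  | h g =>
    have hg : (g : G)⁻¹ ∈ Subgroup.Commensurable.commensurator U :=
      inv_mem (IsHeckeTriple.mem_commensurator_right (H₂ := U) U g)
    have h1 : ((ConjAct.toConjAct (g : G)⁻¹ • U).subgroupOf U).index ≠ 0 := hg.1
    have : Finite (U ⧸ (ConjAct.toConjAct (g : G)⁻¹ • U).subgroupOf U) :=
      haveI : ((ConjAct.toConjAct (g : G)⁻¹ • U).subgroupOf U).FiniteIndex := ⟨h1⟩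
      Subgroup.finite_quotient_of_finiteIndex
    refine (Set.finite_range fun q : U ⧸ (ConjAct.toConjAct (g : G)⁻¹ • U).subgroupOf U =>
      rc U ((g : G) * ((q.out : U) : G)⁻¹)).subset ?_
    rintro _ ⟨x, hx, rfl⟩
    obtain ⟨a, ha, b, hb, rfl⟩ := DoubleCoset.mem_doubleCoset.1 hx
    refine ⟨QuotientGroup.mk (⟨b, hb⟩⁻¹ : U), ?_⟩
    obtain ⟨k, hk⟩ := QuotientGroup.mk_out_eq_mul
      ((ConjAct.toConjAct (g : G)⁻¹ • U).subgroupOf U) (⟨b, hb⟩⁻¹ : U)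
    dsimp only
    rw [hk, mul_assoc, rc_mul_left ha, rc_eq]
    have hk2 := k.2
    rw [Subgroup.mem_subgroupOf, Subgroup.mem_pointwise_smul_iff_inv_smul_mem, ← map_inv,
      ConjAct.toConjAct_smul] at hk2
    simpa [mul_assoc] using hk2

/-- Formal sums of right cosets; a double coset is identified with the sum of its right cosets. -/
noncomputable def toSum : HeckeRing Δ U ℤ →+ (RightCosets U →₀ ℤ) :=
  (Finsupp.linearCombination ℤ fun D : HeckeCoset Δ U U =>
    ∑ c ∈ (finite_rightCosets D).toFinset, Finsupp.single c (1 : ℤ)).toAddMonoidHom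

open Classical in
theorem sum_apply (D : HeckeCoset Δ U U) (x : G) :
    (∑ c ∈ (finite_rightCosets D).toFinset, Finsupp.single c (1 : ℤ)) (rc U x) =
      if x ∈ carrier D then 1 else 0 := by
  rw [Finsupp.finsetSum_apply]
  simp only [Finsupp.single_apply, Finset.sum_ite_eq', Set.Finite.mem_toFinset]
  congr 1
  refine propext ⟨?_, fun h => ⟨x, h, rfl⟩⟩
  rintro ⟨y, hy, h⟩
  rw [rc_eq] at h
  simpa using (mem_carrier_left h).2 hy

open Classical in
theorem toSum_apply (f : HeckeRing Δ U ℤ) (x : G) :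
    toSum f (rc U x) = if hx : x ∈ Δ then f (HeckeCoset.mk U U ⟨x, hx⟩) else 0 := by
  change (Finsupp.linearCombination ℤ (fun D : HeckeCoset Δ U U =>
    ∑ c ∈ (finite_rightCosets D).toFinset, Finsupp.single c (1 : ℤ))
    (HeckeCosetModule.of.symm f)) (rc U x) = _
  rw [Finsupp.linearCombination_apply, Finsupp.sum, Finsupp.finsetSum_apply]
  simp only [Finsupp.smul_apply, sum_apply]
  split_ifs with hx
  · have : ∀ D : HeckeCoset Δ U U, x ∈ carrier D ↔ HeckeCoset.mk U U ⟨x, hx⟩ = D :=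
      fun D => mem_carrier_iff ⟨x, hx⟩
    simp only [this, smul_eq_mul, mul_ite, mul_one, mul_zero, Finset.sum_ite_eq]
    split_ifs with h
    · rfl
    · exact (Finsupp.notMem_support_iff.1 h).symm
  · refine Finset.sum_eq_zero fun D _ => ?_
    rw [if_neg fun h => hx (carrier_subset D h), smul_zero]

theorem toSum_injective : Function.Injective (toSum : HeckeRing Δ U ℤ → _) := by
  intro f g h
  refine HeckeCosetModule.ext fun D => ?_
  induction D using Quotient.inductionOn with
  | h x =>
    have := DFunLike.congr_fun h (rc U x)
    rw [toSum_apply, toSum_apply, dif_pos x.2, dif_pos x.2] at this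
    exact this

/-- Right translation of right cosets. -/
noncomputable def shift (g : G) : (RightCosets U →₀ ℤ) →+ (RightCosets U →₀ ℤ) :=
  Finsupp.mapDomain.addMonoidHom fun c => rc U (c.out * g)

theorem shift_single (g x : G) (a : ℤ) :
    shift g (Finsupp.single (rc U x) a) = Finsupp.single (rc U (x * g)) a := by
  simp only [shift, Finsupp.mapDomain.addMonoidHom_apply, Finsupp.mapDomain_single]
  congr 1
  rw [rc_eq]
  have := rc_eq.1 (rc_out (rc U x))
  simpa [mul_assoc] using this

theorem hom_ext_rc {A : Type*} [AddCommGroup A] {F F' : (RightCosets U →₀ ℤ) →+ A}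
    (h : ∀ x, F (Finsupp.single (rc U x) 1) = F' (Finsupp.single (rc U x) 1)) : F = F' := by
  refine Finsupp.addHom_ext' fun c => AddMonoidHom.ext_int ?_
  rw [← rc_out c]
  exact h _

theorem shift_mul (g h : G) (l : RightCosets U →₀ ℤ) : shift (g * h) l = shift h (shift g l) := by
  refine DFunLike.congr_fun (hom_ext_rc (F := shift (g * h)) (F' := (shift h).comp (shift g))
    fun x => ?_) l
  simp only [AddMonoidHom.comp_apply, shift_single, mul_assoc]

theorem shift_one (l : RightCosets U →₀ ℤ) : shift 1 l = l := by
  refine DFunLike.congr_fun (hom_ext_rc (F := shift 1) (F' := AddMonoidHom.id _) fun x => ?_) l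
  simp [shift_single]

theorem shift_apply (g x : G) (l : RightCosets U →₀ ℤ) :
    shift g l (rc U x) = l (rc U (x * g⁻¹)) := by
  refine DFunLike.congr_fun (hom_ext_rc
    (F := (Finsupp.applyAddHom (rc U x)).comp (shift g))
    (F' := Finsupp.applyAddHom (rc U (x * g⁻¹))) fun y => ?_) l
  simp only [AddMonoidHom.comp_apply, shift_single, Finsupp.applyAddHom_apply]
  classical
  rw [Finsupp.single_apply, Finsupp.single_apply]
  congr 1
  rw [rc_eq, rc_eq]
  simp [mul_assoc]

theorem shift_toSum (f : HeckeRing Δ U ℤ) {u : G} (hu : u ∈ U) : shift u (toSum f) = toSum f := by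
  ext c
  rw [← rc_out c, shift_apply, toSum_apply, toSum_apply]
  have hu' : u ∈ Δ := IsHeckeTriple.mem_of_mem_left (H₁ := U) U hu
  have hu'' : u⁻¹ ∈ Δ := IsHeckeTriple.mem_of_mem_left (H₁ := U) U (inv_mem hu)
  by_cases hx : c.out ∈ Δ
  · have hx' := mul_mem hx hu''
    rw [dif_pos hx, dif_pos hx']
    congr 1
    refine (mem_carrier_iff (D := HeckeCoset.mk U U ⟨c.out, hx⟩) ⟨_, hx'⟩).1 ?_
    exact (mem_carrier_right (inv_mem hu)).2 (mem_carrier_self ⟨c.out, hx⟩)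
  · rw [dif_neg hx, dif_neg]
    intro h
    exact hx (by simpa using mul_mem h hu')

/-- The operator `U x ↦ f · x` on formal sums of right cosets attached to `f`. -/
noncomputable def act (f : HeckeRing Δ U ℤ) : (RightCosets U →₀ ℤ) →+ (RightCosets U →₀ ℤ) :=
  (Finsupp.linearCombination ℤ fun c : RightCosets U => shift c.out (toSum f)).toAddMonoidHom

theorem act_single (f : HeckeRing Δ U ℤ) (x : G) (a : ℤ) :
    act f (Finsupp.single (rc U x) a) = a • shift x (toSum f) := by
  simp only [act, LinearMap.toAddMonoidHom_coe, Finsupp.linearCombination_single]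
  congr 1
  have := rc_eq.1 (rc_out (rc U x)).symm
  rw [← inv_mul_cancel_right (rc U x).out x, mul_assoc, ← mul_assoc, shift_mul,
    shift_toSum f this]

theorem act_shift (f : HeckeRing Δ U ℤ) (g : G) (l : RightCosets U →₀ ℤ) :
    act f (shift g l) = shift g (act f l) := by
  refine DFunLike.congr_fun (hom_ext_rc (F := (act f).comp (shift g))
    (F' := (shift g).comp (act f)) fun x => ?_) l
  simp [shift_single, act_single, shift_mul]

theorem act_add (f g : HeckeRing Δ U ℤ) (l : RightCosets U →₀ ℤ) :
    act (f + g) l = act f l + act g l := by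
  refine DFunLike.congr_fun (hom_ext_rc (F := act (f + g)) (F' := act f + act g) fun x => ?_) l
  simp [act_single]

theorem toSum_basis (D : HeckeCoset Δ U U) :
    toSum (basis D) = ∑ c ∈ (finite_rightCosets D).toFinset, Finsupp.single c (1 : ℤ) := by
  change (Finsupp.linearCombination ℤ _ (Finsupp.single D (1 : ℤ))) = _
  rw [Finsupp.linearCombination_single, one_smul]

theorem act_basis (D₁ D₂ : HeckeCoset Δ U U) (x : G) :
    act (basis D₁) (toSum (basis D₂)) (rc U x) = mulCoeff D₁ D₂ x := by
  classical
  rw [toSum_basis D₂, map_sum, Finsupp.finsetSum_apply]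
  have : ∀ c : RightCosets U, act (basis D₁) (Finsupp.single c 1) (rc U x) =
      if x * c.out⁻¹ ∈ carrier D₁ then 1 else 0 := by
    intro c
    conv_lhs => rw [← rc_out c]
    rw [act_single, one_smul, shift_apply, toSum_basis, sum_apply]
  simp only [this]
  rw [Finset.sum_boole, mulCoeff, ← Set.ncard_coe_finset]
  congr 2
  ext c
  simp only [Finset.coe_filter, Set.Finite.mem_toFinset, Set.mem_ofPred_eq]
  constructor
  · rintro ⟨⟨h, hh, rfl⟩, hx⟩
    refine ⟨h, hh, rfl, ?_⟩
    have := rc_eq.1 (rc_out (rc U h)).symm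
    have h2 := (mem_carrier_right this).2 hx
    simpa [mul_assoc] using h2
  · rintro ⟨h, hh, rfl, hx⟩
    refine ⟨⟨h, hh, rfl⟩, ?_⟩
    have := rc_eq.1 (rc_out (rc U h))
    have h2 := (mem_carrier_right this).2 hx
    simpa [mul_assoc] using h2

theorem mulCoeff_mul_right (D₁ D₂ : HeckeCoset Δ U U) (x : G) {u : G} (hu : u ∈ U) :
    mulCoeff D₁ D₂ (x * u) = mulCoeff D₁ D₂ x := by
  have h : (mulCoeff D₁ D₂ (x * u) : ℤ) = mulCoeff D₁ D₂ x := by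
    rw [← act_basis, ← act_basis]
    conv_lhs => rw [← shift_toSum (basis D₂) hu, act_shift, shift_apply, mul_inv_cancel_right]
  exact_mod_cast h

theorem mulCoeff_out (D₁ D₂ : HeckeCoset Δ U U) (x : Δ) :
    mulCoeff D₁ D₂ ((Quotient.out (HeckeCoset.mk U U x) : Δ) : G) = mulCoeff D₁ D₂ x := by
  have h : ((Quotient.out (HeckeCoset.mk U U x) : Δ) : G) ∈ carrier (HeckeCoset.mk U U x) :=
    (mem_carrier_iff _).2 (Quotient.out_eq _)
  obtain ⟨a, ha, b, hb, e⟩ := DoubleCoset.mem_doubleCoset.1 h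
  rw [e, mulCoeff_mul_right _ _ _ hb, mulCoeff_mul_left _ _ _ ha]

theorem mulCoeff_eq_zero (D₁ D₂ : HeckeCoset Δ U U) {x : G} (hx : x ∉ Δ) :
    mulCoeff D₁ D₂ x = 0 := by
  rw [mulCoeff, ← Set.ncard_empty (α := RightCosets U)]
  refine congrArg Set.ncard <| Set.eq_empty_of_forall_notMem ?_
  rintro c ⟨h, hh, -, h'⟩
  exact hx (by simpa using mul_mem (carrier_subset _ h') (carrier_subset _ hh))

theorem finite_mulCoeff (D₁ D₂ : HeckeCoset Δ U U) :
    (Function.support fun D : HeckeCoset Δ U U =>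
      (mulCoeff D₁ D₂ (Quotient.out D : Δ) : ℤ)).Finite := by
  refine Set.Finite.of_finite_image (f := fun D => rc U ((Quotient.out D : Δ) : G))
    (((act (basis D₁) (toSum (basis D₂))).support.finite_toSet).subset ?_) ?_
  · rintro _ ⟨D, hD, rfl⟩
    rw [Finset.mem_coe, Finsupp.mem_support_iff, act_basis]
    exact hD
  · intro D _ D' _ h
    have h' := rc_eq.1 h
    have e1 : ((Quotient.out D : Δ) : G) ∈ carrier D := (mem_carrier_iff _).2 (Quotient.out_eq D)
    have e2 : ((Quotient.out D' : Δ) : G) ∈ carrier D := by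
      simpa using (mem_carrier_left h').2 e1
    exact ((mem_carrier_iff _).1 e2).symm.trans (Quotient.out_eq D')

/-- The product `D₁ · D₂` of two double cosets in the Hecke algebra. -/
noncomputable def basisMul (D₁ D₂ : HeckeCoset Δ U U) : HeckeRing Δ U ℤ :=
  HeckeCosetModule.of (Finsupp.ofSupportFinite
    (fun D => (mulCoeff D₁ D₂ (Quotient.out D : Δ) : ℤ)) (finite_mulCoeff D₁ D₂))

/-- The bilinear extension of the product of double cosets. -/
noncomputable instance : Mul (HeckeRing Δ U ℤ) where
  mul f g := Finsupp.sum (HeckeCosetModule.of.symm f) fun D₁ a =>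
    Finsupp.sum (HeckeCosetModule.of.symm g) fun D₂ b => (a * b) • basisMul D₁ D₂

/-- The unit is the double coset `U` of `1`. -/
noncomputable instance : One (HeckeRing Δ U ℤ) where
  one := basis 1

theorem toSum_basisMul (D₁ D₂ : HeckeCoset Δ U U) :
    toSum (basisMul D₁ D₂) = act (basis D₁) (toSum (basis D₂)) := by
  ext c
  rw [← rc_out c, toSum_apply, act_basis]
  split_ifs with hx
  · exact congrArg Nat.cast (mulCoeff_out D₁ D₂ ⟨_, hx⟩)
  · rw [mulCoeff_eq_zero _ _ hx, Nat.cast_zero]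

theorem act_sum {ι : Type*} (s : Finset ι) (F : ι → HeckeRing Δ U ℤ) (l : RightCosets U →₀ ℤ) :
    act (∑ i ∈ s, F i) l = ∑ i ∈ s, act (F i) l :=
  map_sum (AddMonoidHom.mk' (fun f : HeckeRing Δ U ℤ => act f l) fun f g => act_add f g l) F s

theorem act_zsmul (a : ℤ) (f : HeckeRing Δ U ℤ) (l : RightCosets U →₀ ℤ) :
    act (a • f) l = a • act f l :=
  map_zsmul (AddMonoidHom.mk' (fun f : HeckeRing Δ U ℤ => act f l) fun f g => act_add f g l) a f

theorem toSum_mul (f g : HeckeRing Δ U ℤ) : toSum (f * g) = act f (toSum g) := by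
  conv_rhs => rw [eq_sum_basis f, eq_sum_basis g]
  change toSum (Finsupp.sum _ _) = _
  simp only [Finsupp.sum, map_sum, act_sum, map_zsmul, act_zsmul, toSum_basisMul, mul_smul,
    Finset.smul_sum]
  rw [Finset.sum_comm]
  refine Finset.sum_congr rfl fun _ _ => Finset.sum_congr rfl fun _ _ => ?_
  rw [smul_comm]

theorem toSum_one : toSum (1 : HeckeRing Δ U ℤ) = Finsupp.single (rc U 1) 1 := by
  classical
  ext c
  change toSum (basis 1) c = _
  rw [← rc_out c, toSum_basis, sum_apply, Finsupp.single_apply]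
  congr 1
  rw [rc_eq, HeckeCoset.one_def, carrier_mk, DoubleCoset.mem_doubleCoset, inv_one, mul_one]
  refine propext ⟨?_, fun h => ⟨_, h, 1, one_mem U, by simp⟩⟩
  rintro ⟨a, ha, b, hb, h⟩
  rw [h]
  simpa using mul_mem ha hb

theorem act_one (f : HeckeRing Δ U ℤ) :
    act f (toSum (1 : HeckeRing Δ U ℤ)) = toSum f := by
  rw [toSum_one, act_single, one_smul, shift_one]

theorem act_mul (f g : HeckeRing Δ U ℤ) (l : RightCosets U →₀ ℤ) :
    act (f * g) l = act f (act g l) := by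
  refine DFunLike.congr_fun (hom_ext_rc (F := act (f * g)) (F' := (act f).comp (act g))
    fun x => ?_) l
  simp only [AddMonoidHom.comp_apply, act_single, one_smul, toSum_mul, act_shift]

theorem one_act (l : RightCosets U →₀ ℤ) : act (1 : HeckeRing Δ U ℤ) l = l := by
  refine DFunLike.congr_fun (hom_ext_rc (F := act (1 : HeckeRing Δ U ℤ))
    (F' := AddMonoidHom.id _) fun x => ?_) l
  simp only [act_single, one_smul, toSum_one, shift_single, one_mul, AddMonoidHom.id_apply]

/-- The Hecke algebra `H(U, Δ)` over `ℤ`. -/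
noncomputable instance : Ring (HeckeRing Δ U ℤ) where
  __ := (inferInstance : AddCommGroup (HeckeRing Δ U ℤ))
  __ := (inferInstance : Mul (HeckeRing Δ U ℤ))
  __ := (inferInstance : One (HeckeRing Δ U ℤ))
  left_distrib f g h := toSum_injective <| by simp only [toSum_mul, map_add]
  right_distrib f g h := toSum_injective <| by simp only [toSum_mul, map_add, act_add]
  zero_mul f := toSum_injective <| by
    rw [toSum_mul, ← zero_smul ℤ (0 : HeckeRing Δ U ℤ), act_zsmul, zero_smul, zero_smul, map_zero]
  mul_zero f := toSum_injective <| by simp only [toSum_mul, map_zero]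
  mul_assoc f g h := toSum_injective <| by simp only [toSum_mul, act_mul]
  one_mul f := toSum_injective <| by rw [toSum_mul, one_act]
  mul_one f := toSum_injective <| by rw [toSum_mul, act_one]
  zsmul := fun n f => n • f
  zsmul_zero' := zero_zsmul
  zsmul_succ' n f := SubNegMonoid.zsmul_succ' n f
  zsmul_neg' n f := SubNegMonoid.zsmul_neg' n f
  nsmul := fun n f => n • f
  nsmul_zero := zero_nsmul
  nsmul_succ n f := succ_nsmul f n

end Hecke

/-- The map on double cosets `U \ Δ / U → U \ Δ' / U` for `Δ ≤ Δ'`, sending `U g U` to `U g U`. -/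
def cosetMap {Δ Δ' : Submonoid G} (h : Δ ≤ Δ') : HeckeCoset Δ U U → HeckeCoset Δ' U U :=
  Quotient.map (fun g : Δ => ⟨g, h g.2⟩) fun _ _ e => e

/-- The inclusion `H(U, Δ) → H(U, Δ')` for `Δ ≤ Δ'`, sending the double coset `U g U` to `U g U`. -/
noncomputable def inclusion {Δ Δ' : Submonoid G} (h : Δ ≤ Δ') (f : HeckeRing Δ U ℤ) :
    HeckeRing Δ' U ℤ :=
  HeckeCosetModule.of (Finsupp.mapDomain (cosetMap h) (HeckeCosetModule.of.symm f))

end HeckeAlgebra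

namespace AlgebraTensor

variable {ι : Type*} {A : ι → Type*} [∀ i, Ring (A i)]

open Classical in
/-- Extend a family over `S` to a family over `T` by the units `1`. -/
noncomputable def extendOne (S T : Finset ι) (x : ∀ i : S, A i) (i : T) : A i :=
  if hi : (i : ι) ∈ S then x ⟨i, hi⟩ else 1

theorem extendOne_update (S T : Finset ι) [DecidableEq S] [DecidableEq T] (h : S ⊆ T) (x : ∀ i : S, A i)
    (j : S) (c : A j) : extendOne S T (Function.update x j c) =
      Function.update (extendOne S T x) ⟨j, h j.2⟩ c := by
  funext i
  by_cases hij : i = ⟨j, h j.2⟩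
  · subst hij
    simp [extendOne]
  · have : (i : ι) ≠ j := fun e => hij (Subtype.ext e)
    rw [Function.update_of_ne hij]
    by_cases hi : (i : ι) ∈ S
    · simp only [extendOne, dif_pos hi]
      rw [Function.update_of_ne]
      exact fun e => this (congrArg Subtype.val e)
    · simp only [extendOne, dif_neg hi]

/-- For finite `S ⊆ T`, the map `⨂_{i ∈ S} A i → ⨂_{i ∈ T} A i` which inserts the unit `1` at every
`i ∈ T ∖ S`. -/
noncomputable def insertOne (S T : Finset ι) (h : S ≤ T) :
    (⨂[ℤ] i : S, A i) →ₐ[ℤ] (⨂[ℤ] i : T, A i) :=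
  PiTensorProduct.liftAlgHom
    { toFun := fun x => PiTensorProduct.tprod ℤ (extendOne S T x)
      map_update_add' := by
        classical
        intro inst x j a b
        rw [extendOne_update S T h, extendOne_update S T h, extendOne_update S T h,
          MultilinearMap.map_update_add]
      map_update_smul' := by
        classical
        intro inst x j a b
        rw [extendOne_update S T h, extendOne_update S T h, MultilinearMap.map_update_smul] }
    (by
      change PiTensorProduct.tprod ℤ _ = PiTensorProduct.tprod ℤ 1
      congr 1
      funext i
      simp [extendOne])
    (fun x y => by
      change PiTensorProduct.tprod ℤ _ = PiTensorProduct.tprod ℤ _ * PiTensorProduct.tprod ℤ _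
      rw [PiTensorProduct.tprod_mul_tprod]
      congr 1
      funext i
      by_cases hi : (i : ι) ∈ S <;> simp [extendOne, hi])

theorem insertOne_tprod (S T : Finset ι) (h : S ≤ T) (x : ∀ i : S, A i) :
    insertOne S T h (PiTensorProduct.tprod ℤ x) = PiTensorProduct.tprod ℤ (extendOne S T x) :=
  PiTensorProduct.lift.tprod x

instance : DirectedSystem (fun S : Finset ι => ⨂[ℤ] i : S, A i) (insertOne · · ·) where
  map_self S x := by
    refine DFunLike.congr_fun (f := (insertOne (A := A) S S le_rfl).toLinearMap)
      (g := LinearMap.id) (PiTensorProduct.ext (MultilinearMap.ext fun x => ?_)) x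
    simp only [LinearMap.compMultilinearMap_apply, AlgHom.toLinearMap_apply, insertOne_tprod,
      LinearMap.id_apply]
    congr 1
    funext i
    simp [extendOne]
  map_map V T S hST hTV x := by
    refine DFunLike.congr_fun
      (f := (insertOne (A := A) T V hTV).toLinearMap ∘ₗ (insertOne S T hST).toLinearMap)
      (g := (insertOne S V (hST.trans hTV)).toLinearMap)
      (PiTensorProduct.ext (MultilinearMap.ext fun x => ?_)) x
    simp only [LinearMap.compMultilinearMap_apply, LinearMap.comp_apply, AlgHom.toLinearMap_apply,
      insertOne_tprod]
    congr 1
    funext i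
    by_cases hi : (i : ι) ∈ S
    · simp [extendOne, hi, hST hi]
    · simp [extendOne, hi]

end AlgebraTensor

/-- The tensor product over `ℤ` of a (possibly infinite) family of rings with unit: the direct limit
of the finite tensor products `⨂_{i ∈ S} A i`, along the maps inserting units. -/
abbrev AlgebraTensor {ι : Type*} (A : ι → Type*) [∀ i, Ring (A i)] : Type _ :=
  DirectLimit (fun S : Finset ι => ⨂[ℤ] i : S, A i) (AlgebraTensor.insertOne · · ·)

open Classical in
/-- The canonical map `A i → ⨂ A`, `a ↦ ⋯ ⊗ 1 ⊗ a ⊗ 1 ⊗ ⋯`. -/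
noncomputable def AlgebraTensor.of {ι : Type*} (A : ι → Type*) [∀ i, Ring (A i)] (i : ι) (a : A i) :
    AlgebraTensor A :=
  Quotient.mk _ ⟨{i}, PiTensorProduct.singleAlgHom (R := ℤ)
    (A := fun j : ({i} : Finset ι) => A j) ⟨i, Finset.mem_singleton_self i⟩ a⟩

namespace Paramodular

/-- The real symplectic group of degree `2`. -/
abbrev Sp : Type := Matrix.symplecticGroup (Fin 2) ℝ

/-- The (real) matrix attached to an element of the symplectic group. -/
abbrev mat (M : Sp) : Matrix (Fin 2 ⊕ Fin 2) (Fin 2 ⊕ Fin 2) ℝ := M.1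

/-- The pattern of the paramodular matrices of level `N`:
the rows are `(1, N, 1, 1)`, `(1, 1, 1, 1/N)`, `(1, N, 1, 1)`, `(N, N, N, 1)`. -/
noncomputable def weight (N : ℕ) : Matrix (Fin 2 ⊕ Fin 2) (Fin 2 ⊕ Fin 2) ℝ :=
  Matrix.fromBlocks !![1, (N : ℝ); 1, 1] !![1, 1; 1, 1 / (N : ℝ)]
    !![1, (N : ℝ); (N : ℝ), (N : ℝ)] !![1, 1; (N : ℝ), 1]

/-- `M` has the shape
`(a₁, a₂ N, b₁, b₂ ; a₃, a₄, b₃, b₄ / N ; c₁, c₂ N, d₁, d₂ ; c₃ N, c₄ N, d₃ N, d₄)`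
with integers `aᵢ, bᵢ, cᵢ, dᵢ`. -/
def IsForm (N : ℕ) (M : Matrix (Fin 2 ⊕ Fin 2) (Fin 2 ⊕ Fin 2) ℝ) : Prop :=
  ∃ Z : Matrix (Fin 2 ⊕ Fin 2) (Fin 2 ⊕ Fin 2) ℤ, ∀ i j, M i j = (Z i j : ℝ) * weight N i j

/-- `ν(M)`: the least positive integer `m` such that `√m M` has the above shape. -/
noncomputable def nu (N : ℕ) (M : Sp) : ℕ :=
  sInf {m : ℕ | 0 < m ∧ IsForm N (√(m : ℝ) • mat M)}

theorem weight_mul (N : ℕ) [NeZero N] (i k j : Fin 2 ⊕ Fin 2) :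
    ∃ n : ℤ, weight N i k * weight N k j = n * weight N i j := by
  have hN : (N : ℝ) ≠ 0 := NeZero.ne _
  have h1 : ∃ n : ℤ, (1 : ℝ) = n := ⟨1, by simp⟩
  have key : (∃ n : ℤ, weight N i k * weight N k j = n * weight N i j) ↔
      (weight N i k * weight N k j = weight N i j ∨
        weight N i k * weight N k j = N * weight N i j ∨
        weight N i k * weight N k j = (N * N) * weight N i j) ∨
      (∃ n : ℤ, weight N i k * weight N k j = n * weight N i j) := by
    refine ⟨Or.inr, ?_⟩
    rintro ((h | h | h) | h)
    · exact ⟨1, by simpa using h⟩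
    · exact ⟨N, by simpa using h⟩
    · exact ⟨N * N, by simpa using h⟩
    · exact h
  rw [key]
  left
  rcases i with i | i <;> rcases j with j | j <;> rcases k with k | k <;>
    fin_cases i <;> fin_cases j <;> fin_cases k <;>
    simp [weight, hN]

theorem IsForm.mul {N : ℕ} [NeZero N] {A B : Matrix (Fin 2 ⊕ Fin 2) (Fin 2 ⊕ Fin 2) ℝ}
    (hA : IsForm N A) (hB : IsForm N B) : IsForm N (A * B) := by
  obtain ⟨X, hX⟩ := hA
  obtain ⟨Y, hY⟩ := hB
  choose n hn using weight_mul N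
  refine ⟨fun i j => ∑ k, X i k * Y k j * n i k j, fun i j => ?_⟩
  rw [Matrix.mul_apply]
  push_cast
  rw [Finset.sum_mul]
  refine Finset.sum_congr rfl fun k _ => ?_
  rw [hX, hY, mul_assoc _ _ (weight N i j), ← hn]
  ring

theorem IsForm.add {N : ℕ} {A B : Matrix (Fin 2 ⊕ Fin 2) (Fin 2 ⊕ Fin 2) ℝ}
    (hA : IsForm N A) (hB : IsForm N B) : IsForm N (A + B) := by
  obtain ⟨X, hX⟩ := hA
  obtain ⟨Y, hY⟩ := hB
  refine ⟨X + Y, fun i j => ?_⟩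
  rw [Matrix.add_apply, hX, hY, Matrix.add_apply]
  push_cast
  ring

theorem IsForm.zsmul {N : ℕ} {A : Matrix (Fin 2 ⊕ Fin 2) (Fin 2 ⊕ Fin 2) ℝ}
    (hA : IsForm N A) (n : ℤ) : IsForm N ((n : ℝ) • A) := by
  obtain ⟨X, hX⟩ := hA
  refine ⟨n • X, fun i j => ?_⟩
  rw [Matrix.smul_apply, hX, Matrix.smul_apply]
  simp [mul_assoc]

theorem isForm_one (N : ℕ) : IsForm N 1 := by
  refine ⟨1, fun i j => ?_⟩
  rcases i with i | i <;> rcases j with j | j <;> fin_cases i <;> fin_cases j <;>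
    simp [weight]

theorem IsForm.symp {N : ℕ} {A : Matrix (Fin 2 ⊕ Fin 2) (Fin 2 ⊕ Fin 2) ℝ} (hA : IsForm N A) :
    IsForm N ((-Matrix.J (Fin 2) ℝ) * A.transpose * Matrix.J (Fin 2) ℝ) := by
  obtain ⟨X, hX⟩ := hA
  refine ⟨(-Matrix.J (Fin 2) ℤ) * X.transpose * Matrix.J (Fin 2) ℤ, fun i j => ?_⟩
  rcases i with i | i <;> rcases j with j | j <;> fin_cases i <;> fin_cases j <;>
    simp [Matrix.mul_apply, Matrix.J, Fintype.sum_sum_type, Fin.sum_univ_two, hX, weight]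

theorem IsForm.inv {N : ℕ} {M : Sp} {c : ℝ} (h : IsForm N (c • mat M)) :
    IsForm N (c • mat M⁻¹) := by
  have := h.symp
  rw [mat, SymplecticGroup.coe_inv]
  simpa using this

/-- The paramodular group `Σ_N` of level `N`. -/
def Sigma (N : ℕ) [NeZero N] : Subgroup Sp where
  carrier := {M | IsForm N (mat M)}
  mul_mem' hA hB := IsForm.mul hA hB
  one_mem' := isForm_one N
  inv_mem' {M} hM := by
    have := IsForm.inv (N := N) (M := M) (c := 1) (by simpa using hM)
    simpa using this

/-- The group `𝔾` of all symplectic matrices `(1/√m) K` with `K` integral and `m ≥ 1`. -/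
noncomputable def bigG : Subgroup Sp where
  carrier := {M | ∃ m : ℕ, 0 < m ∧ ∃ K : Matrix (Fin 2 ⊕ Fin 2) (Fin 2 ⊕ Fin 2) ℤ,
    mat M = (1 / √(m : ℝ)) • K.map (Int.cast : ℤ → ℝ)}
  mul_mem' := by
    rintro A B ⟨m, hm, K, hK⟩ ⟨n, hn', L, hL⟩
    refine ⟨m * n, Nat.mul_pos hm hn', K * L, ?_⟩
    change mat A * mat B = _
    rw [hK, hL, Nat.cast_mul, Real.sqrt_mul (Nat.cast_nonneg m), smul_mul_smul_comm]
    have : (K * L).map (Int.cast : ℤ → ℝ) = K.map Int.cast * L.map Int.cast :=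
      Matrix.map_mul (f := Int.castRingHom ℝ)
    rw [this, one_div_mul_one_div]
  one_mem' := ⟨1, one_pos, 1, by simp⟩
  inv_mem' := by
    rintro A ⟨m, hm, K, hK⟩
    refine ⟨m, hm, (-Matrix.J (Fin 2) ℤ) * K.transpose * Matrix.J (Fin 2) ℤ, ?_⟩
    change mat A⁻¹ = _
    rw [mat, SymplecticGroup.coe_inv]
    have h1 : ((-Matrix.J (Fin 2) ℤ) * K.transpose * Matrix.J (Fin 2) ℤ).map (Int.cast : ℤ → ℝ) =
        (-Matrix.J (Fin 2) ℝ) * (K.map (Int.cast : ℤ → ℝ)).transpose * Matrix.J (Fin 2) ℝ := by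
      ext i j
      rcases i with i | i <;> rcases j with j | j <;> fin_cases i <;> fin_cases j <;>
        simp [Matrix.mul_apply, Matrix.J, Fintype.sum_sum_type, Fin.sum_univ_two]
    rw [h1]
    change _ * (mat A).transpose * _ = _
    rw [hK]
    simp

theorem isForm_of_int (N : ℕ) [NeZero N] (K : Matrix (Fin 2 ⊕ Fin 2) (Fin 2 ⊕ Fin 2) ℤ) :
    IsForm N ((N : ℝ) • K.map (Int.cast : ℤ → ℝ)) := by
  have hN : (N : ℝ) ≠ 0 := NeZero.ne _
  have h : ∀ i j, ∃ n : ℤ, (N : ℝ) = n * weight N i j := by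
    intro i j
    rcases i with i | i <;> rcases j with j | j <;> fin_cases i <;> fin_cases j <;>
      first
      | (refine ⟨1, ?_⟩; simp [weight]; done)
      | (refine ⟨N, ?_⟩; simp [weight]; done)
      | (refine ⟨N * N, ?_⟩; simp [weight, hN])
  choose n hn using h
  refine ⟨fun i j => K i j * n i j, fun i j => ?_⟩
  rw [Matrix.smul_apply, Matrix.map_apply, smul_eq_mul]
  push_cast
  rw [mul_assoc, ← hn, mul_comm]

theorem exists_isForm (N : ℕ) [NeZero N] {M : Sp} (hM : M ∈ bigG) :
    ∃ m : ℕ, 0 < m ∧ IsForm N (√(m : ℝ) • mat M) := by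
  obtain ⟨m, hm, K, hK⟩ := hM
  refine ⟨m * N ^ 2, Nat.mul_pos hm (pow_pos (NeZero.pos N) 2), ?_⟩
  have h0 : √(m : ℝ) ≠ 0 := (Real.sqrt_pos.2 (Nat.cast_pos.2 hm)).ne'
  rw [hK, smul_smul]
  convert isForm_of_int N K using 2
  push_cast
  rw [Real.sqrt_mul (Nat.cast_nonneg m), Real.sqrt_sq (Nat.cast_nonneg N)]
  field_simp

theorem nu_spec (N : ℕ) [NeZero N] {M : Sp} (hM : M ∈ bigG) :
    0 < nu N M ∧ IsForm N (√(nu N M : ℝ) • mat M) :=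
  Nat.sInf_mem (exists_isForm N hM)

/-- An integral multiple `√n M` of the given shape has `ν(M) ∣ n`. -/
theorem nu_dvd (N : ℕ) [NeZero N] {M : Sp} (hM : M ∈ bigG) {n : ℕ} (_ : 0 < n)
    (h : IsForm N (√(n : ℝ) • mat M)) : nu N M ∣ n := by
  obtain ⟨hm, hf⟩ := nu_spec N hM
  set m := nu N M with hm_def
  have hsq : ∃ k : ℕ, m * n = k * k := by
    have hM0 : mat M ≠ 0 := by
      intro h0
      have h1 : mat M * mat M⁻¹ = 1 := congrArg Subtype.val (mul_inv_cancel M)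
      rw [h0, zero_mul] at h1
      exact zero_ne_one h1
    obtain ⟨i, j, hij⟩ : ∃ i j, mat M i j ≠ 0 := by
      by_contra hcon
      push Not at hcon
      exact hM0 (Matrix.ext hcon)
    obtain ⟨X, hX⟩ := hf
    obtain ⟨Y, hY⟩ := h
    have e1 := hX i j
    have e2 := hY i j
    rw [Matrix.smul_apply, smul_eq_mul] at e1 e2
    have hw : weight N i j ≠ 0 := by
      intro h0
      rw [h0, mul_zero] at e1
      exact mul_ne_zero (Real.sqrt_pos.2 (Nat.cast_pos.2 hm)).ne' hij e1
    have hx : (X i j : ℝ) ≠ 0 := by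
      intro h0
      rw [h0, zero_mul] at e1
      exact mul_ne_zero (Real.sqrt_pos.2 (Nat.cast_pos.2 hm)).ne' hij e1
    have e3 : √(n : ℝ) * X i j = √(m : ℝ) * Y i j := by
      have : √(n : ℝ) * X i j * (weight N i j * mat M i j) =
          √(m : ℝ) * Y i j * (weight N i j * mat M i j) := by
        linear_combination √(m : ℝ) * mat M i j * e2 - √(n : ℝ) * mat M i j * e1
      exact mul_right_cancel₀ (mul_ne_zero hw hij) this
    have e4 : (n : ℤ) * X i j ^ 2 = m * Y i j ^ 2 := by
      have := congrArg (· ^ 2) e3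
      simp only [mul_pow, Real.sq_sqrt (Nat.cast_nonneg n), Real.sq_sqrt (Nat.cast_nonneg m)]
        at this
      exact_mod_cast this
    have hx' : X i j ≠ 0 := by exact_mod_cast hx
    have e5 : IsSquare (((m * n : ℕ) : ℚ)) := by
      refine ⟨m * Y i j / X i j, ?_⟩
      have hxq : (X i j : ℚ) ≠ 0 := by exact_mod_cast hx'
      have e4q : (n : ℚ) * X i j ^ 2 = m * Y i j ^ 2 := by exact_mod_cast e4
      field_simp
      push_cast
      linear_combination (m : ℚ) * e4q
    rw [Rat.isSquare_natCast_iff] at e5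
    exact e5
  obtain ⟨k, hk⟩ := hsq
  obtain ⟨g, m', n', hg, hcop, hmg, hng⟩ := Nat.exists_coprime' (Nat.gcd_pos_of_pos_left n hm)
  have hmn' : ∃ l, m' * n' = l ^ 2 := by
    have hgg : (g * g) * (m' * n') = k * k := by
      rw [← hk, hmg, hng]; ring
    have hdvd : g ∣ k := by
      rw [← Nat.pow_dvd_pow_iff (n := 2) two_ne_zero]
      exact ⟨m' * n', by rw [sq, sq, hgg]⟩
    obtain ⟨l, rfl⟩ := hdvd
    refine ⟨l, Nat.eq_of_mul_eq_mul_left (Nat.mul_pos hg hg) ?_⟩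
    rw [hgg]; ring
  obtain ⟨l, hl⟩ := hmn'
  have hma : ∃ a, m' = a ^ 2 := by
    obtain ⟨a, ha⟩ := exists_associated_pow_of_mul_eq_pow'
      (Nat.isCoprime_iff_coprime.2 hcop) (a := (m' : ℤ)) (b := n') (c := l) (k := 2)
      (by exact_mod_cast hl)
    refine ⟨a.natAbs, ?_⟩
    have := Int.associated_iff_natAbs.1 ha
    rw [Int.natAbs_pow, Int.natAbs_natCast] at this
    exact this.symm
  have hnb : ∃ b, n' = b ^ 2 := by
    obtain ⟨a, ha⟩ := exists_associated_pow_of_mul_eq_pow'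
      (Nat.isCoprime_iff_coprime.2 hcop.symm) (a := (n' : ℤ)) (b := m') (c := l) (k := 2)
      (by rw [mul_comm]; exact_mod_cast hl)
    refine ⟨a.natAbs, ?_⟩
    have := Int.associated_iff_natAbs.1 ha
    rw [Int.natAbs_pow, Int.natAbs_natCast] at this
    exact this.symm
  obtain ⟨a, rfl⟩ := hma
  obtain ⟨b, rfl⟩ := hnb
  have hab : IsCoprime (a : ℤ) b := by
    rw [Nat.isCoprime_iff_coprime]
    exact Nat.Coprime.of_dvd (dvd_pow_self a two_ne_zero) (dvd_pow_self b two_ne_zero) hcop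
  have hs1 : √(m : ℝ) = a * √(g : ℝ) := by
    rw [hmg]
    push_cast
    rw [Real.sqrt_mul (by positivity), Real.sqrt_sq (by positivity)]
  have hs2 : √(n : ℝ) = b * √(g : ℝ) := by
    rw [hng]
    push_cast
    rw [Real.sqrt_mul (by positivity), Real.sqrt_sq (by positivity)]
  obtain ⟨u, v, huv⟩ := hab
  have hfin : IsForm N (√(g : ℝ) • mat M) := by
    have := (hf.zsmul u).add (h.zsmul v)
    convert this using 1
    rw [smul_smul, smul_smul, ← add_smul, hs1, hs2]
    congr 1
    have huv' : (u : ℝ) * a + v * b = 1 := by exact_mod_cast huv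
    linear_combination (-√(g : ℝ)) * huv'
  have hle : m ≤ g := Nat.sInf_le ⟨hg, hfin⟩
  have hgm : g ∣ m := ⟨a ^ 2, by rw [hmg]; ring⟩
  have : m = g := le_antisymm hle (Nat.le_of_dvd hm hgm)
  rw [this]
  exact ⟨b ^ 2, by rw [hng]; ring⟩

theorem exists_nu_eq_pow (N : ℕ) [NeZero N] {M : Sp} (hM : M ∈ bigG) (p : Nat.Primes) {r : ℕ}
    (h : IsForm N (√(((p : ℕ) ^ r : ℕ) : ℝ) • mat M)) : ∃ s : ℕ, nu N M = (p : ℕ) ^ s := by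
  obtain ⟨s, -, hs⟩ := (Nat.dvd_prime_pow p.2).1 (nu_dvd N hM (pow_pos p.2.pos r) h)
  exact ⟨s, hs⟩

theorem sigma_le (N : ℕ) [NeZero N] : Sigma N ≤ bigG := by
  have hN : (N : ℝ) ≠ 0 := NeZero.ne _
  rintro M ⟨Z, hZ⟩
  have h : ∀ i j, ∃ n : ℤ, (N : ℝ) * weight N i j = n := by
    intro i j
    rcases i with i | i <;> rcases j with j | j <;> fin_cases i <;> fin_cases j <;>
      first
      | (refine ⟨1, ?_⟩; simp [weight, hN]; done)
      | (refine ⟨N, ?_⟩; simp [weight]; done)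
      | (refine ⟨N * N, ?_⟩; simp [weight])
  choose n hn using h
  refine ⟨N ^ 2, pow_pos (NeZero.pos N) 2, Matrix.of fun i j => Z i j * n i j, ?_⟩
  ext i j
  rw [hZ, Matrix.smul_apply, Matrix.map_apply, Matrix.of_apply]
  push_cast
  rw [← hn, Real.sqrt_sq (Nat.cast_nonneg N), smul_eq_mul]
  field_simp

/-- The subgroup `𝔾_p` of all `M ∈ 𝔾` such that `ν(M)` is a power of `p`. -/
noncomputable def Gp (N : ℕ) [NeZero N] (p : Nat.Primes) : Subgroup Sp where
  carrier := {M | M ∈ bigG ∧ ∃ r : ℕ, nu N M = (p : ℕ) ^ r}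
  mul_mem' := by
    rintro A B ⟨hA, r, hr⟩ ⟨hB, s, hs⟩
    refine ⟨mul_mem hA hB, exists_nu_eq_pow N (mul_mem hA hB) p (r := r + s) ?_⟩
    have := (nu_spec N hA).2.mul (nu_spec N hB).2
    rw [hr, hs, smul_mul_smul_comm, ← Real.sqrt_mul (Nat.cast_nonneg _), ← Nat.cast_mul,
      ← pow_add] at this
    exact this
  one_mem' := ⟨one_mem _, exists_nu_eq_pow N (one_mem _) p (r := 0) (by simpa using isForm_one N)⟩
  inv_mem' := by
    rintro A ⟨hA, r, hr⟩
    refine ⟨inv_mem hA, exists_nu_eq_pow N (inv_mem hA) p (r := r) ?_⟩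
    rw [← hr]
    exact (nu_spec N hA).2.inv

theorem gp_le (N : ℕ) [NeZero N] (p : Nat.Primes) : Gp N p ≤ bigG := fun _ h => h.1

theorem sigma_le_gp (N : ℕ) [NeZero N] (p : Nat.Primes) : Sigma N ≤ Gp N p := fun M hM =>
  ⟨sigma_le N hM, exists_nu_eq_pow N (sigma_le N hM) p (r := 0) (by
    rw [pow_zero, Nat.cast_one, Real.sqrt_one, one_smul]; exact hM)⟩

theorem relIndex_ne_zero (N : ℕ) [NeZero N] {g : Sp} (hg : g ∈ bigG) :
    (ConjAct.toConjAct g • Sigma N).relIndex (Sigma N) ≠ 0 := by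
  obtain ⟨k, hk, hf⟩ := exists_isForm N hg
  have hf' := hf.inv
  have : NeZero k := ⟨hk.ne'⟩
  choose Z hZ using fun u : Sigma N => u.2
  let φ : Sigma N → Matrix (Fin 2 ⊕ Fin 2) (Fin 2 ⊕ Fin 2) (ZMod k) :=
    fun u => (Z u).map (Int.cast : ℤ → ZMod k)
  have key : ∀ u v : Sigma N, φ u = φ v →
      u⁻¹ * v ∈ (ConjAct.toConjAct g • Sigma N).subgroupOf (Sigma N) := by
    intro u v huv
    have h1 : ∀ i j, ∃ w : ℤ, Z v i j = Z u i j + k * w := by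
      intro i j
      have h2 : ((Z u i j : ℤ) : ZMod k) = Z v i j := congrFun (congrFun huv i) j
      rw [ZMod.intCast_eq_intCast_iff_dvd_sub] at h2
      obtain ⟨w, hw⟩ := h2
      exact ⟨w, by linarith⟩
    choose w hw using h1
    let W : Matrix (Fin 2 ⊕ Fin 2) (Fin 2 ⊕ Fin 2) ℝ := fun i j => w i j * weight N i j
    have hW : IsForm N W := ⟨w, fun i j => rfl⟩
    have hv : mat v.1 = mat u.1 + (k : ℝ) • W := by
      ext i j
      rw [Matrix.add_apply, Matrix.smul_apply, hZ, hZ, hw]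
      push_cast
      simp only [W, smul_eq_mul]
      ring
    rw [Subgroup.mem_subgroupOf, Subgroup.mem_pointwise_smul_iff_inv_smul_mem, ← map_inv,
      ConjAct.toConjAct_smul]
    change IsForm N (mat _)
    have e : mat (g⁻¹ * ((u⁻¹ * v : Sigma N) : Sp) * g⁻¹⁻¹) =
        1 + (√(k : ℝ) • mat g⁻¹) * mat (u⁻¹ : Sigma N).1 * W * (√(k : ℝ) • mat g) := by
      have e1 : mat (g⁻¹ * ((u⁻¹ * v : Sigma N) : Sp) * g⁻¹⁻¹) =
          mat g⁻¹ * (mat (u⁻¹ : Sigma N).1 * mat v.1) * mat g := by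
        rw [inv_inv]; rfl
      have e2 : mat (u⁻¹ : Sigma N).1 * mat u.1 = 1 :=
        congrArg Subtype.val (inv_mul_cancel (u : Sp))
      have e3 : mat g⁻¹ * mat g = 1 := congrArg Subtype.val (inv_mul_cancel g)
      rw [e1, hv, mul_add, e2, mul_add, mul_one, add_mul, e3]
      congr 1
      simp only [Matrix.smul_mul, Matrix.mul_smul, smul_smul, Matrix.mul_assoc]
      rw [Real.mul_self_sqrt (Nat.cast_nonneg k)]
    rw [e]
    exact (isForm_one N).add (((hf'.mul (u⁻¹ : Sigma N).2).mul hW).mul hf)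
  have hfin : Finite (Sigma N ⧸ (ConjAct.toConjAct g • Sigma N).subgroupOf (Sigma N)) := by
    refine Finite.of_injective (fun q => φ q.out) fun q q' h => ?_
    rw [← QuotientGroup.out_eq' q, ← QuotientGroup.out_eq' q', QuotientGroup.eq]
    exact key _ _ h
  exact Subgroup.index_ne_zero_of_finite

theorem le_commensurator (N : ℕ) [NeZero N] :
    bigG ≤ Subgroup.Commensurable.commensurator (Sigma N) := by
  intro g hg
  refine ⟨relIndex_ne_zero N hg, ?_⟩
  have := relIndex_ne_zero N (inv_mem hg)
  rw [← Subgroup.relIndex_pointwise_smul (ConjAct.toConjAct g), map_inv, smul_inv_smul] at this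
  exact this

/-- `(Σ_N, 𝔾)` is a Hecke pair. -/
instance (N : ℕ) [NeZero N] : IsHeckeTriple bigG.toSubmonoid (Sigma N) (Sigma N) :=
  .of_diagonal (sigma_le N) (le_commensurator N)

/-- `(Σ_N, 𝔾_p)` is a Hecke pair. -/
instance (N : ℕ) [NeZero N] (p : Nat.Primes) :
    IsHeckeTriple (Gp N p).toSubmonoid (Sigma N) (Sigma N) :=
  .of_diagonal (sigma_le_gp N p) ((gp_le N p).trans (le_commensurator N))

/-- The Hecke algebra `H(Σ_N, 𝔾)`. -/
abbrev Hecke (N : ℕ) [NeZero N] : Type := HeckeRing bigG.toSubmonoid (Sigma N) ℤ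

/-- The primary component `H(Σ_N, 𝔾_p)`. -/
abbrev HeckeP (N : ℕ) [NeZero N] (p : Nat.Primes) : Type :=
  HeckeRing (Gp N p).toSubmonoid (Sigma N) ℤ

/-- The double coset `Σ_N M Σ_N` of `M ∈ 𝔾_p` as an element of `H(Σ_N, 𝔾_p)`. -/
noncomputable def dc (N : ℕ) [NeZero N] (p : Nat.Primes) (M : Gp N p) : HeckeP N p :=
  HeckeAlgebra.basis (HeckeCoset.mk (Sigma N) (Sigma N) M)

/-- The inclusion of `H(Σ_N, 𝔾_p)` into `H(Σ_N, 𝔾)`. -/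
noncomputable def incl (N : ℕ) [NeZero N] (p : Nat.Primes) : HeckeP N p → Hecke N :=
  HeckeAlgebra.inclusion (gp_le N p)

/-- The symplectic matrix `s⁻¹ diag(d)`. -/
noncomputable def diagSp (s : ℝ) (hs : s ≠ 0) (d : Fin 2 ⊕ Fin 2 → ℝ)
    (h : ∀ i : Fin 2, d (.inl i) * d (.inr i) = s ^ 2) : Sp :=
  ⟨(1 / s) • Matrix.diagonal d, by
    rw [SymplecticGroup.mem_iff]
    ext i j
    have h0 := h 0
    have h1 := h 1
    rcases i with i | i <;> rcases j with j | j <;> fin_cases i <;> fin_cases j <;>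
      simp [Matrix.J, Matrix.diagonal_mul, Matrix.mul_diagonal, Matrix.diagonal_transpose] <;>
      field_simp <;> linarith⟩

theorem isForm_diagonal (N : ℕ) (d : Fin 2 ⊕ Fin 2 → ℕ) :
    IsForm N (Matrix.diagonal fun i => (d i : ℝ)) := by
  refine ⟨Matrix.diagonal fun i => (d i : ℤ), fun i j => ?_⟩
  rcases i with i | i <;> rcases j with j | j <;> fin_cases i <;> fin_cases j <;>
    simp [weight]

theorem diagSp_mem (N : ℕ) [NeZero N] (p : Nat.Primes) (r : ℕ) (s : ℝ) (hs : s ≠ 0)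
    (d : Fin 2 ⊕ Fin 2 → ℕ) (h : ∀ i : Fin 2, (d (.inl i) : ℝ) * d (.inr i) = s ^ 2)
    (hr : s = √(((p : ℕ) ^ r : ℕ) : ℝ)) : diagSp s hs (fun i => (d i : ℝ)) h ∈ Gp N p := by
  have hb : diagSp s hs (fun i => (d i : ℝ)) h ∈ bigG := by
    refine ⟨(p : ℕ) ^ r, pow_pos p.2.pos r, Matrix.diagonal fun i => (d i : ℤ), ?_⟩
    rw [← hr]
    change (1 / s) • Matrix.diagonal _ = _
    congr 1
    rw [Matrix.diagonal_map (by simp)]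
    simp
  refine ⟨hb, exists_nu_eq_pow N hb p (r := r) ?_⟩
  rw [← hr]
  change IsForm N (s • ((1 / s) • Matrix.diagonal _))
  rw [smul_smul, mul_one_div_cancel hs, one_smul]
  exact isForm_diagonal N d

/-- The matrix `(1/√p) diag(1, 1, p, p)`. -/
noncomputable def t₁ (N : ℕ) [NeZero N] (p : Nat.Primes) : Gp N p :=
  ⟨diagSp √((p : ℕ) : ℝ) (Real.sqrt_pos.2 (Nat.cast_pos.2 p.2.pos)).ne'
    (fun i => ((Sum.elim ![1, 1] ![(p : ℕ), (p : ℕ)] i : ℕ) : ℝ))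
    (fun i => by fin_cases i <;> simp), diagSp_mem N p 1 _ _ _ _ (by simp)⟩

/-- The matrix `(1/p) diag(1, p, p², p)`. -/
noncomputable def t₂ (N : ℕ) [NeZero N] (p : Nat.Primes) : Gp N p :=
  ⟨diagSp ((p : ℕ) : ℝ) (Nat.cast_ne_zero.2 p.2.ne_zero)
    (fun i => ((Sum.elim ![1, (p : ℕ)] ![(p : ℕ) ^ 2, (p : ℕ)] i : ℕ) : ℝ))
    (fun i => by fin_cases i <;> simp [sq]), diagSp_mem N p 2 _ _ _ _ (by simp)⟩

/-- `T_{N,1}(p) = Σ_N (1/√p) diag(1, 1, p, p) Σ_N`. -/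
noncomputable def T₁ (N : ℕ) [NeZero N] (p : Nat.Primes) : HeckeP N p := dc N p (t₁ N p)

/-- `T_{N,2}(p) = Σ_N (1/p) diag(1, p, p², p) Σ_N`. -/
noncomputable def T₂ (N : ℕ) [NeZero N] (p : Nat.Primes) : HeckeP N p := dc N p (t₂ N p)

/-- `W` is one of the matrices `W_d = (V_d, 0 ; 0, (V_d')⁻¹)`, where
`V_d = (1/√d) (α d, β N ; γ, δ d)` with integers `α, β, γ, δ` and `det V_d = 1`. -/
def IsW (N d : ℕ) (W : Matrix (Fin 2 ⊕ Fin 2) (Fin 2 ⊕ Fin 2) ℝ) : Prop :=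
  ∃ (α β γ δ : ℤ) (V : Matrix (Fin 2) (Fin 2) ℝ),
    V = (1 / √(d : ℝ)) • !![(α : ℝ) * d, (β : ℝ) * N; (γ : ℝ), (δ : ℝ) * d] ∧
    V.det = 1 ∧ W = Matrix.fromBlocks V 0 0 V.transpose⁻¹

end Paramodular

/-! Reordering the coordinates and conjugating by diag(1, 1, 1, N) turns Σ_N into the group of
integral isometries of J ⊕ N J. It turns √m M, for m = ν(M), into an integral similitude with
multiplier m whose upper right block is divisible by N (`isForm_iff`, `pat_of_symp`). The whole
proof works with these integral models.

Local-global principle. If for every prime p ∣ N the first diagonal block of the minimal model is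
nonzero modulo p (`GoodAt`), then Σ_N M Σ_N contains diag(1, m, a, b) with ab = m and a ∣ b
(`exists_diagMat`). The elements W_p normalize Σ_N and exchange the two diagonal blocks modulo p, so
multiplying by them on both sides makes any M good (`exists_wGroup_goodAt`); squarefreeness of N is
needed for W_p to exist. The elements with ν prime to p act as local units at p: multiplying by them
changes neither the p-part of ν, nor goodness at p, nor the p-part of the gcd of the 2 × 2 minors,
which is a. Hence double cosets that agree up to local units at every p are equal
(`exists_sigma_of_locEquiv`).

Tensor product. For A ∈ 𝔾_p and B with ν(B) prime to p, all A u B with u ∈ Σ_N are locally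
equivalent to A B, and an ambiguity in the factorization lies in 𝔾_p and has ν prime to p, hence
lies in Σ_N. So the product of the double cosets of A and B is that of A B (`gdc_mul`). Different
primary components therefore commute, tensors of double cosets go to double cosets that determine
their components (`liftFin_injective`), and diagonal matrices together with the W_p show
surjectivity (`tensorHom_surjective`).

Generators. Let D(i, j) be the double coset of diag(1, p^(i+j), p^i, p^j), so that T₁ = D(0, 1) and
T₂ = D(1, 1). Then D(0, j) T₁ and D(i, j) T₂ contain D(0, j+1) and D(i+1, j+1) with coefficient 1,
and their other good terms have smaller ν or, at equal ν, larger i, by divisibility of minors. For p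
∣ N terms which are not good are reduced by W_p. This triangularity gives generation (`dc_mem`), and
for the monomials T₁^a T₂^b it also gives linear independence.

Commutativity. For p ∤ N each double coset is stable under inversion, which makes the algebra
commutative. For p ∣ N the element W_p does not commute with T₂: the lower right block in the model
of T₂ vanishes modulo p but the upper left one does not, and conjugation by W_p exchanges them. -/

namespace Paramodular

/-! ### Integral models of symplectic matrices. -/

/-- The order of coordinates `(1, 3, 2, 4)`, in which the symplectic form is block diagonal. -/
def coord : Fin 2 ⊕ Fin 2 ≃ Fin 4 where
  toFun := Sum.elim ![0, 2] ![1, 3]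
  invFun := ![.inl 0, .inr 0, .inl 1, .inr 1]
  left_inv := by rintro (i | i) <;> fin_cases i <;> rfl
  right_inv := by intro i; fin_cases i <;> rfl

/-- The scaling `diag(1, 1, 1, N)` which makes the paramodular group integral. -/
def scale (N : ℕ) : Fin 2 ⊕ Fin 2 → ℝ := Sum.elim ![1, 1] ![1, (N : ℝ)]

theorem scale_ne_zero (N : ℕ) [NeZero N] (i : Fin 2 ⊕ Fin 2) : scale N i ≠ 0 := by
  have hN : (N : ℝ) ≠ 0 := NeZero.ne _
  rcases i with i | i <;> fin_cases i <;> simp [scale, hN]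

/-- The real matrix with integral model `X`. -/
noncomputable def realMat (N : ℕ) (X : Matrix (Fin 4) (Fin 4) ℤ) :
    Matrix (Fin 2 ⊕ Fin 2) (Fin 2 ⊕ Fin 2) ℝ :=
  fun i j => X (coord i) (coord j) * (scale N i / scale N j)

/-- The alternating form `J ⊕ N J` in the integral model. -/
def altForm (N : ℕ) : Matrix (Fin 4) (Fin 4) ℤ :=
  !![0, 1, 0, 0; -1, 0, 0, 0; 0, 0, 0, (N : ℤ); 0, 0, -(N : ℤ), 0]

/-- The form `N J⁻¹ ⊕ J⁻¹`, that is, `N` times the inverse of `altForm N`. -/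
def dualForm (N : ℕ) : Matrix (Fin 4) (Fin 4) ℤ :=
  !![0, -(N : ℤ), 0, 0; (N : ℤ), 0, 0, 0; 0, 0, 0, -1; 0, 0, 1, 0]

theorem altForm_mul_dualForm (N : ℕ) : altForm N * dualForm N = (N : ℤ) • 1 := by
  ext i j
  fin_cases i <;> fin_cases j <;> simp [altForm, dualForm, Matrix.mul_apply, Fin.sum_univ_four]

theorem dualForm_mul_altForm (N : ℕ) : dualForm N * altForm N = (N : ℤ) • 1 := by
  ext i j
  fin_cases i <;> fin_cases j <;> simp [altForm, dualForm, Matrix.mul_apply, Fin.sum_univ_four]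

/-- The upper right block of the integral model is divisible by the level. -/
def Pat (N : ℕ) (X : Matrix (Fin 4) (Fin 4) ℤ) : Prop :=
  ((N : ℤ) ∣ X 0 2 ∧ (N : ℤ) ∣ X 0 3) ∧ (N : ℤ) ∣ X 1 2 ∧ (N : ℤ) ∣ X 1 3

/-- `X` is an integral model of `√m M`. -/
def Rep (N m : ℕ) (X : Matrix (Fin 4) (Fin 4) ℤ) (M : Sp) : Prop :=
  √(m : ℝ) • mat M = realMat N X

theorem realMat_mul (N : ℕ) [NeZero N] (X Y : Matrix (Fin 4) (Fin 4) ℤ) :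
    realMat N (X * Y) = realMat N X * realMat N Y := by
  ext i j
  simp only [realMat, Matrix.mul_apply, Int.cast_sum, Int.cast_mul]
  rw [← coord.sum_comp, Finset.sum_mul]
  refine Finset.sum_congr rfl fun k _ => ?_
  have := scale_ne_zero N k
  have := scale_ne_zero N j
  field_simp

theorem realMat_one (N : ℕ) [NeZero N] : realMat N 1 = 1 := by
  ext i j
  have := scale_ne_zero N i
  by_cases h : i = j
  · subst h; simp [realMat, this]
  · simp [realMat, h]

theorem realMat_smul (N : ℕ) (k : ℤ) (X : Matrix (Fin 4) (Fin 4) ℤ) :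
    realMat N (k • X) = (k : ℝ) • realMat N X := by
  ext i j
  simp [realMat, mul_assoc]

theorem realMat_injective (N : ℕ) [NeZero N] : Function.Injective (realMat N) := by
  intro X Y h
  ext a b
  have := congrFun (congrFun h (coord.symm a)) (coord.symm b)
  simp only [realMat, Equiv.apply_symm_apply] at this
  have h1 := scale_ne_zero N (coord.symm a)
  have h2 := scale_ne_zero N (coord.symm b)
  exact_mod_cast mul_right_cancel₀ (div_ne_zero h1 h2) this

/-- The minus sign comes from the convention for `J`, which has -E in its upper right corner,
whereas `altForm` has positive entries above the diagonal. -/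
theorem realMat_symp (N : ℕ) [NeZero N] (X : Matrix (Fin 4) (Fin 4) ℤ)
    (i j : Fin 2 ⊕ Fin 2) :
    ((realMat N X).transpose * Matrix.J (Fin 2) ℝ * realMat N X) i j =
      -((X.transpose * altForm N * X) (coord i) (coord j) : ℤ) / (scale N i * scale N j) := by
  have h1 := scale_ne_zero N i
  have h2 := scale_ne_zero N j
  have hN : (N : ℝ) ≠ 0 := NeZero.ne _
  simp only [Matrix.mul_apply, Matrix.transpose_apply, Fintype.sum_sum_type, Fin.sum_univ_two,
    Fin.sum_univ_four, altForm, Matrix.J, Matrix.fromBlocks_apply₁₁, Matrix.fromBlocks_apply₁₂,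
    Matrix.fromBlocks_apply₂₁, Matrix.fromBlocks_apply₂₂, realMat, Matrix.zero_apply,
    Matrix.neg_apply, Matrix.one_apply, Fin.isValue]
  simp [coord, scale]
  field_simp
  ring

theorem rep_symp_apply {N m : ℕ} [NeZero N] {X : Matrix (Fin 4) (Fin 4) ℤ} {M : Sp}
    (h : Rep N m X M) (i j : Fin 2 ⊕ Fin 2) :
    (m : ℝ) * Matrix.J (Fin 2) ℝ i j =
      -((X.transpose * altForm N * X) (coord i) (coord j) : ℤ) / (scale N i * scale N j) := by
  rw [← realMat_symp, ← h]
  have := SymplecticGroup.mem_iff'.1 M.2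
  simp only [Matrix.transpose_smul, Matrix.smul_mul, Matrix.mul_smul, smul_smul]
  rw [this, Real.mul_self_sqrt (Nat.cast_nonneg m)]
  rfl

theorem Rep.symp {N m : ℕ} [NeZero N] {X : Matrix (Fin 4) (Fin 4) ℤ} {M : Sp}
    (h : Rep N m X M) : X.transpose * altForm N * X = (m : ℤ) • altForm N := by
  have hN : (N : ℝ) ≠ 0 := NeZero.ne _
  ext a b
  obtain ⟨i, rfl⟩ := coord.surjective a
  obtain ⟨j, rfl⟩ := coord.surjective b
  have h0 := rep_symp_apply h i j
  have h1 := scale_ne_zero N i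
  have h2 := scale_ne_zero N j
  rw [eq_div_iff (mul_ne_zero h1 h2), eq_neg_iff_add_eq_zero, add_comm, ← eq_neg_iff_add_eq_zero]
    at h0
  have h3 : (((X.transpose * altForm N * X) (coord i) (coord j) : ℤ) : ℝ) =
      (((m : ℤ) • altForm N) (coord i) (coord j) : ℤ) := by
    rw [h0]
    rcases i with i | i <;> rcases j with j | j <;> fin_cases i <;> fin_cases j <;>
      simp [Matrix.J, scale, altForm, coord]
  exact_mod_cast h3

theorem exists_rep {N m : ℕ} [NeZero N] {X : Matrix (Fin 4) (Fin 4) ℤ} (hm : 0 < m)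
    (h : X.transpose * altForm N * X = (m : ℤ) • altForm N) : ∃ M : Sp, Rep N m X M := by
  have hs : √(m : ℝ) ≠ 0 := (Real.sqrt_pos.2 (Nat.cast_pos.2 hm)).ne'
  have hm' : (m : ℝ) ≠ 0 := Nat.cast_ne_zero.2 hm.ne'
  have hN : (N : ℝ) ≠ 0 := NeZero.ne _
  refine ⟨⟨(√(m : ℝ))⁻¹ • realMat N X, SymplecticGroup.mem_iff'.2 ?_⟩, ?_⟩
  · simp only [Matrix.transpose_smul, Matrix.smul_mul, Matrix.mul_smul, smul_smul]
    rw [← mul_inv, Real.mul_self_sqrt (Nat.cast_nonneg m)]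
    ext i j
    rw [Matrix.smul_apply, realMat_symp, h, smul_eq_mul]
    rcases i with i | i <;> rcases j with j | j <;> fin_cases i <;> fin_cases j <;>
      simp [Matrix.J, scale, altForm, coord] <;> field_simp
  · change √(m : ℝ) • ((√(m : ℝ))⁻¹ • realMat N X) = _
    rw [smul_smul, mul_inv_cancel₀ hs, one_smul]

theorem Rep.mul {N m n : ℕ} [NeZero N] {X Y : Matrix (Fin 4) (Fin 4) ℤ} {A B : Sp}
    (hA : Rep N m X A) (hB : Rep N n Y B) : Rep N (m * n) (X * Y) (A * B) := by
  unfold Rep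
  rw [realMat_mul, ← hA, ← hB, smul_mul_smul_comm, Nat.cast_mul, Real.sqrt_mul (Nat.cast_nonneg m)]
  rfl

theorem rep_one (N : ℕ) [NeZero N] : Rep N 1 1 1 := by
  unfold Rep
  rw [realMat_one, Nat.cast_one, Real.sqrt_one, one_smul]; rfl

theorem Rep.smul {N m : ℕ} {X : Matrix (Fin 4) (Fin 4) ℤ} {A : Sp}
    (hA : Rep N m X A) (k : ℕ) : Rep N (k ^ 2 * m) ((k : ℤ) • X) A := by
  unfold Rep
  rw [realMat_smul, ← hA, Nat.cast_mul, Nat.cast_pow, Real.sqrt_mul (by positivity),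
    Real.sqrt_sq (Nat.cast_nonneg k), smul_smul]
  simp

theorem Rep.eq {N m : ℕ} {X : Matrix (Fin 4) (Fin 4) ℤ} {A B : Sp} (hm : 0 < m)
    (hA : Rep N m X A) (hB : Rep N m X B) : A = B := by
  have hs : √(m : ℝ) ≠ 0 := (Real.sqrt_pos.2 (Nat.cast_pos.2 hm)).ne'
  refine Subtype.ext (smul_right_injective _ hs ?_)
  exact hA.trans hB.symm

theorem Rep.eq_model {N m : ℕ} [NeZero N] {X Y : Matrix (Fin 4) (Fin 4) ℤ} {A : Sp}
    (hA : Rep N m X A) (hB : Rep N m Y A) : X = Y :=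
  realMat_injective N (hA.symm.trans hB)

/-- Conjugation by `scale` removes the denominator N and the factors N of the fourth row. Only the
four entries of the upper right block of the model keep a factor N, which is the content of `Pat`.
-/
theorem isForm_iff {N m : ℕ} [NeZero N] {M : Sp} :
    IsForm N (√(m : ℝ) • mat M) ↔ ∃ X, Pat N X ∧ Rep N m X M := by
  have hN : (N : ℝ) ≠ 0 := NeZero.ne _
  constructor
  · rintro ⟨Z, hZ⟩
    let Z' : Matrix (Fin 4) (Fin 4) ℤ := fun a b => Z (coord.symm a) (coord.symm b)
    refine ⟨fun a b => Z' a b * !![1, 1, (N : ℤ), (N : ℤ); 1, 1, (N : ℤ), (N : ℤ); 1, 1, 1, 1;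
      1, 1, 1, 1] a b, by simp [Pat], ?_⟩
    ext i j
    rw [hZ]
    rcases i with i | i <;> rcases j with j | j <;> fin_cases i <;> fin_cases j <;>
      simp [weight, realMat, coord, scale, Z', hN]
  · rintro ⟨X, ⟨⟨⟨a, ha⟩, b, hb⟩, ⟨c, hc⟩, d, hd⟩, h⟩
    refine ⟨fun i j => !![X 0 0, X 0 1, a, b; X 1 0, X 1 1, c, d; X 2 0, X 2 1, X 2 2, X 2 3;
      X 3 0, X 3 1, X 3 2, X 3 3] (coord i) (coord j), fun i j => ?_⟩
    rw [h]
    rcases i with i | i <;> rcases j with j | j <;> fin_cases i <;> fin_cases j <;>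
      simp [weight, realMat, coord, scale, ha, hb, hc, hd, hN] <;> field_simp

end Paramodular

/-! ### The multiplier ν in terms of models. -/

namespace Paramodular

theorem Pat.mul {N : ℕ} {X Y : Matrix (Fin 4) (Fin 4) ℤ} (hX : Pat N X) (hY : Pat N Y) :
    Pat N (X * Y) := by
  obtain ⟨⟨h1, h2⟩, h3, h4⟩ := hX
  obtain ⟨⟨k1, k2⟩, k3, k4⟩ := hY
  simp only [Pat, Matrix.mul_apply, Fin.sum_univ_four]
  refine ⟨⟨?_, ?_⟩, ?_, ?_⟩ <;>
    exact dvd_add (dvd_add (dvd_add (Dvd.dvd.mul_left ‹_› _) (Dvd.dvd.mul_left ‹_› _))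
      (Dvd.dvd.mul_right ‹_› _)) (Dvd.dvd.mul_right ‹_› _)

theorem pat_one (N : ℕ) : Pat N 1 := by simp [Pat]

theorem altForm_det_ne_zero (N : ℕ) [NeZero N] : (altForm N).det ≠ 0 := by
  intro h
  have h1 := congrArg Matrix.det (altForm_mul_dualForm N)
  rw [Matrix.det_mul, h, zero_mul, Matrix.det_smul, Matrix.det_one, mul_one] at h1
  exact pow_ne_zero _ (Int.natCast_ne_zero.2 (NeZero.ne N)) h1.symm

theorem det_sq_of_symp {N : ℕ} [NeZero N] {X : Matrix (Fin 4) (Fin 4) ℤ}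
    (h : X.transpose * altForm N * X = altForm N) : X.det * X.det = 1 := by
  have h1 := congrArg Matrix.det h
  rw [Matrix.det_mul, Matrix.det_mul, Matrix.det_transpose, mul_right_comm] at h1
  exact mul_right_cancel₀ (altForm_det_ne_zero N) (by rw [h1, one_mul])

theorem dual_symp {N m : ℕ} [NeZero N] (hm : 0 < m) {X : Matrix (Fin 4) (Fin 4) ℤ}
    (h : X.transpose * altForm N * X = (m : ℤ) • altForm N) :
    X * dualForm N * X.transpose = (m : ℤ) • dualForm N := by
  have hN : (N : ℤ) ≠ 0 := Int.natCast_ne_zero.2 (NeZero.ne N)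
  have hm' : (m : ℤ) ≠ 0 := Int.natCast_ne_zero.2 hm.ne'
  -- `dualForm * Xᵀ * altForm` is `N m` times the inverse of `X`
  have h1 : (dualForm N * X.transpose * altForm N) * X = ((m : ℤ) * N) • 1 := by
    rw [Matrix.mul_assoc, Matrix.mul_assoc, ← Matrix.mul_assoc X.transpose, h, Matrix.mul_smul,
      dualForm_mul_altForm, smul_smul]
  have hc : ((m : ℤ) * N) ≠ 0 := mul_ne_zero hm' hN
  -- A left inverse up to a scalar is also a right one: multiply by the adjugate and cancel the
  -- nonzero determinant.
  have h2 : X * (dualForm N * X.transpose * altForm N) = ((m : ℤ) * N) • 1 := by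
    have hd : X.det ≠ 0 := by
      intro h0
      have h3 := congrArg Matrix.det h1
      rw [Matrix.det_mul, h0, mul_zero, Matrix.det_smul, Matrix.det_one, mul_one] at h3
      exact pow_ne_zero _ hc h3.symm
    have h4 : (X * (dualForm N * X.transpose * altForm N)) * X = (((m : ℤ) * N) • 1) * X := by
      rw [Matrix.mul_assoc, h1, Matrix.mul_smul, Matrix.smul_mul, mul_one, one_mul]
    have h5 := congrArg (· * X.adjugate) h4
    simp only [Matrix.mul_assoc _ X, Matrix.mul_adjugate, Matrix.mul_smul, mul_one] at h5
    exact smul_right_injective _ hd h5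
  have h3 := congrArg (· * dualForm N) h2
  simp only [Matrix.mul_assoc, altForm_mul_dualForm, Matrix.mul_smul, mul_one, Matrix.smul_mul,
    one_mul] at h3
  rw [mul_comm, mul_smul, ← Matrix.mul_assoc] at h3
  exact smul_right_injective _ hN h3

/-- The inverse of an isometry is integral, and `dualForm N * X.transpose * altForm N` is N times
this inverse. Its lower left entries are, up to sign, the upper right entries of X with no factor N
in front, so N divides them. -/
theorem pat_of_symp {N : ℕ} [NeZero N] {X : Matrix (Fin 4) (Fin 4) ℤ}
    (h : X.transpose * altForm N * X = altForm N) : Pat N X := by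
  have h1 : (dualForm N * X.transpose * altForm N) * X = (N : ℤ) • 1 := by
    rw [Matrix.mul_assoc, Matrix.mul_assoc, ← Matrix.mul_assoc X.transpose, h,
      dualForm_mul_altForm]
  have h2 : dualForm N * X.transpose * altForm N = (N : ℤ) • (X.det • X.adjugate) := by
    have h3 := congrArg (· * X.adjugate) h1
    simp only [Matrix.mul_assoc _ X, Matrix.mul_adjugate, Matrix.mul_smul, mul_one,
      Matrix.smul_mul, one_mul] at h3
    rw [smul_comm, ← h3, smul_smul, det_sq_of_symp h, one_smul]
  have key : ∀ i j, (N : ℤ) ∣ (dualForm N * X.transpose * altForm N) i j := fun i j => by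
    rw [h2]; exact Dvd.intro _ rfl
  have k1 := key 2 0
  have k2 := key 2 1
  have k3 := key 3 0
  have k4 := key 3 1
  simp only [Matrix.mul_apply, Fin.sum_univ_four] at k1 k2 k3 k4
  simp [dualForm, altForm] at k1 k2 k3 k4
  exact ⟨⟨k4, k2⟩, k3, k1⟩

theorem mem_sigma_of_rep {N : ℕ} [NeZero N] {X : Matrix (Fin 4) (Fin 4) ℤ} {M : Sp}
    (h : Rep N 1 X M) : M ∈ Sigma N := by
  have h1 := h.symp
  rw [Nat.cast_one, one_smul] at h1
  have h2 := isForm_iff.2 ⟨X, pat_of_symp h1, h⟩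
  rwa [Nat.cast_one, Real.sqrt_one, one_smul] at h2

theorem exists_rep_of_mem_sigma {N : ℕ} [NeZero N] {M : Sp} (h : M ∈ Sigma N) :
    ∃ X, Pat N X ∧ Rep N 1 X M := by
  refine isForm_iff.1 ?_
  rw [Nat.cast_one, Real.sqrt_one, one_smul]; exact h

theorem exists_mem_sigma {N : ℕ} [NeZero N] {X : Matrix (Fin 4) (Fin 4) ℤ}
    (h : X.transpose * altForm N * X = altForm N) : ∃ M ∈ Sigma N, Rep N 1 X M := by
  obtain ⟨M, hM⟩ := exists_rep (N := N) (m := 1) one_pos (X := X) (by simpa using h)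
  exact ⟨M, mem_sigma_of_rep hM, hM⟩

theorem mem_bigG_of_rep {N m : ℕ} [NeZero N] {X : Matrix (Fin 4) (Fin 4) ℤ} {M : Sp} (hm : 0 < m)
    (h : Rep N m X M) : M ∈ bigG := by
  have hN : (N : ℝ) ≠ 0 := NeZero.ne _
  have hs : √(m : ℝ) ≠ 0 := (Real.sqrt_pos.2 (Nat.cast_pos.2 hm)).ne'
  have h1 : ∀ i j, ∃ n : ℤ, (N : ℝ) * (scale N i / scale N j) = n := by
    intro i j
    rcases i with i | i <;> rcases j with j | j <;> fin_cases i <;> fin_cases j <;>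
      first
      | (refine ⟨1, ?_⟩; simp [scale, hN]; done)
      | (refine ⟨N, ?_⟩; simp [scale, hN]; done)
      | (refine ⟨N * N, ?_⟩; simp [scale])
  choose n hn using h1
  -- One factor N clears all quotients `scale N i / scale N j`; it enters the square root as N ^ 2.
  refine ⟨N ^ 2 * m, Nat.mul_pos (pow_pos (NeZero.pos N) 2) hm,
    Matrix.of fun i j => X (coord i) (coord j) * n i j, ?_⟩
  have h2 : mat M = (√(m : ℝ))⁻¹ • realMat N X := by
    rw [← h, smul_smul, inv_mul_cancel₀ hs, one_smul]
  rw [h2, Nat.cast_mul, Nat.cast_pow, Real.sqrt_mul (by positivity), Real.sqrt_sq (by positivity)]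
  ext i j
  simp only [Matrix.smul_apply, realMat, Matrix.map_apply, Matrix.of_apply, smul_eq_mul,
    Int.cast_mul, ← hn]
  have := scale_ne_zero N j
  field_simp

theorem exists_rep_nu {N : ℕ} [NeZero N] {M : Sp} (h : M ∈ bigG) :
    ∃ X, Pat N X ∧ Rep N (nu N M) X M :=
  isForm_iff.1 (nu_spec N h).2

theorem nu_pos {N : ℕ} [NeZero N] {M : Sp} (h : M ∈ bigG) : 0 < nu N M := (nu_spec N h).1

theorem nu_dvd_of_rep {N m : ℕ} [NeZero N] {X : Matrix (Fin 4) (Fin 4) ℤ} {M : Sp} (hm : 0 < m)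
    (hX : Pat N X) (h : Rep N m X M) : nu N M ∣ m :=
  nu_dvd N (mem_bigG_of_rep hm h) hm (isForm_iff.2 ⟨X, hX, h⟩)

theorem ne_zero_of_symp {N m : ℕ} [NeZero N] (hm : 0 < m) {X : Matrix (Fin 4) (Fin 4) ℤ}
    (h : X.transpose * altForm N * X = (m : ℤ) • altForm N) : X ≠ 0 := by
  rintro rfl
  have := congrFun (congrFun h 0) 1
  simp [altForm] at this
  omega

/-- Two integral models of the same matrix, one of which is minimal, differ by an integer. -/
theorem exists_eq_smul_of_rep {N m : ℕ} [NeZero N] {X Y : Matrix (Fin 4) (Fin 4) ℤ} {M : Sp}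
    (hm : 0 < m) (hX : Pat N X) (h : Rep N m X M) (hY : Rep N (nu N M) Y M) :
    ∃ k : ℕ, 0 < k ∧ m = k ^ 2 * nu N M ∧ X = (k : ℤ) • Y := by
  obtain ⟨c, hc⟩ := nu_dvd_of_rep hm hX h
  have hG := mem_bigG_of_rep hm h
  have hY0 := ne_zero_of_symp (nu_pos hG) hY.symp
  obtain ⟨a, b, hab⟩ : ∃ a b, Y a b ≠ 0 := by
    by_contra hcon
    push Not at hcon
    exact hY0 (Matrix.ext hcon)
  have h1 : realMat N X = √(c : ℝ) • realMat N Y := by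
    rw [← h, ← hY, smul_smul, hc, Nat.cast_mul, Real.sqrt_mul (by positivity), mul_comm]
  have h2 : (X a b : ℝ) = √(c : ℝ) * Y a b := by
    have := congrFun (congrFun h1 (coord.symm a)) (coord.symm b)
    simp only [realMat, Matrix.smul_apply, Equiv.apply_symm_apply, smul_eq_mul] at this
    have e1 := scale_ne_zero N (coord.symm a)
    have e2 := scale_ne_zero N (coord.symm b)
    rw [← mul_assoc] at this
    exact mul_right_cancel₀ (div_ne_zero e1 e2) this
  -- From here the ratio c of the multipliers is seen to be a square: the equation gives Y a b ∣ X a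
  -- b.
  have h3 : X a b ^ 2 = c * Y a b ^ 2 := by
    have := congrArg (· ^ 2) h2
    simp only [mul_pow, Real.sq_sqrt (Nat.cast_nonneg c)] at this
    exact_mod_cast this
  have h4 : Y a b ∣ X a b := by
    rw [← Int.pow_dvd_pow_iff two_ne_zero]
    exact ⟨c, by rw [h3, mul_comm]⟩
  obtain ⟨d, hd⟩ := h4
  have h5 : (c : ℤ) = d ^ 2 := by
    rw [hd] at h3
    refine mul_right_cancel₀ (pow_ne_zero 2 hab) ?_
    rw [← h3]; ring
  have h6 : c = d.natAbs ^ 2 := by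
    zify; rw [sq_abs]; exact h5
  have hk : 0 < d.natAbs := by
    rcases Nat.eq_zero_or_pos d.natAbs with h0 | h0
    · rw [h6, h0] at hc; simp at hc; omega
    · exact h0
  refine ⟨d.natAbs, hk, by rw [hc, h6, mul_comm], realMat_injective N ?_⟩
  rw [h1, realMat_smul, h6, Nat.cast_pow, Real.sqrt_sq (Nat.cast_nonneg _)]
  rfl

/-- Models multiply. This divisibility is what makes the elements with ν prime to p a group. -/
theorem nu_mul_dvd {N : ℕ} [NeZero N] {A B : Sp} (hA : A ∈ bigG) (hB : B ∈ bigG) :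
    nu N (A * B) ∣ nu N A * nu N B := by
  obtain ⟨X, hX, hX'⟩ := exists_rep_nu (N := N) hA
  obtain ⟨Y, hY, hY'⟩ := exists_rep_nu (N := N) hB
  exact nu_dvd_of_rep (Nat.mul_pos (nu_pos hA) (nu_pos hB)) (hX.mul hY) (hX'.mul hY')

theorem nu_inv {N : ℕ} [NeZero N] {A : Sp} (hA : A ∈ bigG) : nu N A⁻¹ = nu N A := by
  have key : ∀ {A : Sp}, A ∈ bigG → nu N A⁻¹ ∣ nu N A := fun {A} hA =>
    nu_dvd N (inv_mem hA) (nu_pos hA) (nu_spec N hA).2.inv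
  refine Nat.dvd_antisymm (key hA) ?_
  simpa using key (inv_mem hA)

theorem nu_eq_one_iff {N : ℕ} [NeZero N] {A : Sp} (hA : A ∈ bigG) : nu N A = 1 ↔ A ∈ Sigma N := by
  constructor
  · intro h
    obtain ⟨X, -, hX⟩ := exists_rep_nu (N := N) hA
    rw [h] at hX
    exact mem_sigma_of_rep hX
  · intro h
    obtain ⟨X, hX, hX'⟩ := exists_rep_of_mem_sigma h
    exact Nat.dvd_one.1 (nu_dvd_of_rep one_pos hX hX')

/-! ### Local units and local equivalence. -/

/-- The subgroup of all `M ∈ 𝔾` with `ν(M)` prime to `p`. -/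
noncomputable def unitsAt (N : ℕ) [NeZero N] (p : Nat.Primes) : Subgroup Sp where
  carrier := {M | M ∈ bigG ∧ ¬ (p : ℕ) ∣ nu N M}
  mul_mem' := by
    rintro A B ⟨hA, hA'⟩ ⟨hB, hB'⟩
    refine ⟨mul_mem hA hB, fun h => ?_⟩
    rcases (Nat.Prime.dvd_mul p.2).1 (h.trans (nu_mul_dvd hA hB)) with h | h
    exacts [hA' h, hB' h]
  one_mem' := ⟨one_mem _, by
    rw [(nu_eq_one_iff (one_mem _)).2 (one_mem _)]; exact p.2.not_dvd_one⟩
  inv_mem' := by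
    rintro A ⟨hA, hA'⟩
    exact ⟨inv_mem hA, by rwa [nu_inv hA]⟩

theorem sigma_le_unitsAt (N : ℕ) [NeZero N] (p : Nat.Primes) : Sigma N ≤ unitsAt N p :=
  fun M hM => ⟨sigma_le N hM, by
    rw [(nu_eq_one_iff (sigma_le N hM)).2 hM]; exact p.2.not_dvd_one⟩

theorem gp_le_unitsAt (N : ℕ) [NeZero N] {p q : Nat.Primes} (h : p ≠ q) : Gp N p ≤ unitsAt N q := by
  rintro M ⟨hM, r, hr⟩
  refine ⟨hM, fun hd => h ?_⟩
  rw [hr] at hd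
  exact Subtype.ext ((Nat.prime_dvd_prime_iff_eq q.2 p.2).1 (q.2.dvd_of_dvd_pow hd)).symm

/-- A power of p that is prime to p equals 1. This is the source of multiplicity one in products of
double cosets. -/
theorem mem_sigma_of_mem_gp_of_mem_unitsAt {N : ℕ} [NeZero N] {p : Nat.Primes} {M : Sp}
    (h : M ∈ Gp N p) (h' : M ∈ unitsAt N p) : M ∈ Sigma N := by
  obtain ⟨hM, r, hr⟩ := h
  refine (nu_eq_one_iff hM).1 ?_
  rcases Nat.eq_zero_or_pos r with h0 | h0
  · rw [hr, h0, pow_zero]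
  · exact absurd (hr ▸ dvd_pow_self (p : ℕ) h0.ne') h'.2

/-- Local equivalence at `p`: the double cosets agree up to factors with `ν` prime to `p`. -/
def LocEquiv (N : ℕ) [NeZero N] (p : Nat.Primes) (M M' : Sp) : Prop :=
  ∃ g ∈ unitsAt N p, ∃ h ∈ unitsAt N p, M' = g * M * h

theorem LocEquiv.symm {N : ℕ} [NeZero N] {p : Nat.Primes} {M M' : Sp} (h : LocEquiv N p M M') :
    LocEquiv N p M' M := by
  obtain ⟨g, hg, k, hk, rfl⟩ := h
  exact ⟨g⁻¹, inv_mem hg, k⁻¹, inv_mem hk, by group⟩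

theorem LocEquiv.trans {N : ℕ} [NeZero N] {p : Nat.Primes} {M M' M'' : Sp}
    (h : LocEquiv N p M M') (h' : LocEquiv N p M' M'') : LocEquiv N p M M'' := by
  obtain ⟨g, hg, k, hk, rfl⟩ := h
  obtain ⟨g', hg', k', hk', rfl⟩ := h'
  exact ⟨g' * g, mul_mem hg' hg, k * k', mul_mem hk hk', by group⟩

theorem locEquiv_of_sigma {N : ℕ} [NeZero N] {p : Nat.Primes} {M s t : Sp} (hs : s ∈ Sigma N)
    (ht : t ∈ Sigma N) : LocEquiv N p M (s * M * t) :=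
  ⟨s, sigma_le_unitsAt N p hs, t, sigma_le_unitsAt N p ht, rfl⟩

/-- ν is submultiplicative, and the two outer factors contribute nothing at p. -/
theorem LocEquiv.pow_dvd_nu {N : ℕ} [NeZero N] {p : Nat.Primes} {M M' : Sp} (hM : M ∈ bigG)
    (h : LocEquiv N p M M') {k : ℕ} (hk : (p : ℕ) ^ k ∣ nu N M') : (p : ℕ) ^ k ∣ nu N M := by
  obtain ⟨g, hg, t, ht, rfl⟩ := h
  have h1 : (p : ℕ) ^ k ∣ nu N g * nu N M * nu N t :=
    hk.trans ((nu_mul_dvd (mul_mem hg.1 hM) ht.1).trans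
      (mul_dvd_mul_right (nu_mul_dvd hg.1 hM) _))
  have c1 : Nat.Coprime ((p : ℕ) ^ k) (nu N g) :=
    Nat.Coprime.pow_left k ((Nat.Prime.coprime_iff_not_dvd p.2).2 hg.2)
  have c2 : Nat.Coprime ((p : ℕ) ^ k) (nu N t) :=
    Nat.Coprime.pow_left k ((Nat.Prime.coprime_iff_not_dvd p.2).2 ht.2)
  exact c1.dvd_of_dvd_mul_left (c2.dvd_of_dvd_mul_right h1)

theorem nu_eq_of_locEquiv {N : ℕ} [NeZero N] {M M' : Sp} (hM : M ∈ bigG) (hM' : M' ∈ bigG)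
    (h : ∀ p, LocEquiv N p M M') : nu N M = nu N M' := by
  refine Nat.dvd_antisymm ?_ ?_ <;> rw [Nat.dvd_iff_prime_pow_dvd_dvd] <;> intro p k hp hk
  · exact (h ⟨p, hp⟩).symm.pow_dvd_nu hM' hk
  · exact (h ⟨p, hp⟩).pow_dvd_nu hM hk

/-! ### Local invariants: minors, and the first block modulo p. -/

/-- All `2 × 2` minors are divisible by `d`. -/
def DvdMinors (d : ℤ) (X : Matrix (Fin 4) (Fin 4) ℤ) : Prop :=
  ∀ i j k l, d ∣ X i k * X j l - X i l * X j k

/-- Cauchy–Binet: a minor of the product is a sum over six pairs of indices of products of minors.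
-/
theorem DvdMinors.mul {d e : ℤ} {X Y : Matrix (Fin 4) (Fin 4) ℤ} (hX : DvdMinors d X)
    (hY : DvdMinors e Y) : DvdMinors (d * e) (X * Y) := by
  intro i j k l
  have : (X * Y) i k * (X * Y) j l - (X * Y) i l * (X * Y) j k =
      (X i 0 * X j 1 - X i 1 * X j 0) * (Y 0 k * Y 1 l - Y 0 l * Y 1 k) +
      (X i 0 * X j 2 - X i 2 * X j 0) * (Y 0 k * Y 2 l - Y 0 l * Y 2 k) +
      (X i 0 * X j 3 - X i 3 * X j 0) * (Y 0 k * Y 3 l - Y 0 l * Y 3 k) +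
      (X i 1 * X j 2 - X i 2 * X j 1) * (Y 1 k * Y 2 l - Y 1 l * Y 2 k) +
      (X i 1 * X j 3 - X i 3 * X j 1) * (Y 1 k * Y 3 l - Y 1 l * Y 3 k) +
      (X i 2 * X j 3 - X i 3 * X j 2) * (Y 2 k * Y 3 l - Y 2 l * Y 3 k) := by
    simp only [Matrix.mul_apply, Fin.sum_univ_four]
    ring
  rw [this]
  exact dvd_add (dvd_add (dvd_add (dvd_add (dvd_add (mul_dvd_mul (hX _ _ _ _) (hY _ _ _ _))
    (mul_dvd_mul (hX _ _ _ _) (hY _ _ _ _))) (mul_dvd_mul (hX _ _ _ _) (hY _ _ _ _)))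
    (mul_dvd_mul (hX _ _ _ _) (hY _ _ _ _))) (mul_dvd_mul (hX _ _ _ _) (hY _ _ _ _)))
    (mul_dvd_mul (hX _ _ _ _) (hY _ _ _ _))

theorem dvdMinors_one (X : Matrix (Fin 4) (Fin 4) ℤ) : DvdMinors 1 X := fun _ _ _ _ => one_dvd _

theorem DvdMinors.mul_mul {d : ℤ} {X : Matrix (Fin 4) (Fin 4) ℤ} (hX : DvdMinors d X)
    (G H : Matrix (Fin 4) (Fin 4) ℤ) : DvdMinors d (G * X * H) := by
  simpa using ((dvdMinors_one G).mul hX).mul (dvdMinors_one H)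

/-- The first diagonal block vanishes modulo `p`. -/
def DvdBlock (p : ℤ) (X : Matrix (Fin 4) (Fin 4) ℤ) : Prop :=
  (p ∣ X 0 0 ∧ p ∣ X 0 1) ∧ p ∣ X 1 0 ∧ p ∣ X 1 1

/-- Modulo a divisor of N, a matrix with the pattern is block lower triangular, so the first
diagonal blocks multiply. -/
theorem DvdBlock.mul_left {N : ℕ} {p : ℤ} (hp : p ∣ N) {X Y : Matrix (Fin 4) (Fin 4) ℤ}
    (hY : Pat N Y) (hX : DvdBlock p X) : DvdBlock p (Y * X) := by
  obtain ⟨⟨h1, h2⟩, h3, h4⟩ := hY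
  obtain ⟨⟨k1, k2⟩, k3, k4⟩ := hX
  replace h1 := hp.trans h1
  replace h2 := hp.trans h2
  replace h3 := hp.trans h3
  replace h4 := hp.trans h4
  simp only [DvdBlock, Matrix.mul_apply, Fin.sum_univ_four]
  refine ⟨⟨?_, ?_⟩, ?_, ?_⟩ <;>
    exact dvd_add (dvd_add (dvd_add (Dvd.dvd.mul_left ‹_› _) (Dvd.dvd.mul_left ‹_› _))
      (Dvd.dvd.mul_right ‹_› _)) (Dvd.dvd.mul_right ‹_› _)

theorem DvdBlock.mul_right {N : ℕ} {p : ℤ} (hp : p ∣ N) {X Y : Matrix (Fin 4) (Fin 4) ℤ}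
    (hX : Pat N X) (hd : DvdBlock p X) : DvdBlock p (X * Y) := by
  obtain ⟨⟨h1, h2⟩, h3, h4⟩ := hX
  obtain ⟨⟨k1, k2⟩, k3, k4⟩ := hd
  replace h1 := hp.trans h1
  replace h2 := hp.trans h2
  replace h3 := hp.trans h3
  replace h4 := hp.trans h4
  simp only [DvdBlock, Matrix.mul_apply, Fin.sum_univ_four]
  refine ⟨⟨?_, ?_⟩, ?_, ?_⟩ <;>
    exact dvd_add (dvd_add (dvd_add (Dvd.dvd.mul_right ‹_› _) (Dvd.dvd.mul_right ‹_› _))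
      (Dvd.dvd.mul_right ‹_› _)) (Dvd.dvd.mul_right ‹_› _)

/-- Some integral model of `M` has a first diagonal block which is nonzero modulo `p`. -/
def GoodAt (N : ℕ) (p : Nat.Primes) (M : Sp) : Prop :=
  ∃ (m : ℕ) (X : Matrix (Fin 4) (Fin 4) ℤ), 0 < m ∧ Pat N X ∧ Rep N m X M ∧
    ¬ DvdBlock ((p : ℕ) : ℤ) X

/-- Every model with the pattern is an integer multiple of the minimal one, so goodness can be
tested there. -/
theorem GoodAt.not_dvdBlock {N : ℕ} [NeZero N] {p : Nat.Primes} {M : Sp} (h : GoodAt N p M)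
    {Y : Matrix (Fin 4) (Fin 4) ℤ} (hY : Rep N (nu N M) Y M) : ¬ DvdBlock ((p : ℕ) : ℤ) Y := by
  obtain ⟨m, X, hm, hX, hr, hd⟩ := h
  obtain ⟨k, -, -, rfl⟩ := exists_eq_smul_of_rep hm hX hr hY
  rintro ⟨⟨h1, h2⟩, h3, h4⟩
  exact hd ⟨⟨Dvd.dvd.mul_left h1 _, Dvd.dvd.mul_left h2 _⟩, Dvd.dvd.mul_left h3 _,
    Dvd.dvd.mul_left h4 _⟩

theorem exists_rep_nu_inv_mul {N : ℕ} [NeZero N] {g : Sp} (hg : g ∈ bigG) :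
    ∃ G G', Pat N G ∧ Pat N G' ∧ Rep N (nu N g) G g ∧ G' * G = (nu N g : ℤ) • 1 ∧
      G * G' = (nu N g : ℤ) • 1 := by
  obtain ⟨G, hG, hG'⟩ := exists_rep_nu (N := N) hg
  obtain ⟨H, hH, hH'⟩ := exists_rep_nu (N := N) (inv_mem hg)
  rw [nu_inv hg] at hH'
  refine ⟨G, H, hG, hH, hG', ?_, ?_⟩
  · have h1 := hH'.mul hG'
    rw [inv_mul_cancel] at h1
    refine h1.eq_model ?_
    have := (rep_one N).smul (nu N g)
    rwa [mul_one, sq] at this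
  · have h1 := hG'.mul hH'
    rw [mul_inv_cancel] at h1
    refine h1.eq_model ?_
    have := (rep_one N).smul (nu N g)
    rwa [mul_one, sq] at this

/-- Multiplying the model G X H back by models of the inverses gives ν(g) ν(t) X. If the first block
of G X H vanished modulo p, so would that of this multiple, and ν(g) ν(t) is prime to p. -/
theorem GoodAt.of_locEquiv {N : ℕ} [NeZero N] {p : Nat.Primes} (hp : (p : ℕ) ∣ N) {M M' : Sp}
    (h : LocEquiv N p M M') (hM : GoodAt N p M) : GoodAt N p M' := by
  obtain ⟨m, X, hm, hX, hr, hd⟩ := hM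
  obtain ⟨g, hg, t, ht, rfl⟩ := h
  obtain ⟨G, G', hG, hG', rG, e1, -⟩ := exists_rep_nu_inv_mul (N := N) hg.1
  obtain ⟨H, H', hH, hH', rH, -, e2⟩ := exists_rep_nu_inv_mul (N := N) ht.1
  have hpN : ((p : ℕ) : ℤ) ∣ N := Int.natCast_dvd_natCast.2 hp
  refine ⟨nu N g * m * nu N t, G * X * H, Nat.mul_pos (Nat.mul_pos (nu_pos hg.1) hm)
    (nu_pos ht.1), (hG.mul hX).mul hH, (rG.mul hr).mul rH, fun hcon => hd ?_⟩
  have h1 := ((hcon.mul_left hpN hG').mul_right hpN (hG'.mul ((hG.mul hX).mul hH)) (Y := H'))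
  have h2 : G' * (G * X * H) * H' = ((nu N t : ℤ) * (nu N g : ℤ)) • X := by
    calc G' * (G * X * H) * H' = (G' * G) * X * (H * H') := by simp only [Matrix.mul_assoc]
      _ = _ := by
        rw [e1, e2, Matrix.mul_smul, Matrix.smul_mul, Matrix.mul_one, Matrix.one_mul, smul_smul]
  rw [h2] at h1
  have hpp : Prime ((p : ℕ) : ℤ) := Nat.prime_iff_prime_int.1 p.2
  have hu : ¬ ((p : ℕ) : ℤ) ∣ (nu N t : ℤ) * (nu N g : ℤ) := fun hdv => by
    rcases hpp.dvd_or_dvd hdv with hdv | hdv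
    · exact ht.2 (Int.natCast_dvd_natCast.1 hdv)
    · exact hg.2 (Int.natCast_dvd_natCast.1 hdv)
  obtain ⟨⟨k1, k2⟩, k3, k4⟩ := h1
  exact ⟨⟨(hpp.dvd_or_dvd k1).resolve_left hu, (hpp.dvd_or_dvd k2).resolve_left hu⟩,
    (hpp.dvd_or_dvd k3).resolve_left hu, (hpp.dvd_or_dvd k4).resolve_left hu⟩

theorem goodAt_one (N : ℕ) [NeZero N] (p : Nat.Primes) : GoodAt N p 1 :=
  ⟨1, 1, one_pos, pat_one N, rep_one N, fun h => (Nat.prime_iff_prime_int.1 p.2).not_dvd_one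
    (by simpa using h.1.1)⟩

theorem goodAt_of_mem_unitsAt {N : ℕ} [NeZero N] {p : Nat.Primes} (hp : (p : ℕ) ∣ N) {M : Sp}
    (h : M ∈ unitsAt N p) : GoodAt N p M :=
  (goodAt_one N p).of_locEquiv hp ⟨M, h, 1, one_mem _, by simp⟩

end Paramodular

/-! ### Elementary divisors for the form J ⊕ N J. -/

namespace Paramodular

/-- Integral matrices which preserve the form `J ⊕ N J`. -/
def IsSp (N : ℕ) (X : Matrix (Fin 4) (Fin 4) ℤ) : Prop :=
  X.transpose * altForm N * X = altForm N

theorem isSp_one (N : ℕ) : IsSp N 1 := by simp [IsSp]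

theorem IsSp.mul {N : ℕ} {X Y : Matrix (Fin 4) (Fin 4) ℤ} (hX : IsSp N X) (hY : IsSp N Y) :
    IsSp N (X * Y) := by
  unfold IsSp at *
  calc (X * Y).transpose * altForm N * (X * Y)
      = Y.transpose * (X.transpose * altForm N * X) * Y := by
        rw [Matrix.transpose_mul]; simp only [Matrix.mul_assoc]
    _ = _ := by rw [hX, hY]

theorem IsSp.exists_inv {N : ℕ} [NeZero N] {X : Matrix (Fin 4) (Fin 4) ℤ} (hX : IsSp N X) :
    ∃ Y, IsSp N Y ∧ Y * X = 1 ∧ X * Y = 1 := by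
  have h1 : (X.det • X.adjugate) * X = 1 := by
    rw [Matrix.smul_mul, Matrix.adjugate_mul, smul_smul, det_sq_of_symp hX, one_smul]
  have h2 : X * (X.det • X.adjugate) = 1 := by
    rw [Matrix.mul_smul, Matrix.mul_adjugate, smul_smul, det_sq_of_symp hX, one_smul]
  refine ⟨X.det • X.adjugate, ?_, h1, h2⟩
  generalize X.det • X.adjugate = Y at h1 h2
  unfold IsSp at *
  have h3 : Y.transpose * X.transpose = 1 := by rw [← Matrix.transpose_mul, h2, Matrix.transpose_one]
  calc Y.transpose * altForm N * Y = Y.transpose * (X.transpose * altForm N * X) * Y := by rw [hX]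
    _ = (Y.transpose * X.transpose) * altForm N * (X * Y) := by simp only [Matrix.mul_assoc]
    _ = _ := by rw [h3, h2, Matrix.one_mul, Matrix.mul_one]

/-- The embedding of pairs of `2 × 2` matrices as block diagonal matrices. -/
def blk (K L : Matrix (Fin 2) (Fin 2) ℤ) : Matrix (Fin 4) (Fin 4) ℤ :=
  !![K 0 0, K 0 1, 0, 0; K 1 0, K 1 1, 0, 0; 0, 0, L 0 0, L 0 1; 0, 0, L 1 0, L 1 1]

theorem symp_blk (N : ℕ) {K L : Matrix (Fin 2) (Fin 2) ℤ} {m : ℤ} (hK : K.det = m)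
    (hL : L.det = m) : (blk K L).transpose * altForm N * blk K L = m • altForm N := by
  rw [Matrix.det_fin_two] at hK hL
  ext i j
  fin_cases i <;> fin_cases j <;>
    simp [Matrix.mul_apply, Fin.sum_univ_four, altForm, blk] <;>
    first
    | ring1
    | linear_combination hK
    | linear_combination -hK
    | linear_combination (N : ℤ) * hL
    | linear_combination -(N : ℤ) * hL

theorem isSp_blk (N : ℕ) {K L : Matrix (Fin 2) (Fin 2) ℤ} (hK : K.det = 1) (hL : L.det = 1) :
    IsSp N (blk K L) := by
  rw [IsSp, symp_blk N hK hL, one_smul]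

theorem blk_mul (K L K' L' : Matrix (Fin 2) (Fin 2) ℤ) :
    blk K L * blk K' L' = blk (K * K') (L * L') := by
  ext i j
  fin_cases i <;> fin_cases j <;>
    simp [Matrix.mul_apply, Fin.sum_univ_four, Fin.sum_univ_two, blk]

/-- Division with remainder: a suitable x turns x * g + c into the remainder, which is smaller than
|g| and so must vanish. -/
theorem dvd_of_forall_le_abs {g c : ℤ} (hg : g ≠ 0)
    (h : ∀ x : ℤ, x * g + c = 0 ∨ |g| ≤ |x * g + c|) : g ∣ c := by
  have e : -(c / g) * g + c = c % g := by
    have := Int.emod_add_mul_ediv c g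
    linear_combination -this
  have h1 := h (-(c / g))
  rw [e] at h1
  rcases h1 with h1 | h1
  · exact Int.dvd_of_emod_eq_zero h1
  · rw [abs_of_nonneg (Int.emod_nonneg c hg)] at h1
    exact absurd (Int.emod_lt_abs c hg) (not_lt.2 h1)

/-- Any nonempty set of nonzero integral values has one of least absolute value. -/
theorem exists_min_abs {ι : Type*} (f : ι → ℤ) (h : ∃ i, f i ≠ 0) :
    ∃ i, f i ≠ 0 ∧ ∀ j, f j = 0 ∨ |f i| ≤ |f j| := by
  obtain ⟨i, hi, hmin⟩ := WellFounded.has_min (measure fun i => (f i).natAbs).wf {i | f i ≠ 0} h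
  refine ⟨i, hi, fun j => ?_⟩
  rcases eq_or_ne (f j) 0 with h0 | h0
  · exact .inl h0
  · right
    have := hmin j h0
    have h2 : (f i).natAbs ≤ (f j).natAbs := not_lt.1 this
    zify at h2
    exact h2

/-- Smith normal form of a `2 × 2` matrix with positive determinant. -/
theorem exists_smith_two {D : Matrix (Fin 2) (Fin 2) ℤ} {m : ℕ} (hm : 0 < m) (hD : D.det = m) :
    ∃ K L : Matrix (Fin 2) (Fin 2) ℤ, K.det = 1 ∧ L.det = 1 ∧
      ∃ a b : ℕ, a * b = m ∧ a ∣ b ∧ K * D * L = !![(a : ℤ), 0; 0, (b : ℤ)] := by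
  -- Among all equivalent matrices choose one with a nonzero corner of least absolute value; this
  -- corner divides every entry.
  let ι := {P : Matrix (Fin 2) (Fin 2) ℤ × Matrix (Fin 2) (Fin 2) ℤ // P.1.det = 1 ∧ P.2.det = 1}
  have hne : ∃ P : ι, (P.1.1 * D * P.1.2) 0 0 ≠ 0 := by
    by_contra hcon
    push Not at hcon
    have h1 := hcon ⟨(1, 1), by simp, by simp⟩
    have h2 := hcon ⟨(1, !![0, -1; 1, 0]), by simp, by simp⟩
    simp only [Matrix.mul_apply, Fin.sum_univ_two] at h1 h2
    simp at h1 h2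
    rw [Matrix.det_fin_two, h1, h2] at hD
    simp at hD
    omega
  obtain ⟨⟨⟨K, L⟩, hK, hL⟩, hg, hmin⟩ := exists_min_abs _ hne
  simp only at hg hmin hK hL
  set E := K * D * L with hE
  have hmin' : ∀ P Q : Matrix (Fin 2) (Fin 2) ℤ, P.det = 1 → Q.det = 1 →
      (P * E * Q) 0 0 = 0 ∨ |E 0 0| ≤ |(P * E * Q) 0 0| := by
    intro P Q hP hQ
    have := hmin ⟨(P * K, L * Q), by simp [hP, hK], by simp [hQ, hL]⟩
    simp only [hE, Matrix.mul_assoc] at this ⊢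
    exact this
  have hEdet : E 0 0 * E 1 1 - E 0 1 * E 1 0 = m := by
    rw [← Matrix.det_fin_two, hE, Matrix.det_mul, Matrix.det_mul, hK, hL, hD]; simp
  obtain ⟨r, hr⟩ : E 0 0 ∣ E 0 1 := dvd_of_forall_le_abs hg fun x => by
    have := hmin' 1 !![x, -1; 1, 0] (by simp) (by simp)
    simp only [Matrix.mul_apply, Fin.sum_univ_two] at this
    simp at this
    rwa [mul_comm x]
  obtain ⟨s, hs⟩ : E 0 0 ∣ E 1 0 := dvd_of_forall_le_abs hg fun x => by
    have := hmin' !![x, 1; -1, 0] 1 (by simp) (by simp)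
    simp only [Matrix.mul_apply, Fin.sum_univ_two] at this
    simp at this
    exact this
  -- The test matrices produce the corner x E₀₀ + (1 - r) E₁₀ + E₁₁: the coefficient 1 - r
  -- compensates for E₀₁ = r E₀₀, so that x is multiplied by E₀₀ alone.
  obtain ⟨t, ht⟩ : E 0 0 ∣ E 1 1 := by
    have : E 0 0 ∣ (1 - r) * E 1 0 + E 1 1 := dvd_of_forall_le_abs hg fun x => by
      have := hmin' !![x, 1; -1, 0] !![1 - r, -1; 1, 0] (by simp) (by simp)
      simp only [Matrix.mul_apply, Fin.sum_univ_two] at this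
      simp at this
      have e : (x * E 0 0 + E 1 0) * (1 - r) + (x * E 0 1 + E 1 1) =
        x * E 0 0 + ((1 - r) * E 1 0 + E 1 1) := by rw [hr]; ring
      rwa [e] at this
    rwa [dvd_add_right (Dvd.dvd.mul_left ⟨s, hs⟩ _)] at this
  obtain ⟨ε, hε, hε'⟩ : ∃ ε : ℤ, ε * ε = 1 ∧ 0 ≤ ε * E 0 0 := by
    rcases le_total 0 (E 0 0) with h | h
    · exact ⟨1, by simp, by simpa using h⟩
    · exact ⟨-1, by simp, by simpa using h⟩
  have hpos : 0 < ε * E 0 0 := lt_of_le_of_ne hε' fun h => by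
    have := congrArg (ε * ·) h
    simp [← mul_assoc, hε] at this
    exact hg this.symm
  have hfin : (ε * E 0 0) * (ε * (E 1 1 - s * E 0 1)) = m := by
    rw [← hEdet, hs]
    linear_combination (E 0 0 * (E 1 1 - s * E 0 1)) * hε
  have hpos2 : 0 ≤ ε * (E 1 1 - s * E 0 1) := by
    by_contra hneg
    push Not at hneg
    have : (0 : ℤ) < m := by exact_mod_cast hm
    nlinarith
  obtain ⟨a, ha⟩ := Int.eq_ofNat_of_zero_le hpos.le
  obtain ⟨b, hb⟩ := Int.eq_ofNat_of_zero_le hpos2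
  refine ⟨!![ε, 0; -ε * s, ε] * K, L * !![1, -r; 0, 1], ?_, ?_, a, b, ?_, ?_, ?_⟩
  · rw [Matrix.det_mul, hK, Matrix.det_fin_two]; simp [hε]
  · rw [Matrix.det_mul, hL, Matrix.det_fin_two]; simp
  · rw [ha, hb] at hfin; exact_mod_cast hfin
  · rw [← Int.natCast_dvd_natCast]
    change _ = (a : ℤ) at ha
    change _ = (b : ℤ) at hb
    rw [← ha, ← hb]
    refine mul_dvd_mul_left ε ⟨t - s * r, ?_⟩
    rw [ht, hr]; ring
  · have : !![ε, 0; -ε * s, ε] * K * D * (L * !![1, -r; 0, 1]) =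
      !![ε, 0; -ε * s, ε] * E * !![1, -r; 0, 1] := by simp only [hE, Matrix.mul_assoc]
    rw [this]
    change _ = (a : ℤ) at ha
    change _ = (b : ℤ) at hb
    ext i j
    fin_cases i <;> fin_cases j <;> simp only [Matrix.mul_apply, Fin.sum_univ_two] <;> simp
    · exact ha
    · rw [hr]; ring
    · rw [hs]; ring
    · rw [← hb, hs, hr]; ring

theorem isSp_firstRow (N : ℕ) (x b c : ℤ) :
    IsSp N !![x, 1, N * b, N * c; -1, 0, 0, 0; -c, 0, 1, 0; b, 0, 0, 1] := by
  unfold IsSp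
  ext i j
  fin_cases i <;> fin_cases j <;>
    simp [Matrix.mul_apply, Fin.sum_univ_four, altForm] <;> ring

theorem isSp_firstCol (N : ℕ) (x b c : ℤ) :
    IsSp N !![x, -1, -N * c, N * b; 1, 0, 0, 0; b, 0, 1, 0; c, 0, 0, 1] := by
  unfold IsSp
  ext i j
  fin_cases i <;> fin_cases j <;>
    simp [Matrix.mul_apply, Fin.sum_univ_four, altForm] <;> ring

theorem isSp_clearRow (N : ℕ) (b c : ℤ) :
    IsSp N !![1, 0, N * b, N * c; 0, 1, 0, 0; 0, c, 1, 0; 0, -b, 0, 1] := by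
  unfold IsSp
  ext i j
  fin_cases i <;> fin_cases j <;>
    simp [Matrix.mul_apply, Fin.sum_univ_four, altForm] <;> ring

theorem isSp_clearCol (N : ℕ) (b c : ℤ) :
    IsSp N !![1, 0, 0, 0; 0, 1, N * c, -N * b; b, 0, 1, 0; c, 0, 0, 1] := by
  unfold IsSp
  ext i j
  fin_cases i <;> fin_cases j <;>
    simp [Matrix.mul_apply, Fin.sum_univ_four, altForm] <;> ring

/-- A corner entry of least absolute value divides all entries, up to the level. -/
theorem dvd_of_corner_min {N : ℕ} {Y : Matrix (Fin 4) (Fin 4) ℤ} (hg : Y 0 0 ≠ 0)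
    (hmin : ∀ S T, IsSp N S → IsSp N T → (S * Y * T) 0 0 = 0 ∨ |Y 0 0| ≤ |(S * Y * T) 0 0|) :
    DvdBlock (Y 0 0) Y ∧ ∀ i j, Y 0 0 ∣ N * Y i j := by
  have hrow : ∀ b c, Y 0 0 ∣ Y 0 1 + Y 0 2 * b + Y 0 3 * c := fun b c =>
    dvd_of_forall_le_abs hg fun x => by
      have := hmin 1 _ (isSp_one N) (isSp_firstCol N x b c)
      simp only [Matrix.mul_apply, Fin.sum_univ_four] at this
      simp at this
      convert this using 2 <;> ring_nf
  -- Isometries have the pattern, so only multiples of N times the last two rows can be added to the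
  -- first row. This is why divisibility of the lower entries is obtained only up to N.
  have hcol : ∀ b c, Y 0 0 ∣ Y 1 0 + N * Y 2 0 * b + N * Y 3 0 * c := fun b c =>
    dvd_of_forall_le_abs hg fun x => by
      have := hmin _ 1 (isSp_firstRow N x b c) (isSp_one N)
      simp only [Matrix.mul_apply, Fin.sum_univ_four] at this
      simp at this
      convert this using 2 <;> ring_nf
  have h01 : Y 0 0 ∣ Y 0 1 := by simpa using hrow 0 0
  have h02 : Y 0 0 ∣ Y 0 2 := by simpa using (dvd_add_right h01).1 (by simpa using hrow 1 0)
  have h03 : Y 0 0 ∣ Y 0 3 := by simpa using (dvd_add_right h01).1 (by simpa using hrow 0 1)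
  have h10 : Y 0 0 ∣ Y 1 0 := by simpa using hcol 0 0
  have h20 : Y 0 0 ∣ N * Y 2 0 := by simpa using (dvd_add_right h10).1 (by simpa using hcol 1 0)
  have h30 : Y 0 0 ∣ N * Y 3 0 := by simpa using (dvd_add_right h10).1 (by simpa using hcol 0 1)
  obtain ⟨r, hr⟩ := h01
  obtain ⟨s, hs⟩ := h02
  obtain ⟨t, ht⟩ := h03
  have hall : ∀ b c b' c', Y 0 0 ∣ (Y 1 1 + Y 1 2 * b' + Y 1 3 * c') +
      N * b * (Y 2 1 + Y 2 2 * b' + Y 2 3 * c') +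
      N * c * (Y 3 1 + Y 3 2 * b' + Y 3 3 * c') := by
    intro b c b' c'
    -- The coefficient 1 - r - s b' - t c' is chosen so that the total coefficient of x is exactly Y
    -- 0 0.
    have key : Y 0 0 ∣ (1 - r - s * b' - t * c') * (Y 1 0 + N * Y 2 0 * b + N * Y 3 0 * c) +
      ((Y 1 1 + Y 1 2 * b' + Y 1 3 * c') + N * b * (Y 2 1 + Y 2 2 * b' + Y 2 3 * c') +
        N * c * (Y 3 1 + Y 3 2 * b' + Y 3 3 * c')) := dvd_of_forall_le_abs hg fun x => by
      have := hmin _ _ (isSp_firstRow N x b c)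
        (isSp_firstCol N (1 - r - s * b' - t * c') b' c')
      simp only [Matrix.mul_apply, Fin.sum_univ_four] at this
      simp at this
      rw [hr, hs, ht] at this
      convert this using 2 <;> ring_nf
    exact (dvd_add_right (Dvd.dvd.mul_left (hcol b c) _)).1 key
  have h11 : Y 0 0 ∣ Y 1 1 := by simpa using hall 0 0 0 0
  have h12 : Y 0 0 ∣ Y 1 2 := (dvd_add_right h11).1 (by simpa using hall 0 0 1 0)
  have h13 : Y 0 0 ∣ Y 1 3 := (dvd_add_right h11).1 (by simpa using hall 0 0 0 1)
  have h21 : Y 0 0 ∣ N * Y 2 1 := (dvd_add_right h11).1 (by simpa using hall 1 0 0 0)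
  have h31 : Y 0 0 ∣ N * Y 3 1 := (dvd_add_right h11).1 (by simpa using hall 0 1 0 0)
  have h22 : Y 0 0 ∣ N * Y 2 2 := by
    have := hall 1 0 1 0
    have e := (dvd_add_right (dvd_add (dvd_add h11 h12) h21)).1
      (show Y 0 0 ∣ (Y 1 1 + Y 1 2 + N * Y 2 1) + N * Y 2 2 by
        convert this using 1; ring)
    exact e
  have h23 : Y 0 0 ∣ N * Y 2 3 := by
    have := hall 1 0 0 1
    exact (dvd_add_right (dvd_add (dvd_add h11 h13) h21)).1
      (show Y 0 0 ∣ (Y 1 1 + Y 1 3 + N * Y 2 1) + N * Y 2 3 by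
        convert this using 1; ring)
  have h32 : Y 0 0 ∣ N * Y 3 2 := by
    have := hall 0 1 1 0
    exact (dvd_add_right (dvd_add (dvd_add h11 h12) h31)).1
      (show Y 0 0 ∣ (Y 1 1 + Y 1 2 + N * Y 3 1) + N * Y 3 2 by
        convert this using 1; ring)
  have h33 : Y 0 0 ∣ N * Y 3 3 := by
    have := hall 0 1 0 1
    exact (dvd_add_right (dvd_add (dvd_add h11 h13) h31)).1
      (show Y 0 0 ∣ (Y 1 1 + Y 1 3 + N * Y 3 1) + N * Y 3 3 by
        convert this using 1; ring)
  refine ⟨⟨⟨dvd_rfl, ⟨r, hr⟩⟩, h10, h11⟩, fun i j => ?_⟩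
  have h00 : Y 0 0 ∣ N * Y 0 0 := Dvd.intro_left _ rfl
  have h01 : Y 0 0 ∣ N * Y 0 1 := Dvd.dvd.mul_left ⟨r, hr⟩ _
  have h02 : Y 0 0 ∣ N * Y 0 2 := Dvd.dvd.mul_left ⟨s, hs⟩ _
  have h03 : Y 0 0 ∣ N * Y 0 3 := Dvd.dvd.mul_left ⟨t, ht⟩ _
  replace h10 : Y 0 0 ∣ N * Y 1 0 := Dvd.dvd.mul_left h10 _
  replace h11 : Y 0 0 ∣ N * Y 1 1 := Dvd.dvd.mul_left h11 _
  replace h12 : Y 0 0 ∣ N * Y 1 2 := Dvd.dvd.mul_left h12 _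
  replace h13 : Y 0 0 ∣ N * Y 1 3 := Dvd.dvd.mul_left h13 _
  fin_cases i <;> fin_cases j <;> assumption

/-- The diagonal matrix `diag(1, m, a, b)`. -/
def diagMat (m a b : ℕ) : Matrix (Fin 4) (Fin 4) ℤ :=
  !![1, 0, 0, 0; 0, (m : ℤ), 0, 0; 0, 0, (a : ℤ), 0; 0, 0, 0, (b : ℤ)]

/-- If all these corners vanished, the four test isometries would show that the first row of X is
zero, whereas entry (0, 1) of `dual_symp` is -m N. -/
theorem exists_corner_ne_zero {N m : ℕ} [NeZero N] (hm : 0 < m) {X : Matrix (Fin 4) (Fin 4) ℤ}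
    (hs : X.transpose * altForm N * X = (m : ℤ) • altForm N) :
    ∃ T, IsSp N T ∧ (X * T) 0 0 ≠ 0 := by
  by_contra hcon
  push Not at hcon
  have h0 := hcon 1 (isSp_one N)
  have h1 := hcon _ (isSp_firstCol N 0 0 0)
  have h2 := hcon _ (isSp_clearCol N 1 0)
  have h3 := hcon _ (isSp_clearCol N 0 1)
  rw [Matrix.mul_one] at h0
  simp only [Matrix.mul_apply, Fin.sum_univ_four] at h1 h2 h3
  simp [h0] at h1 h2 h3
  have h4 := congrFun (congrFun (dual_symp hm hs) 0) 1
  simp only [Matrix.mul_apply, Fin.sum_univ_four, Matrix.transpose_apply] at h4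
  simp [h0, h1, h2, h3, dualForm] at h4
  rcases h4 with h4 | h4
  · omega
  · exact NeZero.ne N h4

/-- The elementary divisor theorem for integral symplectic similitudes. -/
theorem exists_diagMat {N m : ℕ} [NeZero N] (hm : 0 < m) {X : Matrix (Fin 4) (Fin 4) ℤ}
    (hX : Pat N X) (hs : X.transpose * altForm N * X = (m : ℤ) • altForm N)
    (hgood : ∀ p : ℕ, p.Prime → p ∣ N → ¬ DvdBlock (p : ℤ) X)
    (hprim : ∀ p : ℕ, p.Prime → ¬ p ∣ N → ∃ i j, ¬ (p : ℤ) ∣ X i j) :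
    ∃ S T, IsSp N S ∧ IsSp N T ∧ ∃ a b : ℕ, a * b = m ∧ a ∣ b ∧ S * X * T = diagMat m a b := by
  let ι := {P : Matrix (Fin 4) (Fin 4) ℤ × Matrix (Fin 4) (Fin 4) ℤ // IsSp N P.1 ∧ IsSp N P.2}
  have hne : ∃ P : ι, (P.1.1 * X * P.1.2) 0 0 ≠ 0 := by
    obtain ⟨T, hT, h⟩ := exists_corner_ne_zero hm hs
    exact ⟨⟨(1, T), isSp_one N, hT⟩, by simpa using h⟩
  obtain ⟨⟨⟨S, T⟩, hS, hT⟩, hg, hmin⟩ := exists_min_abs _ hne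
  simp only at hg hmin hS hT
  obtain ⟨S', hS', hSS, -⟩ := hS.exists_inv
  obtain ⟨T', hT', -, hTT⟩ := hT.exists_inv
  set Y := S * X * T with hY
  have hXY : X = S' * Y * T' := by
    calc X = (S' * S) * X * (T * T') := by rw [hSS, hTT, Matrix.one_mul, Matrix.mul_one]
      _ = _ := by simp only [hY, Matrix.mul_assoc]
  obtain ⟨hb, hall⟩ := dvd_of_corner_min hg fun P Q hP hQ => by
    have := hmin ⟨(P * S, T * Q), hP.mul hS, hT.mul hQ⟩
    simp only [hY, Matrix.mul_assoc] at this ⊢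
    exact this
  -- A prime dividing the minimal corner divides the whole first block if it divides N, and all of Y
  -- otherwise. Since S and T are invertible, this carries over to X and contradicts goodness or
  -- primitivity.
  have hunit : IsUnit (Y 0 0) := by
    rw [Int.isUnit_iff_natAbs_eq]
    by_contra h1
    obtain ⟨p, hp, hpd⟩ := Nat.exists_prime_and_dvd h1
    have hpd' : (p : ℤ) ∣ Y 0 0 := Int.natCast_dvd.2 hpd
    by_cases hpN : p ∣ N
    · have hpN' : (p : ℤ) ∣ N := Int.natCast_dvd_natCast.2 hpN
      refine hgood p hp hpN ?_
      have hYp : Pat N Y := ((pat_of_symp hS).mul hX).mul (pat_of_symp hT)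
      have hd : DvdBlock (p : ℤ) Y := ⟨⟨hpd'.trans hb.1.1, hpd'.trans hb.1.2⟩,
        hpd'.trans hb.2.1, hpd'.trans hb.2.2⟩
      rw [hXY]
      exact (hd.mul_left hpN' (pat_of_symp hS')).mul_right hpN' ((pat_of_symp hS').mul hYp)
    · obtain ⟨i, j, hij⟩ := hprim p hp hpN
      refine hij ?_
      have hY' : ∀ k l, (p : ℤ) ∣ Y k l := fun k l => by
        refine ((Nat.prime_iff_prime_int.1 hp).dvd_or_dvd (hpd'.trans (hall k l))).resolve_left ?_
        rwa [Int.natCast_dvd_natCast]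
      rw [hXY, Matrix.mul_apply]
      refine Finset.dvd_sum fun k _ => Dvd.dvd.mul_right ?_ _
      rw [Matrix.mul_apply]
      exact Finset.dvd_sum fun l _ => Dvd.dvd.mul_left (hY' _ _) _
  have hYs : Y.transpose * altForm N * Y = (m : ℤ) • altForm N := by
    unfold IsSp at hS hT
    calc Y.transpose * altForm N * Y
        = T.transpose * (X.transpose * (S.transpose * altForm N * S) * X) * T := by
          rw [hY, Matrix.transpose_mul, Matrix.transpose_mul]; simp only [Matrix.mul_assoc]
      _ = _ := by rw [hS, hs, Matrix.mul_smul, Matrix.smul_mul, hT]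
  have hYp : Pat N Y := ((pat_of_symp hS).mul hX).mul (pat_of_symp hT)
  clear_value Y
  -- normalise the corner to `1`
  obtain ⟨ε, hε, hε1⟩ : ∃ ε : ℤ, ε * ε = 1 ∧ ε * Y 0 0 = 1 := by
    rcases Int.isUnit_iff.1 hunit with h | h
    · exact ⟨1, by simp, by simp [h]⟩
    · exact ⟨-1, by simp, by simp [h]⟩
  obtain ⟨⟨⟨b, hb2⟩, c, hc2⟩, -⟩ := hYp
  -- clear the first row
  let R : Matrix (Fin 4) (Fin 4) ℤ := blk !![ε, 0; 0, ε] 1 * blk !![1, -ε * Y 0 1; 0, 1] 1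
  have hR : IsSp N R := (isSp_blk N (by simp [Matrix.det_fin_two, hε]) (by simp)).mul
    (isSp_blk N (by simp [Matrix.det_fin_two]) (by simp))
  let R' : Matrix (Fin 4) (Fin 4) ℤ :=
    !![1, 0, N * (-b), N * (-c); 0, 1, 0, 0; 0, -c, 1, 0; 0, -(-b), 0, 1]
  have hR' : IsSp N R' := isSp_clearRow N (-b) (-c)
  set Z := Y * R * R' with hZ
  have e00 : (Y * R) 0 0 = 1 := by
    simp only [R, Matrix.mul_apply, Fin.sum_univ_four]; simp [blk]; linarith
  have e01 : (Y * R) 0 1 = 0 := by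
    simp only [R, Matrix.mul_apply, Fin.sum_univ_four]; simp [blk]
    linear_combination (-ε * Y 0 1) * hε1
  have e02 : (Y * R) 0 2 = N * b := by
    simp only [R, Matrix.mul_apply, Fin.sum_univ_four]; simp [blk, hb2]
  have e03 : (Y * R) 0 3 = N * c := by
    simp only [R, Matrix.mul_apply, Fin.sum_univ_four]; simp [blk, hc2]
  have z0 : ∀ j, Z 0 j = if j = 0 then 1 else 0 := by
    intro j
    rw [hZ, Matrix.mul_apply, Fin.sum_univ_four, e00, e01, e02, e03]
    fin_cases j <;> simp [R']
    ring
  -- clear the first column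
  let Q : Matrix (Fin 4) (Fin 4) ℤ :=
    !![1, 0, 0, 0; 0, 1, N * (-Z 3 0), -N * (-Z 2 0); -Z 2 0, 0, 1, 0; -Z 3 0, 0, 0, 1] *
      blk !![1, 0; -Z 1 0, 1] 1
  have hQ : IsSp N Q := (isSp_clearCol N (-Z 2 0) (-Z 3 0)).mul
    (isSp_blk N (by simp [Matrix.det_fin_two]) (by simp))
  set U := Q * Z with hU
  have u0 : ∀ j, U 0 j = if j = 0 then 1 else 0 := by
    intro j
    rw [hU, Matrix.mul_apply, Fin.sum_univ_four, z0]
    simp only [Q, Matrix.mul_apply, Fin.sum_univ_four]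
    fin_cases j <;> simp [blk]
  have u0' : ∀ i, U i 0 = if i = 0 then 1 else 0 := by
    intro i
    rw [hU, Matrix.mul_apply, Fin.sum_univ_four, z0]
    simp only [Q, Matrix.mul_apply, Fin.sum_univ_four]
    fin_cases i <;> simp [blk]
    ring
  have hUs : U.transpose * altForm N * U = (m : ℤ) • altForm N := by
    have h1 : U = Q * Y * (R * R') := by simp only [hU, hZ, Matrix.mul_assoc]
    have hRR := hR.mul hR'
    unfold IsSp at hQ hRR
    calc U.transpose * altForm N * U
        = (R * R').transpose * (Y.transpose * (Q.transpose * altForm N * Q) * Y) * (R * R') := by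
          rw [h1]; simp only [Matrix.transpose_mul, Matrix.mul_assoc]
      _ = _ := by rw [hQ, hYs, Matrix.mul_smul, Matrix.smul_mul, hRR]
  have hN : (N : ℤ) ≠ 0 := Int.natCast_ne_zero.2 (NeZero.ne N)
  have hUd := dual_symp hm hUs
  -- The first column of U is a basis vector, so row 0 of the similitude relation prescribes the
  -- second row of U. The dual relation does the same for the second column.
  have u1 : ∀ j, U 1 j = if j = 1 then (m : ℤ) else 0 := by
    intro j
    have := congrFun (congrFun hUs 0) j
    simp only [Matrix.mul_apply, Fin.sum_univ_four, Matrix.transpose_apply, u0'] at this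
    fin_cases j <;> simp [altForm] at this ⊢
    · exact u0' 1
    all_goals exact this
  have u1' : ∀ i, U i 1 = if i = 1 then (m : ℤ) else 0 := by
    intro i
    have := congrFun (congrFun hUd 0) i
    simp only [Matrix.mul_apply, Fin.sum_univ_four, Matrix.transpose_apply, u0] at this
    fin_cases i <;> simp [dualForm, NeZero.ne N] at this ⊢
    · exact u0 1
    · linarith [mul_left_cancel₀ hN (by linarith : (N : ℤ) * U 1 1 = N * m)]
    all_goals exact this
  -- The remaining block has determinant m, and pairs of unimodular 2 × 2 matrices act on it through
  -- isometries, so its Smith form can be reached.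
  have udet : (!![U 2 2, U 2 3; U 3 2, U 3 3]).det = (m : ℤ) := by
    have := congrFun (congrFun hUs 2) 3
    simp only [Matrix.mul_apply, Fin.sum_univ_four, Matrix.transpose_apply] at this
    simp [altForm, u0, u1] at this
    rw [Matrix.det_fin_two]
    simp
    exact mul_left_cancel₀ hN (by linarith)
  obtain ⟨K, L, hK, hL, a, b', hab, hdvd, hdiag⟩ := exists_smith_two hm udet
  refine ⟨blk 1 K * Q * S, T * R * R' * blk 1 L, ((isSp_blk N (by simp) hK).mul hQ).mul hS,
    ((hT.mul hR).mul hR').mul (isSp_blk N (by simp) hL), a, b', hab, hdvd, ?_⟩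
  have h1 : U = blk !![1, 0; 0, (m : ℤ)] !![U 2 2, U 2 3; U 3 2, U 3 3] := by
    ext i j
    fin_cases i <;> fin_cases j <;> simp [blk, u0, u0', u1, u1']
  calc blk 1 K * Q * S * X * (T * R * R' * blk 1 L)
      = blk 1 K * (Q * (S * X * T * R * R')) * blk 1 L := by simp only [Matrix.mul_assoc]
    _ = blk 1 K * U * blk 1 L := by rw [← hY]
    _ = diagMat m a b' := by
      rw [h1, blk_mul, blk_mul, hdiag, Matrix.one_mul, Matrix.mul_one]
      ext i j
      fin_cases i <;> fin_cases j <;> simp [blk, diagMat]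

end Paramodular

/-! ### The matrices W_d: models, conjugation, and goodness. -/

namespace Paramodular

/-- The matrix with blocks `A`, `N B`, `C`, `D`. -/
def ofBlocks (N : ℤ) (A B C D : Matrix (Fin 2) (Fin 2) ℤ) : Matrix (Fin 4) (Fin 4) ℤ :=
  !![A 0 0, A 0 1, N * B 0 0, N * B 0 1; A 1 0, A 1 1, N * B 1 0, N * B 1 1;
    C 0 0, C 0 1, D 0 0, D 0 1; C 1 0, C 1 1, D 1 0, D 1 1]

theorem pat_ofBlocks (N : ℕ) (A B C D : Matrix (Fin 2) (Fin 2) ℤ) :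
    Pat N (ofBlocks N A B C D) := by simp [Pat, ofBlocks]

theorem Pat.exists_ofBlocks {N : ℕ} {X : Matrix (Fin 4) (Fin 4) ℤ} (h : Pat N X) :
    ∃ A B C D, X = ofBlocks N A B C D := by
  obtain ⟨⟨⟨a, ha⟩, b, hb⟩, ⟨c, hc⟩, d, hd⟩ := h
  refine ⟨!![X 0 0, X 0 1; X 1 0, X 1 1], !![a, b; c, d], !![X 2 0, X 2 1; X 3 0, X 3 1],
    !![X 2 2, X 2 3; X 3 2, X 3 3], ?_⟩
  ext i j
  fin_cases i <;> fin_cases j <;> simp [ofBlocks, *]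

/-- The integral model of `√p W_p`. -/
def wMat (N p α β γ δ : ℤ) : Matrix (Fin 4) (Fin 4) ℤ :=
  !![α * p, 0, β * N, 0; 0, δ * p, 0, -γ * N; γ, 0, δ * p, 0; 0, -β, 0, α * p]

/-- The conjugate of a block matrix by `wMat`. -/
def wConj (p n α β γ δ : ℤ) (A B C D : Matrix (Fin 2) (Fin 2) ℤ) : Matrix (Fin 4) (Fin 4) ℤ :=
  !![
    p * (α * A 0 0 * δ) + (p * n) * (β * C 0 0 * δ) + (p * n) * (α * B 0 0 * (-γ)) + n * (β * D 0 0 * (-γ)),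
    p * (α * A 0 1 * α) + (p * n) * (β * C 0 1 * α) + (p * n) * (α * B 0 1 * β) + n * (β * D 0 1 * β),
    (p * n) * (α * A 0 0 * (-β) + n * (β * C 0 0 * (-β)) + p * (α * B 0 0 * α) + β * D 0 0 * α),
    (p * n) * (α * A 0 1 * γ + n * (β * C 0 1 * γ) + p * (α * B 0 1 * δ) + β * D 0 1 * δ);
    p * (δ * A 1 0 * δ) + (p * n) * ((-γ) * C 1 0 * δ) + (p * n) * (δ * B 1 0 * (-γ)) + n * ((-γ) * D 1 0 * (-γ)),
    p * (δ * A 1 1 * α) + (p * n) * ((-γ) * C 1 1 * α) + (p * n) * (δ * B 1 1 * β) + n * ((-γ) * D 1 1 * β),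
    (p * n) * (δ * A 1 0 * (-β) + n * ((-γ) * C 1 0 * (-β)) + p * (δ * B 1 0 * α) + (-γ) * D 1 0 * α),
    (p * n) * (δ * A 1 1 * γ + n * ((-γ) * C 1 1 * γ) + p * (δ * B 1 1 * δ) + (-γ) * D 1 1 * δ);
    γ * A 0 0 * δ + p * (δ * C 0 0 * δ) + n * (γ * B 0 0 * (-γ)) + δ * D 0 0 * (-γ),
    γ * A 0 1 * α + p * (δ * C 0 1 * α) + n * (γ * B 0 1 * β) + δ * D 0 1 * β,
    n * (γ * A 0 0 * (-β)) + (p * n) * (δ * C 0 0 * (-β)) + (p * n) * (γ * B 0 0 * α) + p * (δ * D 0 0 * α),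
    n * (γ * A 0 1 * γ) + (p * n) * (δ * C 0 1 * γ) + (p * n) * (γ * B 0 1 * δ) + p * (δ * D 0 1 * δ);
    (-β) * A 1 0 * δ + p * (α * C 1 0 * δ) + n * ((-β) * B 1 0 * (-γ)) + α * D 1 0 * (-γ),
    (-β) * A 1 1 * α + p * (α * C 1 1 * α) + n * ((-β) * B 1 1 * β) + α * D 1 1 * β,
    n * ((-β) * A 1 0 * (-β)) + (p * n) * (α * C 1 0 * (-β)) + (p * n) * ((-β) * B 1 0 * α) + p * (α * D 1 0 * α),
    n * ((-β) * A 1 1 * γ) + (p * n) * (α * C 1 1 * γ) + (p * n) * ((-β) * B 1 1 * δ) + p * (α * D 1 1 * δ)]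

/-- After division by p, all terms of the first block of `wConj` except those in D keep a factor p,
and likewise those of the last block except the ones in A: modulo p the diagonal blocks change
places. -/
theorem wMat_conj (p n α β γ δ : ℤ) (A B C D : Matrix (Fin 2) (Fin 2) ℤ) :
    wMat (p * n) p α β γ δ * ofBlocks (p * n) A B C D * wMat (p * n) p δ (-β) (-γ) α =
      p • wConj p n α β γ δ A B C D := by
  ext i j
  fin_cases i <;> fin_cases j <;> simp only [Matrix.mul_apply, Fin.sum_univ_four] <;>
    simp [wMat, ofBlocks, wConj] <;> ring

/-- The inverse has the same shape with α, δ exchanged and β, γ negated, since the product of the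
two models is the scalar d. -/
theorem rep_of_isW {N d : ℕ} [NeZero N] (hd : 0 < d) {W : Sp} (h : IsW N d (mat W)) :
    ∃ α β γ δ : ℤ, α * δ * d ^ 2 - β * γ * N = d ∧ Rep N d (wMat N d α β γ δ) W ∧
      Rep N d (wMat N d δ (-β) (-γ) α) W⁻¹ := by
  obtain ⟨α, β, γ, δ, V, hV, hdet, hW⟩ := h
  have hd' : (d : ℝ) ≠ 0 := Nat.cast_ne_zero.2 hd.ne'
  have hs : √(d : ℝ) ≠ 0 := (Real.sqrt_pos.2 (Nat.cast_pos.2 hd)).ne'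
  have hss : √(d : ℝ) * √(d : ℝ) = d := Real.mul_self_sqrt (Nat.cast_nonneg d)
  have hN : (N : ℝ) ≠ 0 := NeZero.ne _
  have e : α * δ * d ^ 2 - β * γ * N = d := by
    rw [hV, Matrix.det_smul, Matrix.det_fin_two] at hdet
    simp at hdet
    field_simp at hdet
    have : (α : ℝ) * δ * d ^ 2 - β * γ * N = d := by linarith
    exact_mod_cast this
  have hinv : V.transpose⁻¹ = (1 / √(d : ℝ)) •
      !![(δ : ℝ) * d, -(γ : ℝ); -(β : ℝ) * N, (α : ℝ) * d] := by
    refine Matrix.inv_eq_left_inv ?_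
    rw [hV]
    have e' : (α : ℝ) * δ * d ^ 2 - β * γ * N = d := by exact_mod_cast e
    ext i j
    fin_cases i <;> fin_cases j <;> simp [Matrix.mul_apply, Fin.sum_univ_two] <;> field_simp <;>
      first | ring1 | linear_combination e' - hss
  have hr : Rep N d (wMat N d α β γ δ) W := by
    unfold Rep
    rw [hW, hinv, hV]
    ext i j
    rcases i with i | i <;> rcases j with j | j <;> fin_cases i <;> fin_cases j <;>
      simp [realMat, wMat, scale, coord, hs, hN]
  refine ⟨α, β, γ, δ, e, hr, ?_⟩
  have h2 : wMat N d δ (-β) (-γ) α * wMat N d α β γ δ = (d : ℤ) • 1 := by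
    ext i j
    fin_cases i <;> fin_cases j <;> simp only [Matrix.mul_apply, Fin.sum_univ_four] <;>
      simp [wMat] <;> first | ring1 | linear_combination e
  unfold Rep
  have h3 : realMat N (wMat N d δ (-β) (-γ) α) * mat W = √(d : ℝ) • 1 := by
    have := congrArg (realMat N) h2
    rw [realMat_mul, ← hr, realMat_smul, realMat_one, Matrix.mul_smul] at this
    refine smul_right_injective _ hs ?_
    simp only [smul_smul, hss]
    exact_mod_cast this
  have h4 : mat W * mat W⁻¹ = 1 := congrArg Subtype.val (mul_inv_cancel W)
  calc √(d : ℝ) • mat W⁻¹ = (√(d : ℝ) • 1) * mat W⁻¹ := by rw [Matrix.smul_mul, Matrix.one_mul]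
    _ = _ := by rw [← h3, Matrix.mul_assoc, h4, Matrix.mul_one]

end Paramodular

namespace Paramodular

theorem Rep.of_smul {N m k : ℕ} {X : Matrix (Fin 4) (Fin 4) ℤ} {M : Sp} (hk : 0 < k)
    (h : Rep N (k ^ 2 * m) ((k : ℤ) • X) M) : Rep N m X M := by
  have hk' : (k : ℝ) ≠ 0 := Nat.cast_ne_zero.2 hk.ne'
  unfold Rep at h ⊢
  rw [realMat_smul, Nat.cast_mul, Nat.cast_pow, Real.sqrt_mul (by positivity),
    Real.sqrt_sq (Nat.cast_nonneg k), mul_smul] at h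
  exact smul_right_injective _ hk' (by exact_mod_cast h)

/-- Entry (0, 1) of the similitude relation is m on one side and k² times an integer on the other.
-/
theorem sq_dvd_of_rep_smul {N m k : ℕ} [NeZero N] {X : Matrix (Fin 4) (Fin 4) ℤ} {M : Sp}
    (hX : Pat N X) (h : Rep N m ((k : ℤ) • X) M) : k ^ 2 ∣ m := by
  obtain ⟨A, B, C, D, rfl⟩ := hX.exists_ofBlocks
  have := congrFun (congrFun h.symp 0) 1
  simp only [Matrix.mul_apply, Fin.sum_univ_four, Matrix.transpose_apply] at this
  simp [altForm, ofBlocks] at this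
  rw [← Int.natCast_dvd_natCast, ← this]
  refine ⟨A 0 0 * A 1 1 - A 0 1 * A 1 0 + N * (C 0 0 * C 1 1 - C 0 1 * C 1 0), ?_⟩
  push_cast
  ring

/-- A minimal integral model is primitive. -/
theorem eq_one_of_rep_nu_smul {N k : ℕ} [NeZero N] {X : Matrix (Fin 4) (Fin 4) ℤ} {M : Sp}
    (hM : M ∈ bigG) (hX : Pat N X) (h : Rep N (nu N M) ((k : ℤ) • X) M) : k = 1 := by
  obtain ⟨m, hm⟩ := sq_dvd_of_rep_smul hX h
  have hpos := nu_pos (N := N) hM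
  have hk : 0 < k := Nat.pos_of_ne_zero fun h0 => by
    rw [hm, h0] at hpos; simp at hpos
  have hm0 : 0 < m := Nat.pos_of_ne_zero fun h0 => by
    rw [hm, h0] at hpos; simp at hpos
  rw [hm] at h
  have h1 := Nat.le_of_dvd hm0 (nu_dvd_of_rep hm0 hX (h.of_smul hk))
  rw [hm] at h1
  have h2 : k ^ 2 ≤ 1 := by
    by_contra hcon
    nlinarith
  nlinarith

/-- The product of the three models has multiplier d² m and is divisible by d, which leaves a model
with the original multiplier. Hence conjugation does not raise ν. -/
theorem isW_conj_rep {N m d : ℕ} [NeZero N] (hd : 0 < d) (hdN : d ∣ N) {W M : Sp}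
    (h : IsW N d (mat W)) {A B C D : Matrix (Fin 2) (Fin 2) ℤ}
    (hr : Rep N m (ofBlocks N A B C D) M) :
    ∃ (n : ℕ) (α β γ δ : ℤ), N = d * n ∧ α * δ * d - β * γ * n = 1 ∧
      Rep N m (wConj d n α β γ δ A B C D) (W * M * W⁻¹) := by
  obtain ⟨α, β, γ, δ, e, h1, h2⟩ := rep_of_isW hd h
  obtain ⟨n, hn⟩ := hdN
  have hdz : (d : ℤ) ≠ 0 := Int.natCast_ne_zero.2 hd.ne'
  refine ⟨n, α, β, γ, δ, hn, ?_, ?_⟩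
  · rw [hn] at e
    push_cast at e
    exact mul_left_cancel₀ hdz (by linear_combination e)
  · have h3 := (h1.mul hr).mul h2
    have h4 := wMat_conj d n α β γ δ A B C D
    have hn' : (N : ℤ) = d * n := by exact_mod_cast hn
    rw [← hn'] at h4
    rw [h4, show d * m * d = d ^ 2 * m by ring] at h3
    exact h3.of_smul hd

theorem pat_wConj (p n : ℕ) (α β γ δ : ℤ) (A B C D : Matrix (Fin 2) (Fin 2) ℤ) :
    Pat (p * n) (wConj p n α β γ δ A B C D) := by
  refine ⟨⟨?_, ?_⟩, ?_, ?_⟩ <;> push_cast <;> exact Dvd.intro _ rfl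

theorem isW_inv {N d : ℕ} {W : Sp} (h : IsW N d (mat W)) : IsW N d (mat W⁻¹) := by
  obtain ⟨α, β, γ, δ, V, hV, hdet, hW⟩ := h
  have hVu : IsUnit V.det := by rw [hdet]; exact isUnit_one
  have hVi : V⁻¹ = (1 / √(d : ℝ)) •
      !![((δ : ℤ) : ℝ) * d, ((-β : ℤ) : ℝ) * N; ((-γ : ℤ) : ℝ), ((α : ℤ) : ℝ) * d] := by
    rw [Matrix.inv_def, hdet, Ring.inverse_one, one_smul, hV, Matrix.adjugate_smul]
    simp [Matrix.adjugate_fin_two_of]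
  refine ⟨δ, -β, -γ, α, V⁻¹, hVi, by rw [Matrix.det_nonsing_inv, hdet, Ring.inverse_one], ?_⟩
  have hW2 : mat W * mat W⁻¹ = 1 := congrArg Subtype.val (mul_inv_cancel W)
  have hW3 : Matrix.fromBlocks V⁻¹ 0 0 V⁻¹.transpose⁻¹ * mat W = 1 := by
    rw [hW, Matrix.fromBlocks_multiply]
    have e1 : V⁻¹.transpose⁻¹ * V.transpose⁻¹ = 1 := by
      rw [← Matrix.mul_inv_rev, ← Matrix.transpose_mul, Matrix.nonsing_inv_mul _ hVu]
      simp
    simp [Matrix.nonsing_inv_mul _ hVu, e1]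
  calc mat W⁻¹ = (Matrix.fromBlocks V⁻¹ 0 0 V⁻¹.transpose⁻¹ * mat W) * mat W⁻¹ := by
        rw [hW3, Matrix.one_mul]
    _ = _ := by rw [Matrix.mul_assoc, hW2, Matrix.mul_one]

theorem isW_mem_bigG {N d : ℕ} [NeZero N] {W : Sp} (hd : 0 < d) (h : IsW N d (mat W)) :
    W ∈ bigG := by
  obtain ⟨α, β, γ, δ, e, h1, h2⟩ := rep_of_isW hd h
  exact mem_bigG_of_rep hd h1

theorem isW_mem_gp {N : ℕ} [NeZero N] {p : Nat.Primes} {W : Sp}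
    (h : IsW N p (mat W)) : W ∈ Gp N p := by
  obtain ⟨α, β, γ, δ, e, h1, h2⟩ := rep_of_isW p.2.pos h
  refine ⟨isW_mem_bigG p.2.pos h, ?_⟩
  have : nu N W ∣ (p : ℕ) := nu_dvd_of_rep p.2.pos (by simp [Pat, wMat]) h1
  rcases (Nat.dvd_prime p.2).1 this with h | h
  · exact ⟨0, by simp [h]⟩
  · exact ⟨1, by simp [h]⟩

/-- Squarefreeness makes p and n = N / p coprime; a Bézout relation u p + v n = 1 gives α = u, β =
v, γ = -1, δ = 1. -/
theorem exists_isW {N : ℕ} [NeZero N] (hN : Squarefree N) {p : Nat.Primes} (hp : (p : ℕ) ∣ N) :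
    ∃ W : Gp N p, IsW N p (mat W) := by
  obtain ⟨n, hn⟩ := hp
  have hcop : IsCoprime ((p : ℕ) : ℤ) n := by
    rw [Nat.isCoprime_iff_coprime]
    exact Nat.coprime_of_squarefree_mul (hn ▸ hN)
  obtain ⟨u, v, huv⟩ := hcop
  have hp0 : ((p : ℕ) : ℝ) ≠ 0 := Nat.cast_ne_zero.2 p.2.ne_zero
  have hss : √((p : ℕ) : ℝ) * √((p : ℕ) : ℝ) = (p : ℕ) := Real.mul_self_sqrt (Nat.cast_nonneg _)
  let V : Matrix (Fin 2) (Fin 2) ℝ := (1 / √((p : ℕ) : ℝ)) •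
    !![((u : ℤ) : ℝ) * (p : ℕ), ((v : ℤ) : ℝ) * N; ((-1 : ℤ) : ℝ), ((1 : ℤ) : ℝ) * (p : ℕ)]
  have hs : √((p : ℕ) : ℝ) ≠ 0 := (Real.sqrt_pos.2 (Nat.cast_pos.2 p.2.pos)).ne'
  have hV : V.det = 1 := by
    have e : (u : ℝ) * (p : ℕ) + v * n = 1 := by exact_mod_cast huv
    have hNr : (N : ℝ) = (p : ℕ) * n := by exact_mod_cast hn
    rw [Matrix.det_smul, Matrix.det_fin_two]
    simp [hNr]
    field_simp
    linear_combination e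
  have hVu : IsUnit V.det := by rw [hV]; exact isUnit_one
  have hsp : Matrix.fromBlocks V 0 0 V.transpose⁻¹ ∈ Matrix.symplecticGroup (Fin 2) ℝ := by
    rw [SymplecticGroup.mem_iff, Matrix.J, Matrix.fromBlocks_multiply, Matrix.fromBlocks_transpose,
      Matrix.fromBlocks_multiply]
    have hVt : IsUnit V.transpose.det := by rwa [Matrix.det_transpose]
    have e1 : V * V.transpose⁻¹.transpose = 1 := by
      rw [Matrix.transpose_nonsing_inv, Matrix.transpose_transpose, Matrix.mul_nonsing_inv _ hVu]
    simp [Matrix.nonsing_inv_mul _ hVt, e1]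
  have hW : IsW N p (mat ⟨_, hsp⟩) := ⟨u, v, -1, 1, V, rfl, hV, rfl⟩
  exact ⟨⟨⟨_, hsp⟩, isW_mem_gp hW⟩, hW⟩

theorem nu_conj_dvd {N d : ℕ} [NeZero N] (hd : 0 < d) (hdN : d ∣ N) {W M : Sp}
    (h : IsW N d (mat W)) (hM : M ∈ bigG) : nu N (W * M * W⁻¹) ∣ nu N M := by
  obtain ⟨X, hX, hr⟩ := exists_rep_nu (N := N) hM
  obtain ⟨A, B, C, D, rfl⟩ := hX.exists_ofBlocks
  obtain ⟨n, α, β, γ, δ, hn, -, hr'⟩ := isW_conj_rep hd hdN h hr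
  refine nu_dvd_of_rep (nu_pos hM) ?_ hr'
  have := pat_wConj d n α β γ δ A B C D
  rwa [← hn] at this

theorem nu_conj {N d : ℕ} [NeZero N] (hd : 0 < d) (hdN : d ∣ N) {W M : Sp}
    (h : IsW N d (mat W)) (hM : M ∈ bigG) : nu N (W * M * W⁻¹) = nu N M := by
  have hW := isW_mem_bigG hd h
  refine Nat.dvd_antisymm (nu_conj_dvd hd hdN h hM) ?_
  have := nu_conj_dvd hd hdN (isW_inv h) (mul_mem (mul_mem hW hM) (inv_mem hW))
  simpa [mul_assoc] using this

/-- The second diagonal block being nonzero modulo `p` is turned into `GoodAt` by `W_p`. -/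
theorem goodAt_isW_conj {N m : ℕ} [NeZero N] {p : Nat.Primes} (hp : (p : ℕ) ∣ N) {W M : Sp}
    (h : IsW N p (mat W)) {A B C D : Matrix (Fin 2) (Fin 2) ℤ} (hm : 0 < m)
    (hr : Rep N m (ofBlocks N A B C D) M) (hD : ∃ i j, ¬ ((p : ℕ) : ℤ) ∣ D i j) :
    GoodAt N p (W * M * W⁻¹) := by
  obtain ⟨n, α, β, γ, δ, hn, e, hr'⟩ := isW_conj_rep p.2.pos hp h hr
  have hpat := pat_wConj p n α β γ δ A B C D
  rw [← hn] at hpat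
  refine ⟨m, _, hm, hpat, hr', fun hcon => ?_⟩
  have hpp : Prime ((p : ℕ) : ℤ) := Nat.prime_iff_prime_int.1 p.2
  -- By α δ p - β γ n = 1 none of β, γ, n is divisible by p, so the surviving terms in D are entries
  -- of D times units modulo p.
  have hu : ¬ ((p : ℕ) : ℤ) ∣ β * γ * n := fun hd => by
    refine hpp.not_dvd_one ?_
    rw [← e]
    exact dvd_sub (Dvd.intro_left _ rfl) hd
  have hβ : ¬ ((p : ℕ) : ℤ) ∣ β := fun hd => hu (Dvd.dvd.mul_right (Dvd.dvd.mul_right hd _) _)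
  have hγ : ¬ ((p : ℕ) : ℤ) ∣ γ := fun hd => hu (Dvd.dvd.mul_right (Dvd.dvd.mul_left hd _) _)
  have hn' : ¬ ((p : ℕ) : ℤ) ∣ n := fun hd => hu (Dvd.dvd.mul_left hd _)
  have key : ∀ {x y z : ℤ}, ¬ ((p : ℕ) : ℤ) ∣ x → ¬ ((p : ℕ) : ℤ) ∣ z →
      ((p : ℕ) : ℤ) ∣ n * (x * y * z) → ((p : ℕ) : ℤ) ∣ y := fun hx hz h =>
    ((hpp.dvd_or_dvd ((hpp.dvd_or_dvd ((hpp.dvd_or_dvd h).resolve_left hn')).resolve_right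
      hz)).resolve_left hx)
  have hγ' : ¬ ((p : ℕ) : ℤ) ∣ -γ := by rwa [dvd_neg]
  obtain ⟨⟨h1, h2⟩, h3, h4⟩ := hcon
  simp only [wConj, mul_assoc ((p : ℕ) : ℤ)] at h1 h2 h3 h4
  simp only [Matrix.of_apply, Matrix.cons_val', Matrix.cons_val_zero, Matrix.cons_val_one,
    Matrix.cons_val_fin_one] at h1 h2 h3 h4
  have k : ∀ {x y z w : ℤ}, ((p : ℕ) : ℤ) ∣ (p : ℕ) * x + (p : ℕ) * y + (p : ℕ) * z + w →
      ((p : ℕ) : ℤ) ∣ w := fun {x y z w} h =>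
    (dvd_add_right (dvd_add (dvd_add (Dvd.intro _ rfl) (Dvd.intro _ rfl)) (Dvd.intro _ rfl))).1 h
  obtain ⟨i, j, hij⟩ := hD
  refine hij ?_
  fin_cases i <;> fin_cases j
  · exact key hβ hγ' (k h1)
  · exact key hβ hβ (k h2)
  · exact key hγ' hγ' (k h3)
  · exact key hγ' hβ (k h4)

/-- A nonzero first block is goodness, and a nonzero second block becomes a first block under
conjugation. If both vanish modulo p, the model of W M is divisible by p and ν drops; the
off-diagonal blocks of M then become the diagonal blocks of W M modulo p, and they cannot both
vanish because the minimal model is primitive. -/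
theorem exists_goodAt_isW {N : ℕ} [NeZero N] {p : Nat.Primes} (hp : (p : ℕ) ∣ N) {W M : Sp}
    (h : IsW N p (mat W)) (hM : M ∈ bigG) :
    GoodAt N p M ∨ GoodAt N p (W * M * W⁻¹) ∨ nu N (W * M) < nu N M ∧
      (GoodAt N p (W * M) ∨ GoodAt N p (W * (W * M) * W⁻¹)) := by
  obtain ⟨X, hX, hr⟩ := exists_rep_nu (N := N) hM
  obtain ⟨A, B, C, D, rfl⟩ := hX.exists_ofBlocks
  have hppos : 0 < (p : ℕ) := p.2.pos
  have hpp : Prime ((p : ℕ) : ℤ) := Nat.prime_iff_prime_int.1 p.2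
  by_cases hA : DvdBlock ((p : ℕ) : ℤ) (ofBlocks N A B C D)
  swap
  · exact .inl ⟨_, _, nu_pos hM, hX, hr, hA⟩
  by_cases hD : ∃ i j, ¬ ((p : ℕ) : ℤ) ∣ D i j
  · exact .inr (.inl (goodAt_isW_conj hp h (nu_pos hM) hr hD))
  push Not at hD
  right; right
  obtain ⟨α, β, γ, δ, e, hw, -⟩ := rep_of_isW hppos h
  obtain ⟨n, hn⟩ := hp
  have hn' : (N : ℤ) = (p : ℕ) * n := by exact_mod_cast hn
  obtain ⟨⟨⟨a, ha⟩, b, hb⟩, ⟨c, hc⟩, d, hd⟩ := hA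
  simp [ofBlocks] at ha hb hc hd
  choose D' hD' using hD
  have e' : α * δ * (p : ℕ) - β * γ * n = 1 := by
    rw [hn'] at e
    exact mul_left_cancel₀ hpp.ne_zero (by linear_combination e)
  -- the model of `W M` is divisible by `p`
  have hprod : wMat N p α β γ δ * ofBlocks N A B C D = ((p : ℕ) : ℤ) • ofBlocks N
      !![α * A 0 0 + n * β * C 0 0, α * A 0 1 + n * β * C 0 1;
        δ * A 1 0 - n * γ * C 1 0, δ * A 1 1 - n * γ * C 1 1]
      !![α * B 0 0 + β * D' 0 0, α * B 0 1 + β * D' 0 1;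
        δ * B 1 0 - γ * D' 1 0, δ * B 1 1 - γ * D' 1 1]
      !![γ * a + δ * C 0 0, γ * b + δ * C 0 1; -β * c + α * C 1 0, -β * d + α * C 1 1]
      !![n * γ * B 0 0 + δ * D 0 0, n * γ * B 0 1 + δ * D 0 1;
        -n * β * B 1 0 + α * D 1 0, -n * β * B 1 1 + α * D 1 1] := by
    ext i j
    fin_cases i <;> fin_cases j <;> simp only [Matrix.mul_apply, Fin.sum_univ_four] <;>
      simp [wMat, ofBlocks, ha, hb, hc, hd, hD', hn'] <;> ring
  have hr2 := hw.mul hr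
  rw [hprod] at hr2
  have hpm : (p : ℕ) ∣ nu N M := by
    have h1 := sq_dvd_of_rep_smul (pat_ofBlocks N _ _ _ _) hr2
    rw [sq] at h1
    exact Nat.dvd_of_mul_dvd_mul_left hppos h1
  obtain ⟨m, hm⟩ := hpm
  have hm0 : 0 < m := Nat.pos_of_ne_zero fun h0 => by
    have := nu_pos (N := N) hM
    rw [hm, h0] at this; simp at this
  rw [hm, ← mul_assoc, ← sq] at hr2
  replace hr2 := hr2.of_smul hppos
  refine ⟨?_, ?_⟩
  · refine (Nat.le_of_dvd hm0 (nu_dvd_of_rep hm0 (pat_ofBlocks N _ _ _ _) hr2)).trans_lt ?_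
    rw [hm]
    exact lt_mul_of_one_lt_left hm0 p.2.one_lt
  have hu : ¬ ((p : ℕ) : ℤ) ∣ β * γ * n := fun hd => by
    refine hpp.not_dvd_one ?_
    rw [← e']
    exact dvd_sub (Dvd.intro_left _ rfl) hd
  have hβ : ¬ ((p : ℕ) : ℤ) ∣ β := fun hd => hu (Dvd.dvd.mul_right (Dvd.dvd.mul_right hd _) _)
  have hγ : ¬ ((p : ℕ) : ℤ) ∣ γ := fun hd => hu (Dvd.dvd.mul_right (Dvd.dvd.mul_left hd _) _)
  have hnn : ¬ ((p : ℕ) : ℤ) ∣ n := fun hd => hu (Dvd.dvd.mul_left hd _)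
  have key : ∀ {x y : ℤ}, ¬ ((p : ℕ) : ℤ) ∣ x →
      ((p : ℕ) : ℤ) ∣ n * x * y → ((p : ℕ) : ℤ) ∣ y := fun hx h =>
    (hpp.dvd_or_dvd h).resolve_left fun h => (hpp.dvd_or_dvd h).elim hnn hx
  -- With A and D divisible by p, the diagonal blocks of the new model are modulo p the blocks C and
  -- B, with rows multiplied by units.
  by_cases hC : ∃ i j, ¬ ((p : ℕ) : ℤ) ∣ C i j
  · left
    refine ⟨m, _, hm0, pat_ofBlocks N _ _ _ _, hr2, fun hcon => ?_⟩
    obtain ⟨⟨h1, h2⟩, h3, h4⟩ := hcon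
    simp [ofBlocks, ha, hb, hc, hd] at h1 h2 h3 h4
    obtain ⟨i, j, hij⟩ := hC
    refine hij ?_
    fin_cases i <;> fin_cases j
    · exact key hβ ((dvd_add_right (Dvd.dvd.mul_left (Dvd.intro _ rfl) _)).1 h1)
    · exact key hβ ((dvd_add_right (Dvd.dvd.mul_left (Dvd.intro _ rfl) _)).1 h2)
    · exact key hγ ((dvd_sub_right (Dvd.dvd.mul_left (Dvd.intro _ rfl) _)).1 h3)
    · exact key hγ ((dvd_sub_right (Dvd.dvd.mul_left (Dvd.intro _ rfl) _)).1 h4)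
  · right
    push Not at hC
    choose C' hC' using hC
    refine goodAt_isW_conj ⟨n, hn⟩ h hm0 hr2 ?_
    by_contra hcon
    push Not at hcon
    have hB : ∀ i j, ((p : ℕ) : ℤ) ∣ B i j := by
      intro i j
      have h1 := hcon i j
      fin_cases i <;> fin_cases j <;> simp [hD'] at h1
      · exact key hγ ((dvd_add_left (Dvd.dvd.mul_left (Dvd.intro _ rfl) _)).1 h1)
      · exact key hγ ((dvd_add_left (Dvd.dvd.mul_left (Dvd.intro _ rfl) _)).1 h1)
      · exact key hβ (dvd_neg.1 ((dvd_add_left (Dvd.dvd.mul_left (Dvd.intro _ rfl) _)).1 h1))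
      · exact key hβ (dvd_neg.1 ((dvd_add_left (Dvd.dvd.mul_left (Dvd.intro _ rfl) _)).1 h1))
    choose B' hB' using hB
    have hX' : ofBlocks N A B C D = ((p : ℕ) : ℤ) • ofBlocks N !![a, b; c, d] B' C' D' := by
      ext i j
      fin_cases i <;> fin_cases j <;> simp [ofBlocks, ha, hb, hc, hd, hD', hC', hB'] <;> ring
    rw [hX'] at hr
    exact p.2.one_lt.ne' (eq_one_of_rep_nu_smul hM (pat_ofBlocks N _ _ _ _) hr)

/-- Modulo p the first block of the conjugate involves only D. This separates T₂ from its conjugate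
by W_p. -/
theorem not_goodAt_isW_conj {N : ℕ} [NeZero N] {p : Nat.Primes} (hp : (p : ℕ) ∣ N) {W M : Sp}
    (h : IsW N p (mat W)) (hM : M ∈ bigG) {A B C D : Matrix (Fin 2) (Fin 2) ℤ}
    (hr : Rep N (nu N M) (ofBlocks N A B C D) M) (hD : ∀ i j, ((p : ℕ) : ℤ) ∣ D i j) :
    ¬ GoodAt N p (W * M * W⁻¹) := by
  obtain ⟨n, α, β, γ, δ, hn, e, hr'⟩ := isW_conj_rep p.2.pos hp h hr
  rw [← nu_conj p.2.pos hp h hM] at hr'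
  intro hg
  refine hg.not_dvdBlock hr' ?_
  have k : ∀ {x y z n β D w : ℤ}, ((p : ℕ) : ℤ) ∣ D →
      ((p : ℕ) : ℤ) ∣ (p : ℕ) * x + (p : ℕ) * n * y + (p : ℕ) * n * z + n * (β * D * w) := by
    rintro x y z n β D w ⟨d, rfl⟩
    exact ⟨x + n * y + n * z + n * (β * d * w), by ring⟩
  exact ⟨⟨k (hD _ _), k (hD _ _)⟩, k (hD _ _), k (hD _ _)⟩

end Paramodular

/-! ### Reduction to diagonal form, and the local-global principle. -/

namespace Paramodular

variable {N : ℕ} [NeZero N]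

/-- The group generated by the elements `W_p`, `p ∣ N`. -/
noncomputable def wGroup (N : ℕ) [NeZero N] : Subgroup Sp :=
  Subgroup.closure {W | ∃ p : Nat.Primes, (p : ℕ) ∣ N ∧ IsW N p (mat W)}

/-- Invariance of ν under conjugation passes from the generators to the group. As Σ_N and the groups
`unitsAt` are defined by ν, the whole group normalizes them. -/
theorem wGroup_spec {U : Sp} (hU : U ∈ wGroup N) :
    U ∈ bigG ∧ ∀ M ∈ bigG, nu N (U * M * U⁻¹) = nu N M := by
  induction hU using Subgroup.closure_induction with
  | mem W h =>
    obtain ⟨p, hp, hW⟩ := h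
    exact ⟨isW_mem_bigG p.2.pos hW, fun M hM => nu_conj p.2.pos hp hW hM⟩
  | one => exact ⟨one_mem _, fun M _ => by simp⟩
  | mul x y _ _ hx hy =>
    refine ⟨mul_mem hx.1 hy.1, fun M hM => ?_⟩
    rw [← hy.2 M hM, ← hx.2 _ (mul_mem (mul_mem hy.1 hM) (inv_mem hy.1))]
    congr 1
    group
  | inv x _ hx =>
    refine ⟨inv_mem hx.1, fun M hM => ?_⟩
    rw [← hx.2 _ (mul_mem (mul_mem (inv_mem hx.1) hM) (inv_mem (inv_mem hx.1)))]
    congr 1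
    group

theorem wGroup_conj_mem_unitsAt {U g : Sp} (hU : U ∈ wGroup N) {p : Nat.Primes}
    (hg : g ∈ unitsAt N p) : U * g * U⁻¹ ∈ unitsAt N p := by
  obtain ⟨h1, h2⟩ := wGroup_spec hU
  exact ⟨mul_mem (mul_mem h1 hg.1) (inv_mem h1), by rw [h2 g hg.1]; exact hg.2⟩

theorem wGroup_conj_mem_sigma {U g : Sp} (hU : U ∈ wGroup N) (hg : g ∈ Sigma N) :
    U * g * U⁻¹ ∈ Sigma N := by
  obtain ⟨h1, h2⟩ := wGroup_spec hU
  rw [← nu_eq_one_iff (mul_mem (mul_mem h1 (sigma_le N hg)) (inv_mem h1)), h2 g (sigma_le N hg),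
    nu_eq_one_iff (sigma_le N hg)]
  exact hg

theorem LocEquiv.wGroup_mul {U V M M' : Sp} (hU : U ∈ wGroup N) (hV : V ∈ wGroup N)
    {p : Nat.Primes} (h : LocEquiv N p M M') : LocEquiv N p (U * M * V) (U * M' * V) := by
  obtain ⟨g, hg, t, ht, rfl⟩ := h
  refine ⟨U * g * U⁻¹, wGroup_conj_mem_unitsAt hU hg, V⁻¹ * t * V⁻¹⁻¹,
    wGroup_conj_mem_unitsAt (inv_mem hV) ht, by group⟩

/-- The primes are repaired one at a time. Since W_p is a local unit at every q ≠ p, goodness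
already achieved at q ∣ N survives. -/
theorem exists_wGroup_goodAt (hN : Squarefree N) {M : Sp} (hM : M ∈ bigG) :
    ∃ U ∈ wGroup N, ∃ V ∈ wGroup N, ∀ p : Nat.Primes, (p : ℕ) ∣ N → GoodAt N p (U * M * V) := by
  have key : ∀ s : Finset Nat.Primes, ∃ U ∈ wGroup N, ∃ V ∈ wGroup N,
      ∀ p ∈ s, (p : ℕ) ∣ N → GoodAt N p (U * M * V) := by
    classical
    intro s
    induction s using Finset.induction_on with
    | empty => exact ⟨1, one_mem _, 1, one_mem _, by simp⟩
    | insert p s hps ih =>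
      obtain ⟨U, hU, V, hV, h⟩ := ih
      by_cases hp : (p : ℕ) ∣ N
      swap
      · refine ⟨U, hU, V, hV, fun q hq hqN => ?_⟩
        rcases Finset.mem_insert.1 hq with rfl | hq
        · exact absurd hqN hp
        · exact h q hq hqN
      obtain ⟨⟨W, hWp⟩, hW⟩ := exists_isW hN hp
      have hWg : W ∈ wGroup N := Subgroup.subset_closure ⟨p, hp, hW⟩
      have hUMV : U * M * V ∈ bigG := mul_mem (mul_mem (wGroup_spec hU).1 hM) (wGroup_spec hV).1
      have step : ∀ A B : Sp, A ∈ wGroup N → B ∈ wGroup N → (∀ q, p ≠ q → A ∈ unitsAt N q) →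
          (∀ q, p ≠ q → B ∈ unitsAt N q) → GoodAt N p (A * (U * M * V) * B) →
          ∃ U ∈ wGroup N, ∃ V ∈ wGroup N, ∀ q ∈ insert p s, (q : ℕ) ∣ N →
            GoodAt N q (U * M * V) := by
        intro A B hA hB hA' hB' hgood
        refine ⟨A * U, mul_mem hA hU, V * B, mul_mem hV hB, fun q hq hqN => ?_⟩
        have e : A * U * M * (V * B) = A * (U * M * V) * B := by group
        rw [e]
        rcases Finset.mem_insert.1 hq with rfl | hq
        · exact hgood
        · have hne : p ≠ q := fun hpq => hps (hpq ▸ hq)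
          exact (h q hq hqN).of_locEquiv hqN ⟨A, hA' q hne, B, hB' q hne, rfl⟩
      have hu : ∀ q, p ≠ q → W ∈ unitsAt N q := fun q hq => gp_le_unitsAt N hq hWp
      rcases exists_goodAt_isW hp hW hUMV with hg | hg | ⟨-, hg | hg⟩
      · exact step 1 1 (one_mem _) (one_mem _) (fun _ _ => one_mem _) (fun _ _ => one_mem _)
          (by simpa using hg)
      · exact step W W⁻¹ hWg (inv_mem hWg) hu (fun q hq => inv_mem (hu q hq)) hg
      · exact step W 1 hWg (one_mem _) hu (fun _ _ => one_mem _) (by simpa using hg)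
      · exact step (W * W) W⁻¹ (mul_mem hWg hWg) (inv_mem hWg)
          (fun q hq => mul_mem (hu q hq) (hu q hq)) (fun q hq => inv_mem (hu q hq))
          (by rwa [mul_assoc W W])
  have hfin : {p : Nat.Primes | (p : ℕ) ∣ N}.Finite := by
    refine Set.Finite.of_finite_image (f := fun p : Nat.Primes => (p : ℕ))
      (N.primeFactors.finite_toSet.subset ?_) (fun p _ q _ h => Subtype.ext h)
    rintro _ ⟨p, hp, rfl⟩
    exact Nat.mem_primeFactors.2 ⟨p.2, hp, NeZero.ne N⟩
  obtain ⟨U, hU, V, hV, h⟩ := key hfin.toFinset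
  exact ⟨U, hU, V, hV, fun p hp => h p (hfin.mem_toFinset.2 hp) hp⟩

theorem nu_sigma_mul_mul {s M t : Sp} (hs : s ∈ Sigma N) (hM : M ∈ bigG) (ht : t ∈ Sigma N) :
    nu N (s * M * t) = nu N M :=
  (nu_eq_of_locEquiv hM (mul_mem (mul_mem (sigma_le N hs) hM) (sigma_le N ht))
    fun _ => locEquiv_of_sigma hs ht).symm

/-- Elementary divisor theorem for double cosets. -/
theorem exists_sigma_diag {M : Sp} (hM : M ∈ bigG)
    (hgood : ∀ p : Nat.Primes, (p : ℕ) ∣ N → GoodAt N p M) :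
    ∃ s ∈ Sigma N, ∃ t ∈ Sigma N, ∃ a b : ℕ, a * b = nu N M ∧ a ∣ b ∧
      Rep N (nu N M) (diagMat (nu N M) a b) (s * M * t) := by
  obtain ⟨X, hX, hr⟩ := exists_rep_nu (N := N) hM
  obtain ⟨S, T, hS, hT, a, b, hab, hdvd, hdiag⟩ := exists_diagMat (nu_pos hM) hX hr.symp
    (fun p hp hpN => (hgood ⟨p, hp⟩ hpN).not_dvdBlock hr) (by
      -- For p ∤ N primitivity is automatic: in X = p Y the matrix Y still has the pattern because p
      -- is prime to N, which contradicts the minimality of ν.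
      intro p hp hpN
      by_contra hcon
      push Not at hcon
      choose Y hY using hcon
      have hXY : X = ((p : ℕ) : ℤ) • Matrix.of Y := by ext i j; simp [hY]
      have hc : IsCoprime (N : ℤ) ((p : ℕ) : ℤ) := by
        rw [Nat.isCoprime_iff_coprime]
        exact ((Nat.Prime.coprime_iff_not_dvd hp).2 hpN).symm
      have hYp : Pat N (Matrix.of Y) := by
        obtain ⟨⟨h1, h2⟩, h3, h4⟩ := hX
        rw [hY] at h1 h2 h3 h4
        exact ⟨⟨hc.dvd_of_dvd_mul_left h1, hc.dvd_of_dvd_mul_left h2⟩,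
          hc.dvd_of_dvd_mul_left h3, hc.dvd_of_dvd_mul_left h4⟩
      rw [hXY] at hr
      exact hp.one_lt.ne' (eq_one_of_rep_nu_smul hM hYp hr))
  obtain ⟨s, hs, hs'⟩ := exists_mem_sigma hS
  obtain ⟨t, ht, ht'⟩ := exists_mem_sigma hT
  refine ⟨s, hs, t, ht, a, b, hab, hdvd, ?_⟩
  have := (hs'.mul hr).mul ht'
  rwa [one_mul, mul_one, hdiag] at this

/-- Each product in a minor contains an entry other than the corner, unless all four indices are 0
and the minor itself is zero. -/
theorem dvdMinors_of_dvd {d : ℤ} {X : Matrix (Fin 4) (Fin 4) ℤ}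
    (h : ∀ i j, (i ≠ 0 ∨ j ≠ 0) → d ∣ X i j) : DvdMinors d X := by
  intro i j k l
  by_cases h1 : (i ≠ 0 ∨ k ≠ 0) ∨ (j ≠ 0 ∨ l ≠ 0)
  · by_cases h2 : (i ≠ 0 ∨ l ≠ 0) ∨ (j ≠ 0 ∨ k ≠ 0)
    · refine dvd_sub ?_ ?_
      · exact h1.elim (fun h1 => Dvd.dvd.mul_right (h _ _ h1) _)
          fun h1 => Dvd.dvd.mul_left (h _ _ h1) _
      · exact h2.elim (fun h2 => Dvd.dvd.mul_right (h _ _ h2) _)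
          fun h2 => Dvd.dvd.mul_left (h _ _ h2) _
    · push Not at h2
      rw [h2.1.1, h2.1.2, h2.2.1, h2.2.2, sub_self]
      exact dvd_zero d
  · push Not at h1
    rw [h1.1.1, h1.1.2, h1.2.1, h1.2.2, sub_self]
    exact dvd_zero d

theorem dvdMinors_diagMat {d m a b : ℕ} (hda : d ∣ a) (hab : a ∣ b) (hm : a * b = m) :
    DvdMinors (d : ℤ) (diagMat m a b) := by
  have h1 : (d : ℤ) ∣ a := Int.natCast_dvd_natCast.2 hda
  have h2 : (d : ℤ) ∣ b := Int.natCast_dvd_natCast.2 (hda.trans hab)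
  have h3 : (d : ℤ) ∣ m := Int.natCast_dvd_natCast.2 (hda.trans (Dvd.intro _ hm))
  refine dvdMinors_of_dvd fun i j h => ?_
  fin_cases i <;> fin_cases j <;> simp [diagMat, h1, h2, h3] at h ⊢

/-- The number a is the gcd of the 2 × 2 minors of diag(1, m, a, b) with a ∣ b. By Cauchy–Binet its
divisibility by p^k passes to the model of the product, which is c times diag(1, m, a', b'), where
c² = ν(g) ν(t) is prime to p. -/
theorem LocEquiv.pow_dvd_of_diag {p : Nat.Primes} {D D' : Sp} {m a b a' b' : ℕ}
    (hm : nu N D' = m) (hm0 : 0 < m) (h : LocEquiv N p D D') (hD : Rep N m (diagMat m a b) D)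
    (hD' : Rep N m (diagMat m a' b') D') (hab : a * b = m) (hdvd : a ∣ b) {k : ℕ}
    (hk : (p : ℕ) ^ k ∣ a) : (p : ℕ) ^ k ∣ a' := by
  obtain ⟨g, hg, t, ht, rfl⟩ := h
  obtain ⟨G, hG, rG⟩ := exists_rep_nu (N := N) hg.1
  obtain ⟨H, hH, rH⟩ := exists_rep_nu (N := N) ht.1
  have hpat : ∀ a b, Pat N (diagMat m a b) := fun a b => by simp [Pat, diagMat]
  have hr := (rG.mul hD).mul rH
  rw [← hm] at hD'
  obtain ⟨c, -, hc, hc'⟩ := exists_eq_smul_of_rep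
    (Nat.mul_pos (Nat.mul_pos (nu_pos hg.1) hm0) (nu_pos ht.1))
    ((hG.mul (hpat a b)).mul hH) hr hD'
  have hcp : ¬ (p : ℕ) ∣ c := by
    intro hpc
    rw [hm] at hc
    have : nu N g * nu N t = c ^ 2 := by
      refine Nat.eq_of_mul_eq_mul_right hm0 ?_
      rw [← hc]; ring
    have h2 : (p : ℕ) ∣ nu N g * nu N t := by rw [this]; exact hpc.pow two_ne_zero
    rcases (Nat.Prime.dvd_mul p.2).1 h2 with h2 | h2
    exacts [hg.2 h2, ht.2 h2]
  have h1 := (dvdMinors_diagMat hk hdvd hab).mul_mul G H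
  rw [hc'] at h1
  have h2 := h1 0 2 0 2
  simp [diagMat] at h2
  have h3 : (p : ℕ) ^ k ∣ c * (c * a') := by
    zify
    exact h2
  have hco : Nat.Coprime ((p : ℕ) ^ k) c :=
    Nat.Coprime.pow_left k ((Nat.Prime.coprime_iff_not_dvd p.2).2 hcp)
  exact hco.dvd_of_dvd_mul_left (hco.dvd_of_dvd_mul_left h3)

/-- The Hasse principle: double cosets which agree locally everywhere are equal. -/
theorem exists_sigma_of_locEquiv (hN : Squarefree N) {M M' : Sp} (hM : M ∈ bigG) (hM' : M' ∈ bigG)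
    (h : ∀ p, LocEquiv N p M M') : ∃ s ∈ Sigma N, ∃ t ∈ Sigma N, M' = s * M * t := by
  -- The same U and V make M' good as well, because conjugating local units by `wGroup` keeps them
  -- local units and goodness is a local property.
  obtain ⟨U, hU, V, hV, hgood⟩ := exists_wGroup_goodAt hN hM
  have hloc : ∀ p, LocEquiv N p (U * M * V) (U * M' * V) := fun p => (h p).wGroup_mul hU hV
  have hgood' : ∀ p : Nat.Primes, (p : ℕ) ∣ N → GoodAt N p (U * M' * V) := fun p hp =>
    (hgood p hp).of_locEquiv hp (hloc p)
  have hUG := (wGroup_spec hU).1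
  have hVG := (wGroup_spec hV).1
  have hG : U * M * V ∈ bigG := mul_mem (mul_mem hUG hM) hVG
  have hG' : U * M' * V ∈ bigG := mul_mem (mul_mem hUG hM') hVG
  obtain ⟨s, hs, t, ht, a, b, hab, hdvd, hr⟩ := exists_sigma_diag hG hgood
  obtain ⟨s', hs', t', ht', a', b', hab', hdvd', hr'⟩ := exists_sigma_diag hG' hgood'
  have hnu := nu_eq_of_locEquiv hG hG' hloc
  rw [← hnu] at hab' hr'
  have hD : ∀ p, LocEquiv N p (s * (U * M * V) * t) (s' * (U * M' * V) * t') := fun p =>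
    ((locEquiv_of_sigma hs ht).symm.trans (hloc p)).trans (locEquiv_of_sigma hs' ht')
  have hm0 := nu_pos (N := N) hG
  have haa : a = a' := by
    refine Nat.dvd_antisymm ?_ ?_ <;> rw [Nat.dvd_iff_prime_pow_dvd_dvd] <;> intro p k hp hk
    · refine (hD ⟨p, hp⟩).pow_dvd_of_diag ?_ hm0 hr hr' hab hdvd hk
      rw [nu_sigma_mul_mul hs' hG' ht', hnu]
    · refine (hD ⟨p, hp⟩).symm.pow_dvd_of_diag ?_ hm0 hr' hr hab' hdvd' hk
      rw [nu_sigma_mul_mul hs hG ht]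
  have hbb : b = b' := by
    have ha0 : 0 < a := Nat.pos_of_ne_zero fun h0 => by
      rw [h0, zero_mul] at hab; exact hm0.ne hab
    refine Nat.eq_of_mul_eq_mul_left ha0 ?_
    rw [hab, haa, hab']
  rw [← haa, ← hbb] at hr'
  have heq := hr.eq hm0 hr'
  -- U and V can be cancelled since they normalize Σ_N.
  have e1 : M' = U⁻¹ * (s'⁻¹ * s) * U * M * (V * (t * t'⁻¹) * V⁻¹) := by
    have h1 : U * M' * V = s'⁻¹ * (s * (U * M * V) * t) * t'⁻¹ := by rw [heq]; group
    have h2 : M' = U⁻¹ * (U * M' * V) * V⁻¹ := by group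
    rw [h2, h1]; group
  refine ⟨U⁻¹ * (s'⁻¹ * s) * U, ?_, V * (t * t'⁻¹) * V⁻¹,
    wGroup_conj_mem_sigma hV (mul_mem ht (inv_mem ht')), e1⟩
  have := wGroup_conj_mem_sigma (inv_mem hU) (mul_mem (inv_mem hs') hs)
  rwa [inv_inv] at this

end Paramodular

/-! ### Products of double cosets in a general Hecke algebra. -/

namespace HeckeAlgebra

variable {G : Type*} [Group G] {Δ : Submonoid G} {U : Subgroup G}

open Classical in
theorem basis_apply (D D' : HeckeCoset Δ U U) : basis D D' = if D = D' then 1 else 0 :=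
  Finsupp.single_apply

theorem mk_eq_mk_iff {x y : Δ} : HeckeCoset.mk U U x = HeckeCoset.mk U U y ↔
    ∃ u ∈ U, ∃ v ∈ U, (x : G) = u * y * v := by
  rw [← mem_carrier_iff, carrier_mk, DoubleCoset.mem_doubleCoset]
  simp only [SetLike.mem_coe]

theorem mem_carrier_mk {x : G} {y : Δ} : x ∈ carrier (HeckeCoset.mk U U y) ↔
    ∃ u ∈ U, ∃ v ∈ U, x = u * y * v := by
  rw [carrier_mk, DoubleCoset.mem_doubleCoset]
  simp only [SetLike.mem_coe]

theorem coset_ind {P : HeckeCoset Δ U U → Prop} (h : ∀ x : Δ, P (HeckeCoset.mk U U x))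
    (D : HeckeCoset Δ U U) : P D := Quotient.inductionOn D h

theorem exists_of_mulCoeff_ne_zero {D₁ D₂ : HeckeCoset Δ U U} {x : G}
    (h : mulCoeff D₁ D₂ x ≠ 0) : ∃ k ∈ carrier D₂, x * k⁻¹ ∈ carrier D₁ := by
  obtain ⟨c, k, hk, -, hx⟩ := Set.nonempty_of_ncard_ne_zero h
  exact ⟨k, hk, hx⟩

theorem mulCoeff_eq_one {D₁ D₂ : HeckeCoset Δ U U} {x y : G} (hy : y ∈ carrier D₂)
    (hxy : x * y⁻¹ ∈ carrier D₁)
    (h : ∀ k ∈ carrier D₂, x * k⁻¹ ∈ carrier D₁ → k * y⁻¹ ∈ U) : mulCoeff D₁ D₂ x = 1 := by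
  rw [mulCoeff, Set.ncard_eq_one]
  refine ⟨rc U y, Set.ext fun c => ⟨?_, ?_⟩⟩
  · rintro ⟨k, hk, rfl, hx⟩
    exact (rc_eq.2 (h k hk hx)).symm
  · rintro rfl
    exact ⟨y, hy, rfl, hxy⟩

section Inclusion

variable {Δ' : Submonoid G} (h : Δ ≤ Δ')

theorem inclusion_add (f g : HeckeRing Δ U ℤ) :
    inclusion (U := U) h (f + g) = inclusion h f + inclusion h g :=
  Finsupp.mapDomain_add

theorem inclusion_basis (D : HeckeCoset Δ U U) :
    inclusion h (basis D) = basis (cosetMap h D) :=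
  Finsupp.mapDomain_single

theorem carrier_cosetMap (D : HeckeCoset Δ U U) : carrier (cosetMap h D) = carrier D := by
  induction D using coset_ind with
  | h x => rfl

end Inclusion

/-- The double cosets as a basis of the Hecke algebra. -/
noncomputable def zBasis [IsHeckeTriple Δ U U] :
    Module.Basis (HeckeCoset Δ U U) ℤ (HeckeRing Δ U ℤ) :=
  Module.Basis.ofRepr (AddEquiv.toIntLinearEquiv
    { HeckeCosetModule.of.symm with map_add' := fun _ _ => rfl })

theorem zBasis_apply [IsHeckeTriple Δ U U] (D : HeckeCoset Δ U U) : zBasis D = basis D := rfl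

theorem closure_basis [IsHeckeTriple Δ U U] {S : AddSubgroup (HeckeRing Δ U ℤ)}
    (h : ∀ D, basis D ∈ S) (f : HeckeRing Δ U ℤ) : f ∈ S := by
  rw [eq_sum_basis f]
  exact sum_mem fun D _ => zsmul_mem (h D) _

variable [IsHeckeTriple Δ U U]

theorem basis_mul_apply (D₁ D₂ : HeckeCoset Δ U U) (x : Δ) :
    (basis D₁ * basis D₂) (HeckeCoset.mk U U x) = mulCoeff D₁ D₂ x := by
  have h := toSum_apply (basis D₁ * basis D₂) (x : G)
  rw [dif_pos x.2] at h
  rw [← act_basis, ← toSum_mul, h]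

/-- The product of two double cosets is a single double coset. -/
theorem basis_mul_basis {x y : Δ}
    (h₁ : ∀ u ∈ U, ∃ v ∈ U, ∃ w ∈ U, (x : G) * u * y = v * (x * y) * w)
    (h₂ : ∀ k ∈ carrier (HeckeCoset.mk U U y), (x : G) * y * k⁻¹ ∈ carrier (HeckeCoset.mk U U x) →
      k * (y : G)⁻¹ ∈ U) :
    basis (HeckeCoset.mk U U x) * basis (HeckeCoset.mk U U y) =
      basis (HeckeCoset.mk U U (x * y)) := by
  classical
  refine HeckeCosetModule.ext fun D => ?_
  induction D using coset_ind with
  | h z =>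
  rw [basis_mul_apply, basis_apply]
  -- On the double coset of x y the coefficient is 1 by `h₂`. Any other double coset with nonzero
  -- coefficient would lie in U x U y U, which `h₁` identifies with U x y U.
  split_ifs with hz
  · rw [← mulCoeff_out, ← hz, mulCoeff_out, mulCoeff_eq_one (mem_carrier_self y) ?_ ?_,
      Nat.cast_one]
    · simpa using mem_carrier_self x
    · simpa using h₂
  · rw [Nat.cast_eq_zero]
    by_contra hne
    obtain ⟨k, hk, hk'⟩ := exists_of_mulCoeff_ne_zero hne
    obtain ⟨a, ha, b, hb, rfl⟩ := mem_carrier_mk.1 hk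
    obtain ⟨c, hc, d, hd, e⟩ := mem_carrier_mk.1 hk'
    obtain ⟨v, hv, w, hw, e'⟩ := h₁ (d * a) (mul_mem hd ha)
    refine hz (mk_eq_mk_iff.2 ⟨(c * v)⁻¹, inv_mem (mul_mem hc hv), (w * b)⁻¹,
      inv_mem (mul_mem hw hb), ?_⟩)
    have e2 : (z : G) = c * (x * (d * a) * y) * b := by
      rw [mul_inv_eq_iff_eq_mul] at e
      rw [e]; group
    rw [e2, e']
    simp only [Submonoid.coe_mul]
    group

theorem basis_mul_of_normalizes {x y : Δ} (hx : ∀ u ∈ U, (x : G) * u * (x : G)⁻¹ ∈ U)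
    (hx' : ∀ u ∈ U, (x : G)⁻¹ * u * (x : G) ∈ U) :
    basis (HeckeCoset.mk U U x) * basis (HeckeCoset.mk U U y) =
      basis (HeckeCoset.mk U U (x * y)) := by
  refine basis_mul_basis (fun u hu => ⟨x * u * (x : G)⁻¹, hx u hu, 1, one_mem U, by group⟩)
    fun k _ hk => ?_
  obtain ⟨a, ha, b, hb, e⟩ := mem_carrier_mk.1 hk
  have : k * (y : G)⁻¹ = (((x : G)⁻¹ * a * x) * b)⁻¹ := by
    have e2 : k = (a * x * b)⁻¹ * (x * y) := by rw [← e]; group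
    rw [e2]; group
  rw [this]
  exact inv_mem (mul_mem (hx' a ha) hb)

theorem basis_mul_normalizes {x y : Δ} (hy : ∀ u ∈ U, (y : G) * u * (y : G)⁻¹ ∈ U)
    (hy' : ∀ u ∈ U, (y : G)⁻¹ * u * (y : G) ∈ U) :
    basis (HeckeCoset.mk U U x) * basis (HeckeCoset.mk U U y) =
      basis (HeckeCoset.mk U U (x * y)) := by
  refine basis_mul_basis (fun u hu => ⟨1, one_mem U, (y : G)⁻¹ * u * y, hy' u hu, by group⟩)
    fun k hk _ => ?_
  obtain ⟨a, ha, b, hb, rfl⟩ := mem_carrier_mk.1 hk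
  have : a * y * b * (y : G)⁻¹ = a * (y * b * (y : G)⁻¹) := by group
  rw [this]
  exact mul_mem ha (hy b hb)

/-- If all double cosets are stable under inversion, then the Hecke algebra is commutative. -/
theorem mul_comm_of_inv_mem (h : ∀ (D : HeckeCoset Δ U U) (x : G), x ∈ carrier D → x⁻¹ ∈ carrier D)
    (f g : HeckeRing Δ U ℤ) : f * g = g * f := by
  have key : ∀ D₁ D₂ : HeckeCoset Δ U U, basis D₁ * basis D₂ = basis D₂ * basis D₁ := by
    intro D₁ D₂
    refine HeckeCosetModule.ext fun D => ?_
    induction D using coset_ind with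
    | h x =>
    rw [basis_mul_apply, basis_mul_apply, Nat.cast_inj]
    -- The bijection U k ↦ U k x⁻¹ of right cosets interchanges the conditions k ∈ D₂ and x k⁻¹ ∈
    -- D₁, because both double cosets are stable under inversion.
    have e : mulCoeff D₁ D₂ x = mulCoeff D₂ D₁ (x : G)⁻¹ := by
      have hbij : Function.Bijective (fun c : RightCosets U => rc U (c.out * (x : G)⁻¹)) := by
        have haux : ∀ (c : RightCosets U) (g : G), rc U ((rc U (c.out * g)).out * g⁻¹) = c := by
          intro c g
          conv_rhs => rw [← rc_out c]
          have := rc_eq.1 (rc_out (rc U (c.out * g))).symm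
          rw [rc_eq]
          have h2 := inv_mem this
          rw [mul_inv_rev, inv_inv] at h2
          simpa [mul_assoc] using h2
        refine Function.bijective_iff_has_inverse.2
          ⟨fun c => rc U (c.out * x), fun c => ?_, fun c => ?_⟩
        · simpa using haux c (x : G)⁻¹
        · exact haux c x
      rw [mulCoeff, mulCoeff, ← Set.ncard_image_of_injective _ hbij.1]
      congr 1
      ext c
      constructor
      · rintro ⟨c, ⟨k, hk, rfl, hx⟩, rfl⟩
        refine ⟨k * (x : G)⁻¹, ?_, ?_, ?_⟩
        · simpa using h _ _ hx
        · have := rc_eq.1 (rc_out (rc U k))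
          rw [rc_eq]
          simpa [mul_assoc] using this
        · simpa using h _ _ hk
      · rintro ⟨k, hk, rfl, hx⟩
        refine ⟨rc U (k * x), ⟨k * x, ?_, rfl, ?_⟩, ?_⟩
        · simpa using h _ _ hx
        · simpa using h _ _ hk
        · have := rc_eq.1 (rc_out (rc U (k * x)))
          rw [rc_eq]
          simpa [mul_assoc] using this
    rw [e]
    have hx : (x : G)⁻¹ ∈ carrier (HeckeCoset.mk U U x) := h _ _ (mem_carrier_self x)
    obtain ⟨a, ha, b, hb, e'⟩ := mem_carrier_mk.1 hx
    rw [e', mulCoeff_mul_right _ _ _ hb, mulCoeff_mul_left _ _ _ ha]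
  have h1 : ∀ D, basis D * g = g * basis D := fun D =>
    closure_basis (S := (AddMonoidHom.mulLeft (basis D)).eqLocus (AddMonoidHom.mulRight (basis D)))
      (fun D' => key D D') g
  exact closure_basis (S := (AddMonoidHom.mulRight g).eqLocus (AddMonoidHom.mulLeft g)) h1 f

section Inclusion

variable {Δ' : Submonoid G} [IsHeckeTriple Δ' U U] (h : Δ ≤ Δ')

/-- The formal sum of right cosets does not depend on the ambient semigroup, and the product is
determined by it; multiplicativity of the inclusion follows. -/
theorem toSum_inclusion (f : HeckeRing Δ U ℤ) : toSum (inclusion h f) = toSum f := by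
  let F : HeckeRing Δ U ℤ →+ HeckeRing Δ' U ℤ := AddMonoidHom.mk' (inclusion h) (inclusion_add h)
  have key : ∀ D, basis D ∈ ((toSum (U := U) (Δ := Δ')).comp F).eqLocus (toSum (U := U) (Δ := Δ)) :=
    fun D => ?_
  · exact closure_basis key f
  change toSum (inclusion h (basis D)) = toSum (basis D)
  rw [inclusion_basis, toSum_basis, toSum_basis]
  refine Finset.sum_congr ?_ fun _ _ => rfl
  ext c
  simp only [Set.Finite.mem_toFinset, carrier_cosetMap]

theorem inclusion_mul (f g : HeckeRing Δ U ℤ) :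
    inclusion (U := U) h (f * g) = inclusion h f * inclusion h g := by
  refine toSum_injective ?_
  have hact : act (inclusion h f) = act f := by
    refine hom_ext_rc fun x => ?_
    rw [act_single, act_single, toSum_inclusion]
  rw [toSum_inclusion, toSum_mul, toSum_mul, toSum_inclusion, hact]

theorem inclusion_one : inclusion (U := U) h (1 : HeckeRing Δ U ℤ) = 1 := by
  refine toSum_injective ?_
  rw [toSum_inclusion, toSum_one, toSum_one]

/-- The inclusion of Hecke algebras as a ring homomorphism. -/
noncomputable def inclusionHom : HeckeRing Δ U ℤ →+* HeckeRing Δ' U ℤ where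
  toFun := inclusion h
  map_one' := inclusion_one h
  map_mul' := inclusion_mul h
  map_zero' := map_zero (AddMonoidHom.mk' (inclusion (U := U) h) (inclusion_add h))
  map_add' := inclusion_add h

end Inclusion

end HeckeAlgebra

/-! ### Homomorphisms out of the infinite tensor product. -/

theorem Finset.noncommProd_subset_one {ι M : Type*} [Monoid M] {s t : Finset ι} (h : s ⊆ t)
    (f : ι → M) (hf : ∀ i, i ∉ s → f i = 1)
    (comm : (t : Set ι).Pairwise (Function.onFun Commute f)) :
    t.noncommProd f comm = s.noncommProd f (comm.mono (Finset.coe_subset.2 h)) := by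
  classical
  obtain ⟨r, hr, rfl⟩ : ∃ r, Disjoint s r ∧ t = s ∪ r :=
    ⟨t \ s, Finset.disjoint_sdiff, (Finset.union_sdiff_of_subset h).symm⟩
  rw [Finset.noncommProd_union_of_disjoint hr,
    Finset.noncommProd_eq_pow_card r f _ 1 (fun i hi => hf i (Finset.disjoint_right.1 hr hi)),
    one_pow, mul_one]

namespace AlgebraTensor

variable {ι : Type*} {A : ι → Type*} [∀ i, Ring (A i)] {B : Type*} [Ring B]

open Classical in
/-- Extend a family over `S` by the units. -/
noncomputable def extendAll (S : Finset ι) (x : ∀ i : S, A i) (i : ι) : A i :=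
  if hi : i ∈ S then x ⟨i, hi⟩ else 1

theorem extendAll_update (S : Finset ι) [DecidableEq ι] [DecidableEq S] (x : ∀ i : S, A i)
    (j : S) (c : A j) :
    extendAll S (Function.update x j c) = Function.update (extendAll S x) (j : ι) c := by
  funext i
  by_cases hij : i = j
  · subst hij
    simp [extendAll]
  · rw [Function.update_of_ne hij]
    by_cases hi : i ∈ S
    · simp only [extendAll, dif_pos hi]
      rw [Function.update_of_ne]
      exact fun e => hij (congrArg Subtype.val e)
    · simp only [extendAll, dif_neg hi]

theorem extendAll_extendOne {S T : Finset ι} (h : S ⊆ T) (x : ∀ i : S, A i) :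
    extendAll T (extendOne S T x) = extendAll S x := by
  funext i
  by_cases hi : i ∈ S
  · simp [extendAll, extendOne, hi, h hi]
  · simp [extendAll, extendOne, hi]

variable (g : ∀ i, A i →+* B) (hg : ∀ i j, i ≠ j → ∀ x y, Commute (g i x) (g j y))

include hg in
theorem pairwise_commute (S : Finset ι) (y : ∀ i, A i) :
    (S : Set ι).Pairwise (Function.onFun Commute fun i => g i (y i)) :=
  fun i _ j _ hij => hg i j hij _ _

/-- The homomorphism on a finite tensor product given by commuting homomorphisms. -/
noncomputable def liftFin (S : Finset ι) : (⨂[ℤ] i : S, A i) →ₐ[ℤ] B :=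
  PiTensorProduct.liftAlgHom
    { toFun := fun x => S.noncommProd (fun i => g i (extendAll S x i)) (pairwise_commute g hg S _)
      map_update_add' := by
        classical
        intro inst x j a b
        -- Only the factor at j depends on c, and it may be moved to the front because factors at
        -- different indices commute.
        have key : ∀ c, S.noncommProd (fun i => g i (extendAll S (Function.update x j c) i))
            (pairwise_commute g hg S _) = g j c * (S.erase j).noncommProd
              (fun i => g i (extendAll S x i)) (pairwise_commute g hg _ _) := by
          intro c
          rw [← Finset.mul_noncommProd_erase S j.2]
          congr 1
          · rw [extendAll_update, Function.update_self]
          · refine Finset.noncommProd_congr rfl (fun i hi => ?_) _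
            rw [extendAll_update, Function.update_of_ne (Finset.ne_of_mem_erase hi)]
        rw [key, key, key, map_add, add_mul]
      map_update_smul' := by
        classical
        intro inst x j k b
        have key : ∀ c, S.noncommProd (fun i => g i (extendAll S (Function.update x j c) i))
            (pairwise_commute g hg S _) = g j c * (S.erase j).noncommProd
              (fun i => g i (extendAll S x i)) (pairwise_commute g hg _ _) := by
          intro c
          rw [← Finset.mul_noncommProd_erase S j.2]
          congr 1
          · rw [extendAll_update, Function.update_self]
          · refine Finset.noncommProd_congr rfl (fun i hi => ?_) _
            rw [extendAll_update, Function.update_of_ne (Finset.ne_of_mem_erase hi)]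
        rw [key, key, map_zsmul, smul_mul_assoc] }
    (by
      change S.noncommProd (fun i => g i (extendAll S 1 i)) (pairwise_commute g hg S _) = 1
      rw [Finset.noncommProd_eq_pow_card S _ _ 1, one_pow]
      intro i hi
      exact (congrArg (g i) (dif_pos hi)).trans (map_one _))
    (fun x y => by
      change S.noncommProd (fun i => g i (extendAll S (x * y) i)) (pairwise_commute g hg S _) =
        S.noncommProd (fun i => g i (extendAll S x i)) (pairwise_commute g hg S _) *
        S.noncommProd (fun i => g i (extendAll S y i)) (pairwise_commute g hg S _)
      rw [← Finset.noncommProd_mul_distrib _ _ _ _ fun i _ j _ hij => hg i j hij _ _]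
      refine Finset.noncommProd_congr rfl (fun i hi => ?_) _
      rw [Pi.mul_apply, ← map_mul]
      congr 1
      simp [extendAll, hi])

theorem liftFin_tprod (S : Finset ι) (x : ∀ i : S, A i) :
    liftFin g hg S (PiTensorProduct.tprod ℤ x) =
      S.noncommProd (fun i => g i (extendAll S x i)) (pairwise_commute g hg S _) :=
  PiTensorProduct.lift.tprod x

theorem liftFin_insertOne {S T : Finset ι} (h : S ≤ T) (x : ⨂[ℤ] i : S, A i) :
    liftFin g hg T (insertOne S T h x) = liftFin g hg S x := by
  refine DFunLike.congr_fun
    (f := (liftFin g hg T).toLinearMap ∘ₗ (insertOne (A := A) S T h).toLinearMap)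
    (g := (liftFin g hg S).toLinearMap)
    (PiTensorProduct.ext (MultilinearMap.ext fun x => ?_)) x
  simp only [LinearMap.compMultilinearMap_apply, LinearMap.comp_apply, AlgHom.toLinearMap_apply,
    insertOne_tprod, liftFin_tprod]
  simp only [extendAll_extendOne h]
  exact Finset.noncommProd_subset_one h _ (fun i hi => by simp [extendAll, hi]) _

/-- The homomorphism on the tensor product given by commuting homomorphisms. -/
noncomputable def liftHom : AlgebraTensor A →+* B where
  toFun := DirectLimit.lift _ (fun S x => liftFin g hg S x)
    fun _ _ h x => (liftFin_insertOne g hg h x).symm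
  map_one' := DirectLimit.lift_one (fun S => liftFin g hg S) _
  map_mul' x y := DirectLimit.lift_mul (fun S => liftFin g hg S) _ x y
  map_zero' := DirectLimit.lift_zero (fun S => liftFin g hg S) _
  map_add' x y := DirectLimit.lift_add (fun S => liftFin g hg S) _ x y

open Classical in
theorem liftHom_of (i : ι) (a : A i) : liftHom g hg (of A i a) = g i a := by
  have h1 : liftHom g hg (of A i a) = liftFin g hg {i} (PiTensorProduct.tprod ℤ
      (MonoidHom.mulSingle (fun j : ({i} : Finset ι) => A j)
        ⟨i, Finset.mem_singleton_self i⟩ a)) := rfl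
  rw [h1, liftFin_tprod, Finset.noncommProd_singleton]
  simp [extendAll]

theorem liftHom_injective (h : ∀ S, Function.Injective (liftFin g hg S)) :
    Function.Injective (liftHom g hg) :=
  DirectLimit.lift_injective _ _ (fun _ _ h x => (liftFin_insertOne g hg h x).symm) h

end AlgebraTensor

/-! ### The map from the tensor product and its injectivity on finite stages. -/

namespace Paramodular

variable {N : ℕ} [NeZero N]

/-- The double coset of `M ∈ 𝔾` in the global Hecke algebra. -/
noncomputable def gdc (N : ℕ) [NeZero N] (M : Sp) (hM : M ∈ bigG) : Hecke N :=
  HeckeAlgebra.basis (HeckeCoset.mk (Sigma N) (Sigma N) ⟨M, hM⟩)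

theorem incl_dc (p : Nat.Primes) (M : Gp N p) : incl N p (dc N p M) = gdc N M M.2.1 := by
  rw [incl, dc, HeckeAlgebra.inclusion_basis]
  rfl

theorem gdc_congr {M M' : Sp} (hM : M ∈ bigG) (hM' : M' ∈ bigG)
    (h : ∃ s ∈ Sigma N, ∃ t ∈ Sigma N, M' = s * M * t) : gdc N M hM = gdc N M' hM' :=
  congrArg HeckeAlgebra.basis (HeckeAlgebra.mk_eq_mk_iff.2 h).symm

/-- At p the element B is a local unit and u can be absorbed on the right; at every other prime A is
one and u is absorbed on the left. -/
theorem locEquiv_mul_mul {p : Nat.Primes} {A u B : Sp} (hA : A ∈ Gp N p) (hB : B ∈ unitsAt N p)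
    (hu : u ∈ Sigma N) (q : Nat.Primes) : LocEquiv N q (A * B) (A * u * B) := by
  by_cases hq : p = q
  · subst hq
    exact ⟨1, one_mem _, B⁻¹ * u * B,
      mul_mem (mul_mem (inv_mem hB) (sigma_le_unitsAt N p hu)) hB, by group⟩
  · have hA' := gp_le_unitsAt N hq hA
    exact ⟨A * u * A⁻¹, mul_mem (mul_mem hA' (sigma_le_unitsAt N q hu)) (inv_mem hA'), 1,
      one_mem _, by group⟩

/-- The local-global principle puts every A u B into the double coset of A B. For multiplicity one,
k B⁻¹ has ν prime to p as k ∈ Σ_N B Σ_N, and it lies in 𝔾_p because it is also a quotient of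
elements of Σ_N A Σ_N. -/
theorem gdc_mul (hN : Squarefree N) {p : Nat.Primes} {A B : Sp} (hA : A ∈ Gp N p)
    (hB : B ∈ unitsAt N p) :
    gdc N A hA.1 * gdc N B hB.1 = gdc N (A * B) (mul_mem hA.1 hB.1) := by
  refine HeckeAlgebra.basis_mul_basis (fun u hu => ?_) fun k hk hk' => ?_
  · exact exists_sigma_of_locEquiv hN (mul_mem hA.1 hB.1)
      (mul_mem (mul_mem hA.1 (sigma_le N hu)) hB.1) (locEquiv_mul_mul hA hB hu)
  · obtain ⟨s, hs, t, ht, rfl⟩ := HeckeAlgebra.mem_carrier_mk.1 hk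
    obtain ⟨c, hc, d, hd, e⟩ := HeckeAlgebra.mem_carrier_mk.1 hk'
    refine mem_sigma_of_mem_gp_of_mem_unitsAt (p := p) ?_ ?_
    · have : s * B * t * B⁻¹ = (c * A * d)⁻¹ * A := by
        rw [← e]; group
      dsimp only at this ⊢
      rw [this]
      exact mul_mem (inv_mem (mul_mem (mul_mem (sigma_le_gp N p hc) hA) (sigma_le_gp N p hd))) hA
    · exact mul_mem (mul_mem (mul_mem (sigma_le_unitsAt N p hs) hB) (sigma_le_unitsAt N p ht))
        (inv_mem hB)

/-- A B and B A are conjugate by B, a local unit at p, and by A, a local unit at all other primes.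
-/
theorem gdc_mul_comm (hN : Squarefree N) {p q : Nat.Primes} (hpq : p ≠ q) {A B : Sp}
    (hA : A ∈ Gp N p) (hB : B ∈ Gp N q) :
    gdc N A hA.1 * gdc N B hB.1 = gdc N B hB.1 * gdc N A hA.1 := by
  rw [gdc_mul hN hA (gp_le_unitsAt N hpq.symm hB), gdc_mul hN hB (gp_le_unitsAt N hpq hA)]
  refine gdc_congr (mul_mem hA.1 hB.1) (mul_mem hB.1 hA.1)
    (exists_sigma_of_locEquiv hN (mul_mem hA.1 hB.1) (mul_mem hB.1 hA.1) fun r => ?_)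
  by_cases hr : p = r
  · subst hr
    have hB' := gp_le_unitsAt N hpq.symm hB
    exact ⟨B, hB', B⁻¹, inv_mem hB', by group⟩
  · have hA' := gp_le_unitsAt N hr hA
    exact ⟨A⁻¹, inv_mem hA', A, hA', by group⟩

/-- The inclusion of a primary component as a ring homomorphism. -/
noncomputable def inclHom (N : ℕ) [NeZero N] (p : Nat.Primes) : HeckeP N p →+* Hecke N :=
  HeckeAlgebra.inclusionHom (gp_le N p)

theorem inclHom_apply (p : Nat.Primes) (x : HeckeP N p) : inclHom N p x = incl N p x := rfl

theorem commute_inclHom (hN : Squarefree N) (p q : Nat.Primes) (hpq : p ≠ q) (x : HeckeP N p)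
    (y : HeckeP N q) : Commute (inclHom N p x) (inclHom N q y) := by
  have h1 : ∀ A : Gp N p, Commute (inclHom N p (dc N p A)) (inclHom N q y) := fun A =>
    HeckeAlgebra.closure_basis
      (S := ((AddMonoidHom.mulLeft (inclHom N p (dc N p A))).comp
        (inclHom N q).toAddMonoidHom).eqLocus
        ((AddMonoidHom.mulRight (inclHom N p (dc N p A))).comp (inclHom N q).toAddMonoidHom))
      (fun D => by
        induction D using HeckeAlgebra.coset_ind with
        | h B =>
        change inclHom N p (dc N p A) * inclHom N q (dc N q B) =
          inclHom N q (dc N q B) * inclHom N p (dc N p A)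
        rw [inclHom_apply, inclHom_apply, incl_dc, incl_dc]
        exact gdc_mul_comm hN hpq A.2 B.2) y
  exact HeckeAlgebra.closure_basis
    (S := ((AddMonoidHom.mulRight (inclHom N q y)).comp
        (inclHom N p).toAddMonoidHom).eqLocus
        ((AddMonoidHom.mulLeft (inclHom N q y)).comp (inclHom N p).toAddMonoidHom))
      (fun D => by
        induction D using HeckeAlgebra.coset_ind with
        | h A => exact h1 A) x

/-- The homomorphism from the tensor product of the primary components. -/
noncomputable def tensorHom (hN : Squarefree N) :
    AlgebraTensor (fun p : Nat.Primes => HeckeP N p) →+* Hecke N :=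
  AlgebraTensor.liftHom (inclHom N) (commute_inclHom hN)

/-- The product of double cosets of elements of different `𝔾_p` is a double coset. -/
theorem exists_noncommProd_gdc (hN : Squarefree N) (S : Finset Nat.Primes)
    (M : ∀ p : Nat.Primes, Gp N p) :
    ∃ (A : Sp) (hA : A ∈ bigG), S.noncommProd (fun p => inclHom N p (dc N p (M p)))
        
        (AlgebraTensor.pairwise_commute (inclHom N) (commute_inclHom hN) S
          fun p => dc N p (M p)) = gdc N A hA ∧
      (∀ p ∈ S, LocEquiv N p (M p) A) ∧ ∀ p ∉ S, A ∈ unitsAt N p := by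
  classical
  induction S using Finset.induction_on with
  | empty =>
    refine ⟨1, one_mem _, ?_, by simp, fun p _ => one_mem _⟩
    rw [Finset.noncommProd_empty]
    rfl
  | insert p S hp ih =>
    obtain ⟨A, hA, e, h1, h2⟩ := ih
    refine ⟨M p * A, mul_mem (M p).2.1 hA, ?_, fun q hq => ?_, fun q hq => ?_⟩
    · rw [Finset.noncommProd_insert_of_notMem _ _ _ _ hp, e, inclHom_apply, incl_dc]
      exact gdc_mul hN (M p).2 (h2 p hp)
    · rcases Finset.mem_insert.1 hq with rfl | hq
      · exact ⟨1, one_mem _, A, h2 _ hp, by group⟩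
      · refine (h1 q hq).trans ⟨M p, gp_le_unitsAt N ?_ (M p).2, 1, one_mem _, by group⟩
        rintro rfl
        exact hp hq
    · rw [Finset.mem_insert, not_or] at hq
      exact mul_mem (gp_le_unitsAt N (Ne.symm hq.1) (M p).2) (h2 q hq.2)

/-- The tensors of double cosets form a basis, and each goes to a single double coset. Its
representative is locally equivalent at p to the component at p, and away from p elements of 𝔾_p are
local units; so the components are determined, and distinct basis vectors have distinct images. -/
theorem liftFin_injective (hN : Squarefree N) (S : Finset Nat.Primes) :
    Function.Injective (AlgebraTensor.liftFin (inclHom N) (commute_inclHom hN) S) := by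
  let b := Basis.piTensorProduct fun p : S =>
    HeckeAlgebra.zBasis (Δ := (Gp N p).toSubmonoid) (U := Sigma N)
  have hex : ∀ D : ∀ p : S, HeckeCoset (Gp N p).toSubmonoid (Sigma N) (Sigma N),
      ∃ M : ∀ p : Nat.Primes, Gp N p, ∀ p : S, HeckeCoset.mk (Sigma N) (Sigma N) (M p) = D p := by
    classical
    intro D
    choose M hM using fun p : S => Quotient.exists_rep (D p)
    refine ⟨fun p => if h : p ∈ S then M ⟨p, h⟩ else 1, fun p => ?_⟩
    simp only [p.2, dif_pos]
    exact hM p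
  choose M hM using hex
  choose A hA hAe hA1 hA2 using fun D => exists_noncommProd_gdc hN S (M D)
  let F : (∀ p : S, HeckeCoset (Gp N p).toSubmonoid (Sigma N) (Sigma N)) →
    HeckeCoset bigG.toSubmonoid (Sigma N) (Sigma N) :=
      fun D => HeckeCoset.mk (Sigma N) (Sigma N) ⟨A D, hA D⟩
  have hF : Function.Injective F := by
    intro D D' h
    obtain ⟨s, hs, t, ht, e⟩ := HeckeAlgebra.mk_eq_mk_iff.1 h
    funext p
    rw [← hM D p, ← hM D' p]
    refine HeckeAlgebra.mk_eq_mk_iff.2 ?_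
    refine exists_sigma_of_locEquiv hN (M D' p).2.1 (M D p).2.1 fun q => ?_
    by_cases hq : p = q
    · subst hq
      refine (hA1 D' p p.2).trans (LocEquiv.trans ?_ (hA1 D p p.2).symm)
      exact ⟨s, sigma_le_unitsAt N p hs, t, sigma_le_unitsAt N p ht, e⟩
    · exact ⟨M D p, gp_le_unitsAt N hq (M D p).2, (M D' p)⁻¹,
        inv_mem (gp_le_unitsAt N hq (M D' p).2), by group⟩
  have hb : ∀ D, AlgebraTensor.liftFin (inclHom N) (commute_inclHom hN) S (b D) =
      HeckeAlgebra.zBasis (F D) := by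
    intro D
    rw [HeckeAlgebra.zBasis_apply]
    refine Eq.trans ?_ (hAe D)
    simp only [b, Basis.piTensorProduct_apply, AlgebraTensor.liftFin_tprod]
    refine Finset.noncommProd_congr rfl (fun p hp => ?_) _
    simp only [AlgebraTensor.extendAll, hp, dif_pos, HeckeAlgebra.zBasis_apply]
    rw [dc, hM D ⟨p, hp⟩]
  have hli : LinearIndependent ℤ fun D => AlgebraTensor.liftFin (inclHom N)
      (commute_inclHom hN) S (b D) := by
    simp only [hb]
    exact HeckeAlgebra.zBasis.linearIndependent.comp F hF
  intro x y hxy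
  apply b.repr.injective
  apply hli
  have key : ∀ z, Finsupp.linearCombination ℤ (fun D => AlgebraTensor.liftFin (inclHom N)
      (commute_inclHom hN) S (b D)) (b.repr z) =
      AlgebraTensor.liftFin (inclHom N) (commute_inclHom hN) S z := by
    intro z
    conv_rhs => rw [← b.linearCombination_repr z]
    rw [Finsupp.linearCombination_apply, Finsupp.linearCombination_apply, map_finsuppSum]
    simp only [map_zsmul]
  rw [key, key, hxy]

end Paramodular

/-! ### Surjectivity of the map from the tensor product. -/

namespace Paramodular

variable {N : ℕ} [NeZero N]

theorem diagMat_mul (m n a b c d : ℕ) :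
    diagMat (m * n) (a * c) (b * d) = diagMat m a b * diagMat n c d := by
  ext i j
  simp only [Matrix.mul_apply, Fin.sum_univ_four]
  fin_cases i <;> fin_cases j <;> simp [diagMat]

theorem pat_diagMat (N m a b : ℕ) : Pat N (diagMat m a b) := by simp [Pat, diagMat]

theorem exists_rep_diagMat {m a b : ℕ} (hm : 0 < m) (h : a * b = m) :
    ∃ D, Rep N m (diagMat m a b) D := by
  refine exists_rep hm ?_
  have h' : (a : ℤ) * b = m := by exact_mod_cast h
  ext i j
  simp only [Matrix.mul_apply, Fin.sum_univ_four]
  fin_cases i <;> fin_cases j <;> simp [diagMat, altForm, ← h'] <;> ring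

theorem tensorHom_of (hN : Squarefree N) (p : Nat.Primes) (x : HeckeP N p) :
    tensorHom hN (AlgebraTensor.of (fun p : Nat.Primes => HeckeP N p) p x) = incl N p x :=
  AlgebraTensor.liftHom_of _ _ p x

theorem gdc_mem_range_of_mem_gp (hN : Squarefree N) {p : Nat.Primes} {A : Sp} (hA : A ∈ Gp N p) :
    gdc N A hA.1 ∈ (tensorHom hN).rangeS :=
  ⟨_, (tensorHom_of hN p (dc N p ⟨A, hA⟩)).trans (incl_dc p ⟨A, hA⟩)⟩

theorem mem_gp_of_rep {p : Nat.Primes} {e : ℕ} {X : Matrix (Fin 4) (Fin 4) ℤ} {M : Sp}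
    (hX : Pat N X) (h : Rep N ((p : ℕ) ^ e) X M) : M ∈ Gp N p := by
  refine ⟨mem_bigG_of_rep (pow_pos p.2.pos e) h, ?_⟩
  obtain ⟨s, -, hs⟩ := (Nat.dvd_prime_pow p.2).1 (nu_dvd_of_rep (pow_pos p.2.pos e) hX h)
  exact ⟨s, hs⟩

/-- The part of the diagonal matrix at the least prime factor of m splits off, and `gdc_mul` turns
this factorization into a product of double cosets. -/
theorem gdc_diag_mem_range (hN : Squarefree N) (m : ℕ) : ∀ (a b : ℕ) (D : Sp) (hD : D ∈ bigG),
    0 < m → a * b = m → Rep N m (diagMat m a b) D → gdc N D hD ∈ (tensorHom hN).rangeS := by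
  induction m using Nat.strong_induction_on with
  | _ m ih =>
  intro a b D hD hm hab hr
  by_cases h1 : m = 1
  · subst h1
    have hs : D ∈ Sigma N := mem_sigma_of_rep hr
    -- The unit lies in every primary component; the prime 2 is an arbitrary choice.
    exact gdc_mem_range_of_mem_gp hN (sigma_le_gp N ⟨2, Nat.prime_two⟩ hs)
  · let p : Nat.Primes := ⟨m.minFac, Nat.minFac_prime h1⟩
    have ha0 : a ≠ 0 := by rintro rfl; simp at hab; omega
    have hb0 : b ≠ 0 := by rintro rfl; simp at hab; omega
    obtain ⟨i, a', ha', rfl⟩ := Nat.exists_eq_pow_mul_and_not_dvd ha0 p p.2.ne_one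
    obtain ⟨j, b', hb', rfl⟩ := Nat.exists_eq_pow_mul_and_not_dvd hb0 p p.2.ne_one
    have hm' : m = (p : ℕ) ^ (i + j) * (a' * b') := by rw [← hab, pow_add]; ring
    have hn0 : 0 < a' * b' := Nat.pos_of_ne_zero (by rintro h; rw [h] at hm'; simp at hm'; omega)
    have hpn : ¬ (p : ℕ) ∣ a' * b' := fun h => ((Nat.Prime.dvd_mul p.2).1 h).elim ha' hb'
    have hlt : a' * b' < m := by
      have hp : (p : ℕ) ∣ m := Nat.minFac_dvd m
      refine lt_of_le_of_ne (Nat.le_of_dvd hm ⟨_, by rw [hm', mul_comm]⟩) fun h => hpn ?_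
      rwa [h]
    obtain ⟨D₁, hD₁⟩ := exists_rep_diagMat (N := N) (pow_pos p.2.pos (i + j))
      (pow_add (p : ℕ) i j).symm
    obtain ⟨D₂, hD₂⟩ := exists_rep_diagMat (N := N) hn0 rfl
    have hrr := hD₁.mul hD₂
    rw [← diagMat_mul, ← hm'] at hrr
    obtain rfl := hr.eq hm hrr
    have h₁ : D₁ ∈ Gp N p := mem_gp_of_rep (pat_diagMat _ _ _ _) hD₁
    have h₂' : D₂ ∈ bigG := mem_bigG_of_rep hn0 hD₂
    have h₂ : D₂ ∈ unitsAt N p :=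
      ⟨h₂', fun h => hpn (h.trans (nu_dvd_of_rep hn0 (pat_diagMat _ _ _ _) hD₂))⟩
    rw [← gdc_mul hN h₁ h₂]
    exact mul_mem (gdc_mem_range_of_mem_gp hN h₁) (ih _ hlt _ _ _ h₂' hn0 rfl hD₂)

theorem wGroup_conj_mem_sigma' {U g : Sp} (hU : U ∈ wGroup N) (hg : g ∈ Sigma N) :
    U⁻¹ * g * U ∈ Sigma N := by
  simpa using wGroup_conj_mem_sigma (inv_mem hU) hg

theorem gdc_wGroup_mul {U M : Sp} (hU : U ∈ wGroup N) (hM : M ∈ bigG) :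
    gdc N U (wGroup_spec hU).1 * gdc N M hM = gdc N (U * M) (mul_mem (wGroup_spec hU).1 hM) :=
  HeckeAlgebra.basis_mul_of_normalizes (fun _ => wGroup_conj_mem_sigma hU)
    fun _ => wGroup_conj_mem_sigma' hU

theorem gdc_mul_wGroup {U M : Sp} (hU : U ∈ wGroup N) (hM : M ∈ bigG) :
    gdc N M hM * gdc N U (wGroup_spec hU).1 = gdc N (M * U) (mul_mem hM (wGroup_spec hU).1) :=
  HeckeAlgebra.basis_mul_normalizes (fun _ => wGroup_conj_mem_sigma hU)
    fun _ => wGroup_conj_mem_sigma' hU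

theorem gdc_wGroup_mem_range (hN : Squarefree N) {U : Sp} (hU : U ∈ wGroup N) :
    gdc N U (wGroup_spec hU).1 ∈ (tensorHom hN).rangeS := by
  -- The inverse is carried along so that the inversion step of the closure induction goes through.
  suffices h : gdc N U (wGroup_spec hU).1 ∈ (tensorHom hN).rangeS ∧
      gdc N U⁻¹ (wGroup_spec (inv_mem hU)).1 ∈ (tensorHom hN).rangeS from h.1
  induction hU using Subgroup.closure_induction with
  | mem W h =>
    obtain ⟨p, hp, hW⟩ := h
    exact ⟨gdc_mem_range_of_mem_gp hN (isW_mem_gp hW),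
      gdc_mem_range_of_mem_gp hN (isW_mem_gp (isW_inv hW))⟩
  | one =>
    have h1 := gdc_mem_range_of_mem_gp hN (one_mem (Gp N ⟨2, Nat.prime_two⟩))
    exact ⟨h1, by simpa only [inv_one] using h1⟩
  | mul x y hx hy ihx ihy =>
    refine ⟨?_, ?_⟩
    · rw [← gdc_wGroup_mul hx (wGroup_spec hy).1]
      exact mul_mem ihx.1 ihy.1
    · simp only [mul_inv_rev]
      rw [← gdc_wGroup_mul (inv_mem hy) (wGroup_spec (inv_mem hx)).1]
      exact mul_mem ihy.2 ihx.2
  | inv x hx ih => exact ⟨ih.2, by simpa only [inv_inv] using ih.1⟩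

theorem tensorHom_surjective (hN : Squarefree N) : Function.Surjective (tensorHom hN) := by
  intro f
  -- The range is taken as a subsemiring; containing -1 makes it an additive subgroup.
  have hneg : (-1 : Hecke N) ∈ (tensorHom hN).rangeS := by
    let p : Nat.Primes := ⟨2, Nat.prime_two⟩
    refine ⟨_, (tensorHom_of hN p (-1)).trans ?_⟩
    rw [← inclHom_apply, map_neg, map_one]
  refine HeckeAlgebra.closure_basis (S := { (tensorHom hN).rangeS.toAddSubmonoid with
    neg_mem' := fun {x} hx => by simpa using mul_mem hneg hx }) (fun D => ?_) f
  induction D using HeckeAlgebra.coset_ind with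
  | h M =>
  obtain ⟨M, hM⟩ := M
  change gdc N M hM ∈ (tensorHom hN).rangeS
  obtain ⟨U, hU, V, hV, hgood⟩ := exists_wGroup_goodAt hN hM
  have hUG := (wGroup_spec hU).1
  have hVG := (wGroup_spec hV).1
  have hG : U * M * V ∈ bigG := mul_mem (mul_mem hUG hM) hVG
  obtain ⟨s, hs, t, ht, a, b, hab, -, hr⟩ := exists_sigma_diag hG hgood
  have h1 := gdc_diag_mem_range hN _ a b _
    (mul_mem (mul_mem (sigma_le N hs) hG) (sigma_le N ht)) (nu_pos hG) hab hr
  rw [← gdc_congr hG _ ⟨s, hs, t, ht, rfl⟩] at h1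
  have h2 := mul_mem (mul_mem (gdc_wGroup_mem_range hN (inv_mem hU)) h1)
    (gdc_wGroup_mem_range hN (inv_mem hV))
  rw [gdc_wGroup_mul (inv_mem hU) hG, gdc_mul_wGroup (inv_mem hV)] at h2
  have e : U⁻¹ * (U * M * V) * V⁻¹ = M := by group
  simpa only [e] using h2

theorem tensorHom_injective (hN : Squarefree N) : Function.Injective (tensorHom hN) :=
  AlgebraTensor.liftHom_injective _ _ (liftFin_injective hN)

end Paramodular

/-! ### Supports and leading coefficients of products. -/

namespace HeckeAlgebra

variable {G : Type*} [Group G] {Δ : Submonoid G} {U : Subgroup G} [IsHeckeTriple Δ U U]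

/-- The coefficient of a double coset as an additive map. -/
noncomputable def coeffHom (D : HeckeCoset Δ U U) : HeckeRing Δ U ℤ →+ ℤ where
  toFun f := f D
  map_zero' := rfl
  map_add' _ _ := rfl

/-- The elements of the Hecke algebra supported on the double cosets with property `P`. -/
noncomputable def supported (P : G → Prop) : AddSubgroup (HeckeRing Δ U ℤ) where
  carrier := {f | ∀ x : Δ, f (HeckeCoset.mk U U x) ≠ 0 → P x}
  zero_mem' x h := absurd rfl h
  add_mem' {f g} hf hg x h := by
    by_contra hP
    have h1 : f (HeckeCoset.mk U U x) = 0 := not_not.1 fun h1 => hP (hf x h1)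
    have h2 : g (HeckeCoset.mk U U x) = 0 := not_not.1 fun h1 => hP (hg x h1)
    exact h (by
      change coeffHom _ (f + g) = 0
      rw [map_add]
      change f _ + g _ = 0
      rw [h1, h2, add_zero])
  neg_mem' {f} hf x h := hf x fun h0 => h (by
    change coeffHom _ (-f) = 0
    rw [map_neg]
    change -f _ = 0
    rw [h0, neg_zero])

variable {P Q R : G → Prop}

theorem mem_of_forall_coeff {f : HeckeRing Δ U ℤ} {S : AddSubgroup (HeckeRing Δ U ℤ)}
    (h : ∀ x : Δ, f (HeckeCoset.mk U U x) ≠ 0 → basis (HeckeCoset.mk U U x) ∈ S) : f ∈ S := by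
  rw [eq_sum_basis f]
  refine sum_mem fun D hD => zsmul_mem ?_ _
  induction D using coset_ind with
  | h x => exact h x (Finsupp.mem_support_iff.1 hD)

theorem mem_of_mem_supported {f : HeckeRing Δ U ℤ} (hf : f ∈ supported P)
    {S : AddSubgroup (HeckeRing Δ U ℤ)}
    (h : ∀ x : Δ, P x → basis (HeckeCoset.mk U U x) ∈ S) : f ∈ S :=
  mem_of_forall_coeff fun x hx => h x (hf x hx)

theorem basis_mem_supported (hP : ∀ u ∈ U, ∀ v ∈ U, ∀ a, P a → P (u * a * v)) {x : Δ} (hx : P x) :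
    basis (HeckeCoset.mk U U x) ∈ supported P := by
  classical
  intro y hy
  rw [basis_apply] at hy
  obtain ⟨u, hu, v, hv, e⟩ := mk_eq_mk_iff.1 (ite_ne_right_iff.1 hy).1.symm
  rw [e]
  exact hP u hu v hv _ hx

theorem mul_mem_supported (hP : ∀ u ∈ U, ∀ v ∈ U, ∀ a, P a → P (u * a * v))
    (hQ : ∀ u ∈ U, ∀ v ∈ U, ∀ a, Q a → Q (u * a * v)) (h : ∀ a b, P a → Q b → R (a * b))
    {f g : HeckeRing Δ U ℤ} (hf : f ∈ supported P) (hg : g ∈ supported Q) :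
    f * g ∈ supported R := by
  have h1 : f ∈ (supported R).comap (AddMonoidHom.mulRight g) :=
    mem_of_mem_supported hf fun a ha => ?_
  · exact AddSubgroup.mem_comap.1 h1
  have h2 : g ∈ (supported R).comap (AddMonoidHom.mulLeft (basis (HeckeCoset.mk U U a))) :=
    mem_of_mem_supported hg fun b hb => ?_
  · exact AddSubgroup.mem_comap.1 h2
  refine AddSubgroup.mem_comap.2 fun x hx => ?_
  rw [AddMonoidHom.coe_mulLeft] at hx
  rw [basis_mul_apply, Nat.cast_ne_zero] at hx
  obtain ⟨k, hk, hk'⟩ := exists_of_mulCoeff_ne_zero hx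
  obtain ⟨u, hu, v, hv, rfl⟩ := mem_carrier_mk.1 hk
  obtain ⟨c, hc, d, hd, e⟩ := mem_carrier_mk.1 hk'
  rw [mul_inv_eq_iff_eq_mul.1 e]
  exact h _ _ (hP c hc d hd _ ha) (hQ u hu v hv _ hb)

/-- The coefficient of a product at `U x y U`, if `k = y` is, up to units, the only
possibility to write `x y` as a product with second factor `k` in `U y U`. -/
theorem mul_basis_apply_eq (hP : ∀ u ∈ U, ∀ v ∈ U, ∀ a, P a → P (u * a * v))
    {x y : Δ} (h : ∀ k ∈ carrier (HeckeCoset.mk U U y), P ((x : G) * y * k⁻¹) → k * (y : G)⁻¹ ∈ U)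
    {f : HeckeRing Δ U ℤ} (hf : f ∈ supported P) :
    (f * basis (HeckeCoset.mk U U y)) (HeckeCoset.mk U U (x * y)) = f (HeckeCoset.mk U U x) := by
  classical
  refine mem_of_mem_supported hf (S := ((coeffHom (HeckeCoset.mk U U (x * y))).comp
    (AddMonoidHom.mulRight (basis (HeckeCoset.mk U U y)))).eqLocus
      (coeffHom (HeckeCoset.mk U U x))) fun a ha => ?_
  change (basis (HeckeCoset.mk U U a) * basis (HeckeCoset.mk U U y)) (HeckeCoset.mk U U (x * y)) =
    basis (HeckeCoset.mk U U a) (HeckeCoset.mk U U x)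
  -- Every a in the support of f satisfies P, so the hypothesis applies to all factorizations of x y
  -- with first factor in U a U.
  have key : ∀ k ∈ carrier (HeckeCoset.mk U U y),
      ((x * y : Δ) : G) * k⁻¹ ∈ carrier (HeckeCoset.mk U U a) → k * (y : G)⁻¹ ∈ U := by
    intro k hk hk'
    obtain ⟨c, hc, d, hd, e⟩ := mem_carrier_mk.1 hk'
    refine h k hk ?_
    rw [← Submonoid.coe_mul, e]
    exact hP c hc d hd _ ha
  rw [basis_mul_apply, basis_apply]
  split_ifs with hax
  · rw [mulCoeff_eq_one (mem_carrier_self y) ?_ key, Nat.cast_one]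
    simpa [hax] using mem_carrier_self x
  · rw [Nat.cast_eq_zero]
    by_contra hne
    obtain ⟨k, hk, hk'⟩ := exists_of_mulCoeff_ne_zero hne
    have h1 := key k hk hk'
    refine hax ((mem_carrier_iff x).1 ?_).symm
    have h2 := (mem_carrier_right (D := HeckeCoset.mk U U a) h1).2 hk'
    simpa [mul_assoc] using h2

end HeckeAlgebra

namespace HeckeAlgebra

variable {G : Type*} [Group G] {Δ : Submonoid G} {U : Subgroup G} [IsHeckeTriple Δ U U]

/-- The elimination step of a unitriangular system: subtract from f its other terms. -/
theorem basis_mem_of_coeff_eq_one {S : AddSubgroup (HeckeRing Δ U ℤ)} {f : HeckeRing Δ U ℤ}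
    (hf : f ∈ S) {x : Δ} (h1 : f (HeckeCoset.mk U U x) = 1)
    (h : ∀ y : Δ, f (HeckeCoset.mk U U y) ≠ 0 → HeckeCoset.mk U U y ≠ HeckeCoset.mk U U x →
      basis (HeckeCoset.mk U U y) ∈ S) : basis (HeckeCoset.mk U U x) ∈ S := by
  classical
  have hg : f - basis (HeckeCoset.mk U U x) ∈ S := mem_of_forall_coeff fun y hy => by
    have e : (f - basis (HeckeCoset.mk U U x)) (HeckeCoset.mk U U y) =
        f (HeckeCoset.mk U U y) - basis (HeckeCoset.mk U U x) (HeckeCoset.mk U U y) :=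
      map_sub (coeffHom (HeckeCoset.mk U U y)) _ _
    rw [e, basis_apply] at hy
    by_cases hyx : HeckeCoset.mk U U x = HeckeCoset.mk U U y
    · rw [if_pos hyx, ← hyx, h1, sub_self] at hy
      exact absurd rfl hy
    · rw [if_neg hyx, sub_zero] at hy
      exact h y hy (Ne.symm hyx)
  simpa using sub_mem hf hg

end HeckeAlgebra

/-! ### Bounds on supports by minors, and uniqueness of factorizations. -/

namespace Paramodular

variable {N : ℕ} [NeZero N]

/-- `√m M` has an integral model with minors divisible by `d` and lower right block
divisible by `c`. -/
def HasModel (N m : ℕ) (d c : ℤ) (M : Sp) : Prop :=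
  ∃ Y, Pat N Y ∧ Rep N m Y M ∧ DvdMinors d Y ∧
    (c ∣ Y 2 2 ∧ c ∣ Y 2 3) ∧ c ∣ Y 3 2 ∧ c ∣ Y 3 3

/-- Minors multiply by Cauchy–Binet. In the lower right block of X Y every term contains an entry of
the upper right or lower right block of Y, and both are divisible by c'. -/
theorem HasModel.mul {m m' : ℕ} {d d' c c' : ℤ} {A B : Sp} (hc : c' ∣ N)
    (hA : HasModel N m d c A) (hB : HasModel N m' d' c' B) :
    HasModel N (m * m') (d * d') c' (A * B) := by
  obtain ⟨X, hX, rX, dX, -⟩ := hA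
  obtain ⟨Y, hY, rY, dY, ⟨h1, h2⟩, h3, h4⟩ := hB
  refine ⟨X * Y, hX.mul hY, rX.mul rY, dX.mul dY, ?_⟩
  obtain ⟨⟨k1, k2⟩, k3, k4⟩ := hY
  simp only [Matrix.mul_apply, Fin.sum_univ_four]
  exact ⟨⟨dvd_add (dvd_add (dvd_add (.mul_left (hc.trans k1) _) (.mul_left (hc.trans k3) _))
    (.mul_left h1 _)) (.mul_left h3 _), dvd_add (dvd_add (dvd_add (.mul_left (hc.trans k2) _)
    (.mul_left (hc.trans k4) _)) (.mul_left h2 _)) (.mul_left h4 _)⟩,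
    dvd_add (dvd_add (dvd_add (.mul_left (hc.trans k1) _) (.mul_left (hc.trans k3) _))
    (.mul_left h1 _)) (.mul_left h3 _), dvd_add (dvd_add (dvd_add (.mul_left (hc.trans k2) _)
    (.mul_left (hc.trans k4) _)) (.mul_left h2 _)) (.mul_left h4 _)⟩

theorem HasModel.sigma_mul_mul {m : ℕ} {d c : ℤ} {s t M : Sp} (hc : c ∣ N) (hs : s ∈ Sigma N)
    (ht : t ∈ Sigma N) (h : HasModel N m d c M) : HasModel N m d c (s * M * t) := by
  obtain ⟨X, hX, rX, dX, ⟨h1, h2⟩, h3, h4⟩ := h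
  obtain ⟨S, pS, rS⟩ := exists_rep_of_mem_sigma hs
  obtain ⟨T, pT, rT⟩ := exists_rep_of_mem_sigma ht
  have hr := (rS.mul rX).mul rT
  rw [one_mul, mul_one] at hr
  refine ⟨S * X * T, (pS.mul hX).mul pT, hr, dX.mul_mul S T, ?_⟩
  obtain ⟨⟨k1, k2⟩, k3, k4⟩ := pT
  obtain ⟨⟨l1, l2⟩, l3, l4⟩ := hX
  have e2 : ∀ i, c ∣ (S * X) i 2 := fun i => by
    simp only [Matrix.mul_apply, Fin.sum_univ_four]
    exact dvd_add (dvd_add (dvd_add (.mul_left (hc.trans l1) _) (.mul_left (hc.trans l3) _))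
      (.mul_left h1 _)) (.mul_left h3 _)
  have e3 : ∀ i, c ∣ (S * X) i 3 := fun i => by
    simp only [Matrix.mul_apply, Fin.sum_univ_four]
    exact dvd_add (dvd_add (dvd_add (.mul_left (hc.trans l2) _) (.mul_left (hc.trans l4) _))
      (.mul_left h2 _)) (.mul_left h4 _)
  have f2 : ∀ i, c ∣ (S * X * T) i 2 := fun i => by
    rw [Matrix.mul_apply, Fin.sum_univ_four]
    exact dvd_add (dvd_add (dvd_add (.mul_left (hc.trans k1) _) (.mul_left (hc.trans k3) _))
      (.mul_right (e2 i) _)) (.mul_right (e3 i) _)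
  have f3 : ∀ i, c ∣ (S * X * T) i 3 := fun i => by
    rw [Matrix.mul_apply, Fin.sum_univ_four]
    exact dvd_add (dvd_add (dvd_add (.mul_left (hc.trans k2) _) (.mul_left (hc.trans k4) _))
      (.mul_right (e2 i) _)) (.mul_right (e3 i) _)
  exact ⟨⟨f2 2, f3 2⟩, f2 3, f3 3⟩

theorem Rep.diag_inv {m a b : ℕ} (hm : 0 < m) (hab : a * b = m) {D : Sp}
    (h : Rep N m (diagMat m a b) D) :
    Rep N m !![(m : ℤ), 0, 0, 0; 0, 1, 0, 0; 0, 0, (b : ℤ), 0; 0, 0, 0, (a : ℤ)] D⁻¹ := by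
  have hab' : (a : ℤ) * b = m := by exact_mod_cast hab
  obtain ⟨D', hD'⟩ := exists_rep (N := N) (m := m)
    (X := !![(m : ℤ), 0, 0, 0; 0, 1, 0, 0; 0, 0, (b : ℤ), 0; 0, 0, 0, (a : ℤ)]) hm (by
      ext i j
      simp only [Matrix.mul_apply, Fin.sum_univ_four]
      fin_cases i <;> fin_cases j <;> simp [altForm, ← hab'] <;> ring)
  have h1 := h.mul hD'
  have e : diagMat m a b * !![(m : ℤ), 0, 0, 0; 0, 1, 0, 0; 0, 0, (b : ℤ), 0; 0, 0, 0, (a : ℤ)] =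
      (m : ℤ) • 1 := by
    ext i j
    simp only [Matrix.mul_apply, Fin.sum_univ_four]
    fin_cases i <;> fin_cases j <;> simp [diagMat, ← hab', mul_comm]
  rw [e, ← sq, ← mul_one (m ^ 2)] at h1
  have h2 := (h1.of_smul hm).eq one_pos (rep_one N)
  rwa [inv_eq_of_mul_eq_one_right h2]

/-- The quotient has the model H diag(m, 1, b, a) with multiplier m². The column divisibilities say
that m divides this matrix, so a model with multiplier 1 remains. -/
theorem mul_inv_mem_sigma_of_dvd {m a b : ℕ} (hm : 0 < m) (hab : a * b = m) {D k : Sp}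
    (h : Rep N m (diagMat m a b) D) {H : Matrix (Fin 4) (Fin 4) ℤ} (hH : Rep N m H k)
    (h1 : ∀ i, (m : ℤ) ∣ H i 1) (h2 : ∀ i, (a : ℤ) ∣ H i 2) (h3 : ∀ i, (b : ℤ) ∣ H i 3) :
    k * D⁻¹ ∈ Sigma N := by
  have hab' : (a : ℤ) * b = m := by exact_mod_cast hab
  have hr := hH.mul (h.diag_inv hm hab)
  choose u hu using h1
  choose v hv using h2
  choose w hw using h3
  have e : H * !![(m : ℤ), 0, 0, 0; 0, 1, 0, 0; 0, 0, (b : ℤ), 0; 0, 0, 0, (a : ℤ)] =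
      (m : ℤ) • Matrix.of fun i => ![H i 0, u i, v i, w i] := by
    ext i j
    simp only [Matrix.mul_apply, Fin.sum_univ_four]
    fin_cases j <;> simp [hu, hv, hw, ← hab'] <;> ring
  rw [e, ← sq, ← mul_one (m ^ 2)] at hr
  exact mem_sigma_of_rep (hr.of_smul hm)

/-- Multiply H (dual form) Hᵀ = m (dual form) on the left by row 0 of G. As row 0 of G H is a basis
vector, this gives N H k 1 up to sign; on the other side the pattern of G supplies a factor N, which
cancels. -/
theorem dvd_col_one {m : ℕ} (hm : 0 < m) {H G : Matrix (Fin 4) (Fin 4) ℤ} (hG : Pat N G)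
    (hH : H.transpose * altForm N * H = (m : ℤ) • altForm N)
    (h0 : (G * H) 0 0 = 1) (h1 : (G * H) 0 1 = 0) (h2 : (G * H) 0 2 = 0) (h3 : (G * H) 0 3 = 0)
    (k : Fin 4) : (m : ℤ) ∣ H k 1 := by
  have hN : (N : ℤ) ≠ 0 := Int.natCast_ne_zero.2 (NeZero.ne N)
  have hd := dual_symp hm hH
  have e : ∀ l, N * (H k 1 * H l 0 - H k 0 * H l 1) + (H k 3 * H l 2 - H k 2 * H l 3) =
      m * dualForm N k l := by
    intro l
    have := congrFun (congrFun hd k) l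
    simp only [Matrix.mul_apply, Fin.sum_univ_four, Matrix.transpose_apply, Matrix.smul_apply,
      smul_eq_mul] at this
    rw [← this]
    simp [dualForm]
    ring
  simp only [Matrix.mul_apply, Fin.sum_univ_four] at h0 h1 h2 h3
  have e' : N * H k 1 = m * (G 0 0 * dualForm N k 0 + G 0 1 * dualForm N k 1 +
      G 0 2 * dualForm N k 2 + G 0 3 * dualForm N k 3) := by
    linear_combination G 0 0 * e 0 + G 0 1 * e 1 + G 0 2 * e 2 + G 0 3 * e 3 - N * H k 1 * h0 +
      N * H k 0 * h1 - H k 3 * h2 + H k 2 * h3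
  obtain ⟨⟨⟨a, ha⟩, b, hb⟩, -⟩ := hG
  obtain ⟨z, hz⟩ : ∃ z, G 0 0 * dualForm N k 0 + G 0 1 * dualForm N k 1 +
      G 0 2 * dualForm N k 2 + G 0 3 * dualForm N k 3 = N * z := by
    fin_cases k <;> simp [dualForm, ha, hb]
    · exact ⟨-G 0 1, by ring⟩
    · exact ⟨G 0 0, by ring⟩
    · exact ⟨-b, by ring⟩
  rw [hz] at e'
  exact ⟨z, mul_left_cancel₀ hN (by linear_combination e')⟩

/-- The same argument with row 2, where the dual form has entries ±1, so no factor N has to be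
cancelled. -/
theorem dvd_col_three {m : ℕ} (hm : 0 < m) {H G : Matrix (Fin 4) (Fin 4) ℤ}
    (hH : H.transpose * altForm N * H = (m : ℤ) • altForm N)
    (h0 : (G * H) 2 0 = 0) (h1 : (G * H) 2 1 = 0) (h2 : (G * H) 2 2 = 1) (h3 : (G * H) 2 3 = 0)
    (k : Fin 4) : (m : ℤ) ∣ H k 3 := by
  have hd := dual_symp hm hH
  have e : ∀ l, N * (H k 1 * H l 0 - H k 0 * H l 1) + (H k 3 * H l 2 - H k 2 * H l 3) =
      m * dualForm N k l := by
    intro l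
    have := congrFun (congrFun hd k) l
    simp only [Matrix.mul_apply, Fin.sum_univ_four, Matrix.transpose_apply, Matrix.smul_apply,
      smul_eq_mul] at this
    rw [← this]
    simp [dualForm]
    ring
  simp only [Matrix.mul_apply, Fin.sum_univ_four] at h0 h1 h2 h3
  refine ⟨G 2 0 * dualForm N k 0 + G 2 1 * dualForm N k 1 +
      G 2 2 * dualForm N k 2 + G 2 3 * dualForm N k 3, ?_⟩
  linear_combination G 2 0 * e 0 + G 2 1 * e 1 + G 2 2 * e 2 + G 2 3 * e 3 - N * H k 1 * h0 +
    N * H k 0 * h1 - H k 3 * h2 + H k 2 * h3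

/-- Row 0 of G H has entries 1 and 0 in columns 0 and j, which writes H k j as a combination of
minors of H in these columns. -/
theorem DvdMinors.dvd_of_row {d : ℤ} {H G : Matrix (Fin 4) (Fin 4) ℤ} (hH : DvdMinors d H)
    (h0 : (G * H) 0 0 = 1) {j : Fin 4} (hj : (G * H) 0 j = 0) (k : Fin 4) : d ∣ H k j := by
  simp only [Matrix.mul_apply, Fin.sum_univ_four] at h0 hj
  have e : H k j = G 0 0 * (H k j * H 0 0 - H k 0 * H 0 j) +
      G 0 1 * (H k j * H 1 0 - H k 0 * H 1 j) + G 0 2 * (H k j * H 2 0 - H k 0 * H 2 j) +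
      G 0 3 * (H k j * H 3 0 - H k 0 * H 3 j) := by
    linear_combination -H k j * h0 + H k 0 * hj
  rw [e]
  exact dvd_add (dvd_add (dvd_add (.mul_left (hH _ _ _ _) _) (.mul_left (hH _ _ _ _) _))
    (.mul_left (hH _ _ _ _) _)) (.mul_left (hH _ _ _ _) _)

/-- The element of `𝔾_p` with model `diag(1, p^(i+j), p^i, p^j)`. -/
noncomputable def pd (N : ℕ) [NeZero N] (p : Nat.Primes) (i j : ℕ) : Gp N p :=
  ⟨(exists_rep_diagMat (N := N) (pow_pos p.2.pos (i + j)) (pow_add (p : ℕ) i j).symm).choose,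
    mem_gp_of_rep (pat_diagMat _ _ _ _)
      (exists_rep_diagMat (N := N) (pow_pos p.2.pos (i + j)) (pow_add (p : ℕ) i j).symm).choose_spec⟩

theorem rep_pd (p : Nat.Primes) (i j : ℕ) :
    Rep N ((p : ℕ) ^ (i + j)) (diagMat ((p : ℕ) ^ (i + j)) ((p : ℕ) ^ i) ((p : ℕ) ^ j))
      (pd N p i j).1 :=
  (exists_rep_diagMat (N := N) (pow_pos p.2.pos (i + j)) (pow_add (p : ℕ) i j).symm).choose_spec

theorem pd_mul (p : Nat.Primes) (i j k l : ℕ) :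
    pd N p i j * pd N p k l = pd N p (i + k) (j + l) := by
  have h := (rep_pd (N := N) p i j).mul (rep_pd p k l)
  rw [← diagMat_mul, ← pow_add, ← pow_add, ← pow_add,
    show i + j + (k + l) = i + k + (j + l) by ring] at h
  exact Subtype.ext (h.eq (pow_pos p.2.pos _) (rep_pd p _ _))

theorem t₁_eq_pd (p : Nat.Primes) : t₁ N p = pd N p 0 1 := by
  have hs : √((p : ℕ) : ℝ) ≠ 0 := (Real.sqrt_pos.2 (Nat.cast_pos.2 p.2.pos)).ne'
  have hN : (N : ℝ) ≠ 0 := NeZero.ne _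
  refine Subtype.ext (Rep.eq (N := N) p.2.pos (X := diagMat p 1 p) ?_ (by simpa using rep_pd p 0 1))
  unfold Rep
  ext i j
  rcases i with i | i <;> rcases j with j | j <;> fin_cases i <;> fin_cases j <;>
    simp [t₁, diagSp, realMat, diagMat, coord, scale, mat, hs, hN]

theorem t₂_eq_pd (p : Nat.Primes) : t₂ N p = pd N p 1 1 := by
  have hp : ((p : ℕ) : ℝ) ≠ 0 := Nat.cast_ne_zero.2 p.2.ne_zero
  have hN : (N : ℝ) ≠ 0 := NeZero.ne _
  refine Subtype.ext (Rep.eq (N := N) (pow_pos p.2.pos 2) (X := diagMat ((p : ℕ) ^ 2) p p) ?_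
    (by simpa using rep_pd p 1 1))
  unfold Rep
  rw [Nat.cast_pow, Real.sqrt_sq (Nat.cast_nonneg _)]
  ext i j
  rcases i with i | i <;> rcases j with j | j <;> fin_cases i <;> fin_cases j <;>
    simp [t₂, diagSp, realMat, diagMat, coord, scale, mat, hp, hN]

end Paramodular

namespace Paramodular

variable {N : ℕ} [NeZero N] {p : Nat.Primes}

theorem hasModel_pd {i j : ℕ} (hij : i ≤ j) :
    HasModel N ((p : ℕ) ^ (i + j)) (((p : ℕ) : ℤ) ^ i) 1 (pd N p i j).1 := by
  refine ⟨_, pat_diagMat _ _ _ _, rep_pd p i j, ?_, by simp⟩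
  have := dvdMinors_diagMat (dvd_refl ((p : ℕ) ^ i)) (pow_dvd_pow (p : ℕ) hij)
    (pow_add (p : ℕ) i j).symm
  exact_mod_cast this

theorem hasModel_pd_one_one {c : ℤ} (hc : c ∣ (p : ℕ)) :
    HasModel N ((p : ℕ) ^ 2) ((p : ℕ) : ℤ) c (pd N p 1 1).1 := by
  obtain ⟨Y, hY, hr, hd, -⟩ := hasModel_pd (N := N) (p := p) (le_refl 1)
  obtain rfl := hr.eq_model (rep_pd p 1 1)
  exact ⟨_, hY, hr, by simpa using hd, by simp [diagMat, hc]⟩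

/-- Let G and H be models of the two factors. Row 0 of G H is a basis vector, which forces p² to
divide column 1 of H; since the minors of H are divisible by p, so are columns 2 and 3. -/
theorem mul_inv_pd_one_one_mem {i j : ℕ} {d : ℤ} {k s t : Sp} (hs : s ∈ Sigma N) (ht : t ∈ Sigma N)
    (hk : k = s * pd N p 1 1 * t)
    (h : HasModel N ((p : ℕ) ^ (i + j)) d 1 ((pd N p i j).1 * pd N p 1 1 * k⁻¹)) :
    k * (pd N p 1 1 : Sp)⁻¹ ∈ Sigma N := by
  obtain ⟨G, hG, rG, -⟩ := h
  obtain ⟨H, hH, rH, dH, -⟩ := (hasModel_pd_one_one (N := N) (p := p) (one_dvd _)).sigma_mul_mul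
    (one_dvd _) hs ht
  rw [← hk] at rH
  have hprod := rG.mul rH
  rw [inv_mul_cancel_right] at hprod
  have e := hprod.eq_model ((rep_pd p i j).mul (rep_pd p 1 1))
  rw [← diagMat_mul] at e
  have h0 : ∀ l, (G * H) 0 l = ![1, 0, 0, 0] l := by
    intro l
    rw [e]
    fin_cases l <;> simp [diagMat]
  have hm : 0 < (p : ℕ) ^ 2 := pow_pos p.2.pos 2
  have h1 : (G * H) 0 0 = 1 := h0 0
  refine mul_inv_mem_sigma_of_dvd (a := p) (b := p) hm (sq (p : ℕ)).symm
    (by simpa using rep_pd p 1 1) rH (dvd_col_one hm hG rH.symp h1 (h0 1) (h0 2) (h0 3))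
    (dH.dvd_of_row h1 (h0 2)) (dH.dvd_of_row h1 (h0 3))

/-- Now rows 0 and 2 of G H are both basis vectors, and they force p to divide columns 1 and 3 of H.
-/
theorem mul_inv_pd_zero_one_mem {j : ℕ} {d : ℤ} {k s t : Sp} (hs : s ∈ Sigma N) (ht : t ∈ Sigma N)
    (hk : k = s * pd N p 0 1 * t)
    (h : HasModel N ((p : ℕ) ^ (0 + j)) d 1 ((pd N p 0 j).1 * pd N p 0 1 * k⁻¹)) :
    k * (pd N p 0 1 : Sp)⁻¹ ∈ Sigma N := by
  obtain ⟨G, hG, rG, -⟩ := h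
  obtain ⟨H, hH, rH, dH, -⟩ := (hasModel_pd (N := N) (p := p) (zero_le_one' ℕ)).sigma_mul_mul
    (one_dvd _) hs ht
  rw [← hk] at rH
  have hprod := rG.mul rH
  rw [inv_mul_cancel_right] at hprod
  have e := hprod.eq_model ((rep_pd p 0 j).mul (rep_pd p 0 1))
  rw [← diagMat_mul] at e
  have h0 : ∀ l, (G * H) 0 l = ![1, 0, 0, 0] l := by
    intro l
    rw [e]
    fin_cases l <;> simp [diagMat]
  have h2 : ∀ l, (G * H) 2 l = ![0, 0, 1, 0] l := by
    intro l
    rw [e]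
    fin_cases l <;> simp [diagMat]
  have hm : 0 < (p : ℕ) ^ (0 + 1) := pow_pos p.2.pos _
  exact mul_inv_mem_sigma_of_dvd (a := (p : ℕ) ^ 0) (b := (p : ℕ) ^ 1) hm (by simp)
    (rep_pd p 0 1) rH (dvd_col_one hm hG rH.symp (h0 0) (h0 1) (h0 2) (h0 3))
    (fun i => by simp)
    (fun i => by simpa using dvd_col_three hm rH.symp (h2 0) (h2 1) (h2 2) (h2 3) i)

theorem nu_of_rep_of_eq_one {M : Sp} {m : ℕ} {X : Matrix (Fin 4) (Fin 4) ℤ} (hm : 0 < m)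
    (hX : Pat N X) (h : Rep N m X M) (h1 : X 0 0 = 1) : nu N M = m := by
  obtain ⟨Y, hY, hr⟩ := exists_rep_nu (N := N) (mem_bigG_of_rep hm h)
  obtain ⟨k, hk, e, rfl⟩ := exists_eq_smul_of_rep hm hX h hr
  have : k = 1 := by
    have h2 : (k : ℤ) ∣ 1 := ⟨Y 0 0, by simpa using h1.symm⟩
    exact_mod_cast Int.eq_one_of_dvd_one (Int.natCast_nonneg k) h2
  rw [e, this]; simp

theorem nu_pd (i j : ℕ) : nu N (pd N p i j).1 = (p : ℕ) ^ (i + j) :=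
  nu_of_rep_of_eq_one (pow_pos p.2.pos _) (pat_diagMat _ _ _ _) (rep_pd p i j) rfl

theorem exists_pd {M : Sp} (hM : M ∈ Gp N p) (hgood : (p : ℕ) ∣ N → GoodAt N p M) :
    ∃ i j, i ≤ j ∧ nu N M = (p : ℕ) ^ (i + j) ∧ ∃ s ∈ Sigma N, ∃ t ∈ Sigma N,
      M = s * pd N p i j * t := by
  obtain ⟨hMG, r, hr⟩ := id hM
  -- At primes q ≠ p dividing N goodness is automatic, since M is a local unit there.
  obtain ⟨s, hs, t, ht, a, b, hab, hdvd, hrep⟩ := exists_sigma_diag hMG fun q hq => by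
    by_cases hpq : p = q
    · subst hpq
      exact hgood hq
    · exact goodAt_of_mem_unitsAt hq (gp_le_unitsAt N hpq hM)
  rw [hr] at hab
  obtain ⟨i, -, rfl⟩ := (Nat.dvd_prime_pow p.2).1 (Dvd.intro _ hab)
  obtain ⟨j, -, rfl⟩ := (Nat.dvd_prime_pow p.2).1 (Dvd.intro_left _ hab)
  have hij : r = i + j := Nat.pow_right_injective p.2.two_le (by simp only [← hab, pow_add])
  rw [hr, hij] at hrep
  have e := hrep.eq (pow_pos p.2.pos _) (rep_pd p i j)
  refine ⟨i, j, (Nat.pow_dvd_pow_iff_le_right p.2.one_lt).1 hdvd, by rw [hr, hij],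
    s⁻¹, inv_mem hs, t⁻¹, inv_mem ht, ?_⟩
  rw [← e]; group

/-- The minor on rows and columns 0 and 2 of the model is p^i. -/
theorem le_of_hasModel_pd {i j e k : ℕ} {c : ℤ} (he : e = i + j)
    (h : HasModel N ((p : ℕ) ^ e) (((p : ℕ) : ℤ) ^ k) c (pd N p i j).1) : k ≤ i := by
  subst he
  obtain ⟨Y, -, hr, hd, -⟩ := h
  obtain rfl := hr.eq_model (rep_pd p i j)
  have h2 := hd 0 2 0 2
  simp [diagMat] at h2
  exact (Nat.pow_dvd_pow_iff_le_right p.2.one_lt).1 (by exact_mod_cast h2)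

theorem dc_congr {M M' : Gp N p} (h : ∃ s ∈ Sigma N, ∃ t ∈ Sigma N, (M : Sp) = s * M' * t) :
    HeckeCoset.mk (Δ := (Gp N p).toSubmonoid) (Sigma N) (Sigma N) M =
      HeckeCoset.mk (Sigma N) (Sigma N) M' :=
  HeckeAlgebra.mk_eq_mk_iff.2 h

/-- The model of W only links coordinates 0 with 2 and 1 with 3, and for i = 0 the diagonal matrix
is constant on each of these pairs. -/
theorem isW_mul_pd_zero {W : Gp N p} (hW : IsW N p (mat W)) (j : ℕ) : (W : Sp) * pd N p 0 j = pd N p 0 j * W := by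
  obtain ⟨α, β, γ, δ, e, hw, -⟩ := rep_of_isW p.2.pos hW
  have h1 := hw.mul (rep_pd p 0 j)
  have h2 := (rep_pd p 0 j).mul hw
  rw [mul_comm ((p : ℕ) ^ (0 + j))] at h2
  have e : wMat N p α β γ δ * diagMat ((p : ℕ) ^ (0 + j)) ((p : ℕ) ^ 0) ((p : ℕ) ^ j) =
      diagMat ((p : ℕ) ^ (0 + j)) ((p : ℕ) ^ 0) ((p : ℕ) ^ j) * wMat N p α β γ δ := by
    ext i j
    simp only [Matrix.mul_apply, Fin.sum_univ_four]
    fin_cases i <;> fin_cases j <;> simp [wMat, diagMat, mul_comm]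
  rw [e] at h1
  exact h1.eq (Nat.mul_pos p.2.pos (pow_pos p.2.pos _)) h2

section Normalizer

variable {W : Gp N p} (hp : (p : ℕ) ∣ N) (hW : IsW N p (mat W))
include hp hW

theorem isW_mem_wGroup : (W : Sp) ∈ wGroup N := Subgroup.subset_closure ⟨p, hp, hW⟩

theorem dc_isW_mul (M : Gp N p) : dc N p W * dc N p M = dc N p (W * M) :=
  HeckeAlgebra.basis_mul_of_normalizes
    (fun _ => wGroup_conj_mem_sigma (isW_mem_wGroup hp hW))
    fun _ => wGroup_conj_mem_sigma' (isW_mem_wGroup hp hW)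

theorem dc_mul_isW (M : Gp N p) : dc N p M * dc N p W = dc N p (M * W) :=
  HeckeAlgebra.basis_mul_normalizes
    (fun _ => wGroup_conj_mem_sigma (isW_mem_wGroup hp hW))
    fun _ => wGroup_conj_mem_sigma' (isW_mem_wGroup hp hW)

/-- The square of the model is divisible by p, leaving multiplier 1. Thus the double coset of W is
an involution and its inverse need not be adjoined. -/
theorem isW_mul_self_mem : (W : Sp) * W ∈ Sigma N := by
  obtain ⟨α, β, γ, δ, e, hw, -⟩ := rep_of_isW p.2.pos hW
  obtain ⟨n, hn⟩ := hp
  have hn' : (N : ℤ) = (p : ℕ) * n := by exact_mod_cast hn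
  have h := hw.mul hw
  have e2 : wMat N p α β γ δ * wMat N p α β γ δ = ((p : ℕ) : ℤ) •
      !![α * α * p + β * γ * n, 0, β * N * (α + δ), 0;
        0, δ * δ * p + γ * β * n, 0, -γ * N * (α + δ);
        γ * (α + δ), 0, γ * β * n + δ * δ * p, 0;
        0, -β * (α + δ), 0, β * γ * n + α * α * p] := by
    ext i j
    simp only [Matrix.mul_apply, Fin.sum_univ_four]
    fin_cases i <;> fin_cases j <;> simp [wMat, hn'] <;> ring
  rw [e2, ← sq, ← mul_one ((p : ℕ) ^ 2)] at h
  exact mem_sigma_of_rep (h.of_smul p.2.pos)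

theorem dc_isW_mul_mul (M : Gp N p) : dc N p W * (dc N p W * dc N p M) = dc N p M := by
  rw [dc_isW_mul hp hW, dc_isW_mul hp hW]
  refine congrArg HeckeAlgebra.basis (dc_congr ⟨W * W, isW_mul_self_mem hp hW, 1, one_mem _, ?_⟩)
  simp [mul_assoc]

theorem dc_isW_conj (M : Gp N p) :
    dc N p W * dc N p (W * M * W⁻¹) * dc N p W = dc N p M := by
  rw [dc_isW_mul hp hW, dc_mul_isW hp hW]
  refine congrArg HeckeAlgebra.basis (dc_congr ⟨W * W, isW_mul_self_mem hp hW, 1, one_mem _, ?_⟩)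
  simp [mul_assoc]

end Normalizer

end Paramodular

/-! ### Generation by T₁, T₂ and W_p. -/

namespace Paramodular

variable {N : ℕ} [NeZero N] {p : Nat.Primes}

theorem hasModel_invariant {m : ℕ} {d c : ℤ} (hc : c ∣ N) :
    ∀ u ∈ Sigma N, ∀ v ∈ Sigma N, ∀ a, HasModel N m d c a → HasModel N m d c (u * a * v) :=
  fun _ hu _ hv _ h => h.sigma_mul_mul hc hu hv

theorem T₁_eq : T₁ N p = dc N p (pd N p 0 1) := by rw [T₁, t₁_eq_pd]

theorem T₂_eq : T₂ N p = dc N p (pd N p 1 1) := by rw [T₂, t₂_eq_pd]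

theorem dc_mem_supported {m : ℕ} {d c : ℤ} (hc : c ∣ N) {M : Gp N p} (h : HasModel N m d c M) :
    dc N p M ∈ HeckeAlgebra.supported (HasModel N m d c) :=
  HeckeAlgebra.basis_mem_supported (hasModel_invariant hc) (x := (M : (Gp N p).toSubmonoid)) h

theorem mul_T₁_mem_supported {m : ℕ} {d : ℤ} {f : HeckeP N p}
    (hf : f ∈ HeckeAlgebra.supported (HasModel N m d 1)) :
    f * T₁ N p ∈ HeckeAlgebra.supported (HasModel N (m * p) d 1) := by
  have h := hasModel_pd (N := N) (p := p) (zero_le_one' ℕ)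
  rw [zero_add, pow_one, pow_zero] at h
  rw [T₁_eq]
  refine HeckeAlgebra.mul_mem_supported (hasModel_invariant (one_dvd _))
    (hasModel_invariant (one_dvd _)) (fun a b ha hb => ?_) hf (dc_mem_supported (one_dvd _) h)
  simpa using ha.mul (one_dvd _) hb

theorem mul_T₂_mem_supported {m : ℕ} {c d : ℤ} (hc : c ∣ (p : ℕ)) (hc' : c ∣ N) {f : HeckeP N p}
    (hf : f ∈ HeckeAlgebra.supported (HasModel N m d 1)) :
    f * T₂ N p ∈ HeckeAlgebra.supported (HasModel N (m * (p : ℕ) ^ 2) (d * (p : ℕ)) c) := by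
  rw [T₂_eq]
  exact HeckeAlgebra.mul_mem_supported (hasModel_invariant (one_dvd _))
    (hasModel_invariant hc') (fun a b ha hb => ha.mul hc' hb) hf
    (dc_mem_supported hc' (hasModel_pd_one_one hc))

theorem mul_T₁_apply {j : ℕ} {d : ℤ} {f : HeckeP N p}
    (hf : f ∈ HeckeAlgebra.supported (HasModel N ((p : ℕ) ^ (0 + j)) d 1)) :
    (f * T₁ N p) (HeckeCoset.mk (Sigma N) (Sigma N) (pd N p 0 (j + 1))) =
      f (HeckeCoset.mk (Sigma N) (Sigma N) (pd N p 0 j)) := by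
  rw [T₁_eq, ← pd_mul p 0 j 0 1]
  refine HeckeAlgebra.mul_basis_apply_eq (hasModel_invariant (one_dvd _)) (fun k hk h => ?_) hf
  obtain ⟨s, hs, t, ht, hk⟩ := HeckeAlgebra.mem_carrier_mk.1 hk
  exact mul_inv_pd_zero_one_mem hs ht hk h

theorem mul_T₂_apply {i j : ℕ} {d : ℤ} {f : HeckeP N p}
    (hf : f ∈ HeckeAlgebra.supported (HasModel N ((p : ℕ) ^ (i + j)) d 1)) :
    (f * T₂ N p) (HeckeCoset.mk (Sigma N) (Sigma N) (pd N p (i + 1) (j + 1))) =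
      f (HeckeCoset.mk (Sigma N) (Sigma N) (pd N p i j)) := by
  rw [T₂_eq, ← pd_mul p i j 1 1]
  refine HeckeAlgebra.mul_basis_apply_eq (hasModel_invariant (one_dvd _)) (fun k hk h => ?_) hf
  obtain ⟨s, hs, t, ht, hk⟩ := HeckeAlgebra.mem_carrier_mk.1 hk
  exact mul_inv_pd_one_one_mem hs ht hk h

theorem dc_apply_self (M : Gp N p) : dc N p M (HeckeCoset.mk (Sigma N) (Sigma N) M) = 1 := by
  classical
  rw [dc, HeckeAlgebra.basis_apply, if_pos rfl]

theorem pd_zero_zero : pd N p 0 0 = 1 :=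
  Subtype.ext (Rep.eq (N := N) (X := 1) one_pos (by
    have h := rep_pd (N := N) p 0 0
    have e : diagMat ((p : ℕ) ^ (0 + 0)) ((p : ℕ) ^ 0) ((p : ℕ) ^ 0) = 1 := by
      ext i j
      fin_cases i <;> fin_cases j <;> simp [diagMat]
    rw [e] at h
    simpa using h) (rep_one N))

theorem HasModel.not_goodAt_isW_conj (hp : (p : ℕ) ∣ N) {W M : Sp} (hW : IsW N p (mat W)) {d : ℤ}
    (hM : M ∈ bigG) (h : HasModel N (nu N M) d ((p : ℕ) : ℤ) M) :
    ¬ GoodAt N p (W * M * W⁻¹) := by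
  obtain ⟨Y, hY, hr, -, ⟨h1, h2⟩, h3, h4⟩ := h
  obtain ⟨A, B, C, D, rfl⟩ := hY.exists_ofBlocks
  refine Paramodular.not_goodAt_isW_conj hp hW hM hr fun i j => ?_
  fin_cases i <;> fin_cases j
  exacts [h1, h2, h3, h4]

variable {A : Subalgebra ℤ (HeckeP N p)}

theorem dc_mem_of_dc_isW_mul_mem (hp : (p : ℕ) ∣ N) {W : Gp N p} (hW : IsW N p (mat W))
    (hWA : dc N p W ∈ A) {M : Gp N p} (h : dc N p (W * M) ∈ A) : dc N p M ∈ A := by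
  rw [← dc_isW_mul_mul hp hW, dc_isW_mul hp hW M]
  exact mul_mem hWA h

theorem dc_mem_of_dc_isW_conj_mem (hp : (p : ℕ) ∣ N) {W : Gp N p} (hW : IsW N p (mat W))
    (hWA : dc N p W ∈ A) {M : Gp N p} (h : dc N p (W * M * W⁻¹) ∈ A) : dc N p M ∈ A := by
  rw [← dc_isW_conj hp hW]
  exact mul_mem (mul_mem hWA h) hWA

/-- This disposes of the non-leading terms of a product. Terms with smaller ν fall under `low`; good
terms are diagonal, and their minors place them under `high` or make them the leading term; if W
lowers ν, `low` applies to W M. Only good conjugates under W depend on the product considered, and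
they are left to `hconj`. -/
theorem dc_mem_of_hasModel (hWA : (p : ℕ) ∣ N → ∃ W : Gp N p, IsW N p (mat W) ∧ dc N p W ∈ A)
    {i j e : ℕ} (hij : i + j = e)
    (low : ∀ M : Gp N p, nu N M < (p : ℕ) ^ e → dc N p M ∈ A)
    (high : ∀ k l, i < k → k ≤ l → k + l = e → dc N p (pd N p k l) ∈ A) {c : ℤ} (hc : c ∣ N)
    {M : Gp N p} (h : HasModel N ((p : ℕ) ^ e) (((p : ℕ) : ℤ) ^ i) c M)
    (hne : HeckeCoset.mk (Δ := (Gp N p).toSubmonoid) (Sigma N) (Sigma N) M ≠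
      HeckeCoset.mk (Sigma N) (Sigma N) (pd N p i j))
    (hconj : (p : ℕ) ∣ N → ∀ W : Gp N p, IsW N p (mat W) → dc N p W ∈ A →
      GoodAt N p (W * M * (W : Sp)⁻¹) → nu N M = (p : ℕ) ^ e → dc N p M ∈ A) : dc N p M ∈ A := by
  have hdvd : nu N M ∣ (p : ℕ) ^ e := by
    obtain ⟨Y, hY, hr, -⟩ := id h
    exact nu_dvd_of_rep (pow_pos p.2.pos e) hY hr
  rcases (Nat.le_of_dvd (pow_pos p.2.pos e) hdvd).lt_or_eq with hlt | heq
  · exact low M hlt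
  have good : ((p : ℕ) ∣ N → GoodAt N p M) → dc N p M ∈ A := by
    intro hgood
    obtain ⟨k, l, hkl, hnu, s, hs, t, ht, hM⟩ := exists_pd M.2 hgood
    have hkl' : e = k + l := Nat.pow_right_injective p.2.two_le (heq.symm.trans hnu)
    have hmk := dc_congr (M := M) (M' := pd N p k l) ⟨s, hs, t, ht, hM⟩
    have hm : HasModel N ((p : ℕ) ^ e) (((p : ℕ) : ℤ) ^ i) c (pd N p k l).1 := by
      have e1 : (pd N p k l).1 = s⁻¹ * M * t⁻¹ := by rw [hM]; group
      rw [e1]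
      exact h.sigma_mul_mul hc (inv_mem hs) (inv_mem ht)
    rcases (le_of_hasModel_pd hkl' hm).lt_or_eq with hlt | heq'
    · have := high k l hlt hkl hkl'.symm
      rwa [dc, ← hmk] at this
    · subst heq'
      obtain rfl : j = l := by omega
      exact absurd hmk hne
  by_cases hp : (p : ℕ) ∣ N
  · obtain ⟨W, hW, hWA⟩ := hWA hp
    rcases exists_goodAt_isW hp hW M.2.1 with hg | hg | ⟨hlt, -⟩
    · exact good fun _ => hg
    · exact hconj hp W hW hWA hg heq
    · exact dc_mem_of_dc_isW_mul_mem hp hW hWA (low (W * M) (hlt.trans_eq heq))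
  · exact good fun h => absurd h hp

/-- A subalgebra containing `T₁`, `T₂` and (if `p ∣ N`) some `W` contains all double cosets. -/
theorem dc_mem (h₁ : T₁ N p ∈ A) (h₂ : T₂ N p ∈ A)
    (hWA : (p : ℕ) ∣ N → ∃ W : Gp N p, IsW N p (mat W) ∧ dc N p W ∈ A) (e : ℕ) :
    ∀ M : Gp N p, nu N M = (p : ℕ) ^ e → dc N p M ∈ A := by
  induction e using Nat.strong_induction_on with
  | _ e IH =>
  have low : ∀ M : Gp N p, nu N M < (p : ℕ) ^ e → dc N p M ∈ A := by
    intro M hM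
    obtain ⟨-, r, hr⟩ := M.2
    rw [hr] at hM
    exact IH r ((Nat.pow_lt_pow_iff_right p.2.one_lt).1 hM) M hr
  -- For fixed e this is a descending induction on i, with k measuring the distance from the top; k
  -- = 0 is vacuous because i ≤ e.
  have key : ∀ k i j, i ≤ j → i + j = e → e + 1 ≤ i + k → dc N p (pd N p i j) ∈ A := by
    intro k
    induction k with
    | zero => intro i j _ _ h; omega
    | succ k ih =>
      intro i j hle hij hk
      have high : ∀ i' j', i < i' → i' ≤ j' → i' + j' = e → dc N p (pd N p i' j') ∈ A :=
        fun i' j' h1 h2 h3 => ih i' j' h2 h3 (by omega)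
      rcases i with _ | i
      · rcases j with _ | j
        · rw [pd_zero_zero]
          exact one_mem A
        · have hf := dc_mem_supported (p := p) (one_dvd _)
            (hasModel_pd (N := N) (p := p) (Nat.zero_le j))
          have hfA : dc N p (pd N p 0 j) ∈ A := low _ (by
            rw [nu_pd]
            exact Nat.pow_lt_pow_right p.2.one_lt (by omega))
          refine HeckeAlgebra.basis_mem_of_coeff_eq_one (S := A.toSubring.toAddSubgroup)
            (f := dc N p (pd N p 0 j) * T₁ N p) (A.mul_mem hfA h₁)
            ((mul_T₁_apply hf).trans (dc_apply_self _)) fun M hM hne => ?_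
          have hM' := mul_T₁_mem_supported hf M hM
          rw [← pow_succ, show 0 + j + 1 = e by omega] at hM'
          refine dc_mem_of_hasModel hWA hij low high (one_dvd _) hM' hne ?_
          -- Let W M W⁻¹ have diagonal type (i', j'). If i' = 0, then W commutes with this diagonal
          -- element and normalizes Σ_N, so M would be the leading term. If i' > 0, the conjugate
          -- falls under `high`.
          intro hp W hW hW' hg hnu
          have hnu' := nu_conj p.2.pos hp hW M.2.1
          obtain ⟨i', j', hij', hnu2, s, hs, t, ht, e2⟩ := exists_pd
            (M := W * M * (W : Sp)⁻¹) (mul_mem (mul_mem W.2 M.2) (inv_mem W.2)) fun _ => hg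
          have he : e = i' + j' :=
            Nat.pow_right_injective p.2.two_le (hnu.symm.trans (hnu'.symm.trans hnu2))
          have hmk := dc_congr (M := W * M * W⁻¹) (M' := pd N p i' j') ⟨s, hs, t, ht, e2⟩
          rcases Nat.eq_zero_or_pos i' with h0 | h0
          · subst h0
            obtain rfl : j' = j + 1 := by omega
            refine absurd (dc_congr ⟨(W : Sp)⁻¹ * s * W,
              wGroup_conj_mem_sigma' (isW_mem_wGroup hp hW) hs, (W : Sp)⁻¹ * t * W,
              wGroup_conj_mem_sigma' (isW_mem_wGroup hp hW) ht, ?_⟩) hne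
            have e3 : (M : Sp) = (W : Sp)⁻¹ * (W * M * (W : Sp)⁻¹) * W := by group
            have e4 : (pd N p 0 (j + 1) : Sp) = (W : Sp)⁻¹ * (W * pd N p 0 (j + 1)) := by group
            rw [isW_mul_pd_zero hW] at e4
            rw [e3, e2]
            conv_rhs => rw [e4]
            group
          · have := high i' j' h0 hij' he.symm
            rw [dc, ← hmk] at this
            exact dc_mem_of_dc_isW_conj_mem hp hW hW' this
      · rcases j with _ | j
        · omega
        have hf := dc_mem_supported (p := p) (one_dvd _)
          (hasModel_pd (N := N) (p := p) (Nat.le_of_succ_le_succ hle))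
        have hfA : dc N p (pd N p i j) ∈ A := low _ (by
          rw [nu_pd]
          exact Nat.pow_lt_pow_right p.2.one_lt (by omega))
        -- For p ∣ N the lower right block of the model of T₂ is divisible by p. All terms of the
        -- product inherit this at multiplier p^e, which rules out good conjugates under W.
        obtain ⟨c, hcp, hcN, hc⟩ : ∃ c : ℤ, c ∣ (p : ℕ) ∧ c ∣ N ∧ ((p : ℕ) ∣ N → c = (p : ℕ)) := by
          by_cases hp : (p : ℕ) ∣ N
          · exact ⟨(p : ℕ), dvd_rfl, Int.natCast_dvd_natCast.2 hp, fun _ => rfl⟩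
          · exact ⟨1, one_dvd _, one_dvd _, fun h => absurd h hp⟩
        refine HeckeAlgebra.basis_mem_of_coeff_eq_one (S := A.toSubring.toAddSubgroup)
          (f := dc N p (pd N p i j) * T₂ N p) (A.mul_mem hfA h₂)
          ((mul_T₂_apply hf).trans (dc_apply_self _)) fun M hM hne => ?_
        have hM' := mul_T₂_mem_supported hcp hcN hf M hM
        rw [← pow_succ, ← pow_add, show i + j + 2 = e by omega] at hM'
        refine dc_mem_of_hasModel hWA hij low high hcN hM' hne ?_
        intro hp W hW hW' hg hnu
        rw [← hnu, hc hp] at hM'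
        exact absurd hg (hM'.not_goodAt_isW_conj hp hW M.2.1)
  intro M hM
  have good : ∀ M : Gp N p, nu N M = (p : ℕ) ^ e → ((p : ℕ) ∣ N → GoodAt N p M) →
      dc N p M ∈ A := by
    intro M hM hgood
    obtain ⟨i, j, hij, hnu, s, hs, t, ht, e1⟩ := exists_pd M.2 hgood
    have he : e = i + j := Nat.pow_right_injective p.2.two_le (hM.symm.trans hnu)
    have := key (e + 1) i j hij he.symm (by omega)
    rwa [dc, ← dc_congr ⟨s, hs, t, ht, e1⟩] at this
  by_cases hp : (p : ℕ) ∣ N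
  · obtain ⟨W, hW, hWA⟩ := hWA hp
    rcases exists_goodAt_isW hp hW M.2.1 with hg | hg | ⟨hlt, -⟩
    · exact good M hM fun _ => hg
    · refine dc_mem_of_dc_isW_conj_mem hp hW hWA (good _ ?_ fun _ => hg)
      rw [← hM]
      exact nu_conj p.2.pos hp hW M.2.1
    · exact dc_mem_of_dc_isW_mul_mem hp hW hWA (low (W * M) (hlt.trans_eq hM))
  · exact good M hM fun h => absurd h hp

theorem eq_top_of_mem (h₁ : T₁ N p ∈ A) (h₂ : T₂ N p ∈ A)
    (hWA : (p : ℕ) ∣ N → ∃ W : Gp N p, IsW N p (mat W) ∧ dc N p W ∈ A) : A = ⊤ := by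
  refine Algebra.eq_top_iff.2 fun f => ?_
  refine HeckeAlgebra.closure_basis (S := A.toSubring.toAddSubgroup) (fun D => ?_) f
  induction D using HeckeAlgebra.coset_ind with
  | h M =>
  obtain ⟨e, he⟩ := M.2.2
  exact dc_mem h₁ h₂ hWA e M he

end Paramodular

/-! ### Linear independence of the monomials, and commutativity. -/

namespace Paramodular

variable {N : ℕ} [NeZero N] {p : Nat.Primes}

theorem T₁_pow_mem_supported (a : ℕ) :
    T₁ N p ^ a ∈ HeckeAlgebra.supported (HasModel N ((p : ℕ) ^ (0 + a)) (((p : ℕ) : ℤ) ^ 0) 1) := by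
  induction a with
  | zero =>
    have h := dc_mem_supported (p := p) (one_dvd _) (hasModel_pd (N := N) (p := p) (le_refl 0))
    rw [pd_zero_zero] at h
    rw [pow_zero (T₁ N p)]
    exact h
  | succ a ih =>
    rw [pow_succ (T₁ N p), ← add_assoc, pow_succ (p : ℕ)]
    exact mul_T₁_mem_supported ih

theorem T₁_pow_mul_T₂_pow_mem_supported (a b : ℕ) :
    T₁ N p ^ a * T₂ N p ^ b ∈ HeckeAlgebra.supported
      (HasModel N ((p : ℕ) ^ (b + (a + b))) (((p : ℕ) : ℤ) ^ b) 1) := by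
  induction b with
  | zero =>
    rw [pow_zero (T₂ N p), mul_one]
    exact T₁_pow_mem_supported a
  | succ b ih =>
    rw [pow_succ (T₂ N p), ← mul_assoc, show b + 1 + (a + (b + 1)) = b + (a + b) + 2 by ring,
      pow_add _ _ 2, pow_succ _ b]
    exact mul_T₂_mem_supported (one_dvd _) (one_dvd _) ih

theorem T₁_pow_apply (a : ℕ) :
    (T₁ N p ^ a) (HeckeCoset.mk (Sigma N) (Sigma N) (pd N p 0 a)) = 1 := by
  induction a with
  | zero =>
    rw [pow_zero, pd_zero_zero]
    exact dc_apply_self 1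
  | succ a ih => rw [pow_succ, mul_T₁_apply (T₁_pow_mem_supported a), ih]

theorem T₁_pow_mul_T₂_pow_apply (a b : ℕ) :
    (T₁ N p ^ a * T₂ N p ^ b) (HeckeCoset.mk (Sigma N) (Sigma N) (pd N p b (a + b))) = 1 := by
  induction b with
  | zero => rw [pow_zero, mul_one, add_zero, T₁_pow_apply]
  | succ b ih =>
    rw [pow_succ, ← mul_assoc, ← add_assoc,
      mul_T₂_apply (T₁_pow_mul_T₂_pow_mem_supported a b), ih]

theorem le_of_T₁_pow_mul_T₂_pow_apply_ne_zero {a b c d : ℕ}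
    (h : (T₁ N p ^ a * T₂ N p ^ b) (HeckeCoset.mk (Sigma N) (Sigma N) (pd N p d (c + d))) ≠ 0) :
    c + 2 * d ≤ a + 2 * b ∧ (c + 2 * d = a + 2 * b → b ≤ d) := by
  have hm := T₁_pow_mul_T₂_pow_mem_supported a b _ h
  refine ⟨?_, fun he => le_of_hasModel_pd (by omega) hm⟩
  obtain ⟨Y, hY, hr, -⟩ := hm
  have h2 := nu_dvd_of_rep (pow_pos p.2.pos _) hY hr
  rw [nu_pd] at h2
  have := (Nat.pow_dvd_pow_iff_le_right p.2.one_lt).1 h2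
  omega

theorem linearIndependent_T₁_pow_mul_T₂_pow (N : ℕ) [NeZero N] (p : Nat.Primes) :
    LinearIndependent ℤ fun e : ℕ × ℕ => T₁ N p ^ e.1 * T₂ N p ^ e.2 := by
  rw [linearIndependent_iff']
  intro s g hg
  by_contra hcon
  push Not at hcon
  obtain ⟨y, hy, hgy⟩ := hcon
  -- Pick a monomial with nonzero coefficient and maximal a + 2b, and among these minimal b. By the
  -- support bound no other monomial in the relation meets its leading double coset.
  obtain ⟨x, hx, hmax⟩ := Finset.exists_max_image (s.filter fun e => g e ≠ 0)
    (fun e => (toLex (e.1 + 2 * e.2, OrderDual.toDual e.2) : ℕ ×ₗ ℕᵒᵈ))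
    ⟨y, Finset.mem_filter.2 ⟨hy, hgy⟩⟩
  obtain ⟨hxs, hgx⟩ := Finset.mem_filter.1 hx
  have h0 := congrArg (HeckeAlgebra.coeffHom
    (HeckeCoset.mk (Sigma N) (Sigma N) (pd N p x.2 (x.1 + x.2)))) hg
  rw [map_sum, map_zero, Finset.sum_eq_single_of_mem x hxs, map_zsmul] at h0
  · have h1 := T₁_pow_mul_T₂_pow_apply (N := N) (p := p) x.1 x.2
    change g x • (T₁ N p ^ x.1 * T₂ N p ^ x.2) _ = 0 at h0
    rw [h1, smul_eq_mul, mul_one] at h0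
    exact hgx h0
  · intro e he hex
    rw [map_zsmul]
    by_contra hne
    have hge : g e ≠ 0 := fun h => hne (by rw [h, zero_smul])
    obtain ⟨h1, h2⟩ := le_of_T₁_pow_mul_T₂_pow_apply_ne_zero fun h =>
      hne ((congrArg (g e • ·) h).trans (smul_zero _))
    have h3 := hmax e (Finset.mem_filter.2 ⟨he, hge⟩)
    rw [Prod.Lex.le_iff] at h3
    rcases h3 with h3 | ⟨h3, h4⟩
    · exact absurd h1 (not_le.2 h3)
    · have h5 : x.2 ≤ e.2 := h4
      have h6 := h2 h3.symm
      have h7 : e.1 + 2 * e.2 = x.1 + 2 * x.2 := h3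
      exact hex (Prod.ext (by omega) (by omega))

/-- A diagonal element is conjugate to its inverse under the paramodular group. -/
theorem exists_inv_pd_eq (i j : ℕ) :
    ∃ w ∈ Sigma N, (pd N p i j : Sp)⁻¹ = w * pd N p i j * w⁻¹ := by
  -- The rotation in both planes exchanges 1 with p^(i+j) and p^i with p^j, which is what inversion
  -- does to the diagonal matrix.
  let J : Matrix (Fin 2) (Fin 2) ℤ := !![0, 1; -1, 0]
  have hJ : J.det = 1 := by simp [J]
  obtain ⟨w, hw, rw'⟩ := exists_mem_sigma (isSp_blk N hJ hJ)
  have hm : 0 < (p : ℕ) ^ (i + j) := pow_pos p.2.pos _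
  have h1 := ((rep_pd (N := N) p i j).diag_inv hm (pow_add _ _ _).symm).mul rw'
  have h2 := rw'.mul (rep_pd (N := N) p i j)
  have e : !![(((p : ℕ) ^ (i + j) : ℕ) : ℤ), 0, 0, 0; 0, 1, 0, 0;
      0, 0, (((p : ℕ) ^ j : ℕ) : ℤ), 0; 0, 0, 0, (((p : ℕ) ^ i : ℕ) : ℤ)] * blk J J =
      blk J J * diagMat ((p : ℕ) ^ (i + j)) ((p : ℕ) ^ i) ((p : ℕ) ^ j) := by
    ext k l
    simp only [Matrix.mul_apply, Fin.sum_univ_four]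
    fin_cases k <;> fin_cases l <;> simp [blk, diagMat, J]
  rw [e, mul_one] at h1
  rw [one_mul] at h2
  refine ⟨w, hw, ?_⟩
  rw [← h1.eq hm h2]
  group

/-- Without a goodness condition at p every double coset contains a diagonal element, which is
conjugate to its inverse under Σ_N; so all double cosets are stable under inversion. -/
theorem mul_comm_of_not_dvd (hp : ¬ (p : ℕ) ∣ N) (x y : HeckeP N p) : x * y = y * x := by
  refine HeckeAlgebra.mul_comm_of_inv_mem (fun D M hM => ?_) x y
  obtain ⟨i, j, -, -, s, hs, t, ht, e⟩ := exists_pd (HeckeAlgebra.carrier_subset D hM)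
    fun h => absurd h hp
  obtain ⟨w, hw, hw'⟩ := exists_inv_pd_eq (N := N) (p := p) i j
  have e2 : M⁻¹ = (t⁻¹ * w * s⁻¹) * M * (t⁻¹ * w⁻¹ * s⁻¹) := by
    rw [e, mul_inv_rev, mul_inv_rev, hw']
    group
  rw [e2]
  exact HeckeAlgebra.mul_mem_carrier (mul_mem (mul_mem (inv_mem ht) hw) (inv_mem hs))
    (mul_mem (mul_mem (inv_mem ht) (inv_mem hw)) (inv_mem hs)) hM

/-- If W and T₂ commuted, W t₂ W⁻¹ would lie in Σ_N t₂ Σ_N and be good at p, since the first block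
of t₂ has corner 1. The lower right block of t₂ is divisible by p, so the conjugate is not good. -/
theorem exists_mul_ne_mul (hN : Squarefree N) (hp : (p : ℕ) ∣ N) :
    ∃ x y : HeckeP N p, x * y ≠ y * x := by
  obtain ⟨W, hW⟩ := exists_isW hN hp
  refine ⟨dc N p W, dc N p (pd N p 1 1), fun h => ?_⟩
  rw [dc_isW_mul hp hW, dc_mul_isW hp hW] at h
  obtain ⟨s, hs, t, ht, e⟩ := HeckeAlgebra.mk_eq_mk_iff.1 (HeckeAlgebra.zBasis.injective h)
  have hgood : GoodAt N p (pd N p 1 1).1 :=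
    ⟨_, _, pow_pos p.2.pos _, pat_diagMat _ _ _ _, rep_pd p 1 1, fun hd =>
      (Nat.prime_iff_prime_int.1 p.2).not_dvd_one (by simpa [diagMat] using hd.1.1)⟩
  have hm := hasModel_pd_one_one (N := N) (p := p) (dvd_refl _)
  rw [show (p : ℕ) ^ 2 = nu N (pd N p 1 1).1 from (nu_pd 1 1).symm] at hm
  refine hm.not_goodAt_isW_conj hp hW (pd N p 1 1).2.1 (hgood.of_locEquiv hp
    (locEquiv_of_sigma hs (wGroup_conj_mem_sigma (isW_mem_wGroup hp hW) ht)) |> fun h' => ?_)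
  have e2 : (W : Sp) * pd N p 1 1 = s * (pd N p 1 1 * W) * t := e
  rw [e2]
  convert h' using 1
  group

end Paramodular

theorem theorem5 (N : ℕ) [NeZero N] (hN : Squarefree N) :
    (∃ Φ : AlgebraTensor (fun p : Nat.Primes => Paramodular.HeckeP N p) ≃+* Paramodular.Hecke N,
      ∀ (p : Nat.Primes) (x : Paramodular.HeckeP N p),
        Φ (AlgebraTensor.of (fun p : Nat.Primes => Paramodular.HeckeP N p) p x) =
          Paramodular.incl N p x) ∧
    ∀ p : Nat.Primes,
      (¬ (p : ℕ) ∣ N →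
        Algebra.adjoin ℤ {Paramodular.T₁ N p, Paramodular.T₂ N p} = ⊤ ∧
        LinearIndependent ℤ fun e : ℕ × ℕ =>
          Paramodular.T₁ N p ^ e.1 * Paramodular.T₂ N p ^ e.2) ∧
      ((p : ℕ) ∣ N →
        (∃ W : Paramodular.Gp N p, Paramodular.IsW N p (Paramodular.mat W)) ∧
        ∀ W : Paramodular.Gp N p, Paramodular.IsW N p (Paramodular.mat W) →
          Algebra.adjoin ℤ {Paramodular.dc N p W, Paramodular.T₁ N p, Paramodular.T₂ N p} = ⊤) ∧
      ((∀ x y : Paramodular.HeckeP N p, x * y = y * x) ↔ ¬ (p : ℕ) ∣ N) := by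
  open Paramodular in
  refine ⟨⟨RingEquiv.ofBijective (tensorHom hN) ⟨tensorHom_injective hN, tensorHom_surjective hN⟩,
    fun p x => tensorHom_of hN p x⟩, fun p => ⟨fun hp => ⟨?_, ?_⟩, fun hp => ⟨?_, ?_⟩, ?_, ?_⟩⟩
  · exact eq_top_of_mem (Algebra.subset_adjoin (by simp)) (Algebra.subset_adjoin (by simp))
      fun h => absurd h hp
  · exact linearIndependent_T₁_pow_mul_T₂_pow N p
  · exact exists_isW hN hp
  · exact fun W hW => eq_top_of_mem (Algebra.subset_adjoin (by simp))
      (Algebra.subset_adjoin (by simp)) fun _ => ⟨W, hW, Algebra.subset_adjoin (by simp)⟩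
  · intro h hp
    obtain ⟨x, y, hxy⟩ := exists_mul_ne_mul hN hp
    exact hxy (h x y)
  · exact fun hp => mul_comm_of_not_dvd hp
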